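/- **Setting.** Let $V$ be a finite-dimensional real vector space, $I$ a finite set, $(\alpha_i)_{i\in I}$ a free family in $V^*$ and $(\alpha_i^\vee)_{i\in I}$ a family in $V$ with $\alpha_i(\alpha_i^\vee)=2$; put $r_i(v)=v-\alpha_i(v)\alpha_i^\vee$, $W^v=\langle r_i\mid i\in I\rangle$, $W^v(J)=\langle r_i\mid i\in J\rangle$ for $J\subset I$, $\Phi=\{w\alpha_i\}$ and $r_{w\alpha_i}=wr_iw^{-1}$. Assume that $(W^v,(r_i))$ is a Coxeter system with length $\ell$, that every root in $\Phi$ is a combination of the $\alpha_i$ with coefficients all $\ge 0$ (positive) or all $\le 0$, that $w\alpha_i$ is positive iff $\ell(wr_i)>\ell(w)$, and that $\Phi\cap\mathbb R_{>0}\alpha=\{\alpha\}$ for $\alpha\in\Phi$. Let $\Delta_{im}\subset V^*\setminus(\{0\}\cup\mathbb R\Phi)$ be stable under $\pm W^v$, consisting of combinations of the $\alpha_i$ with coefficients all $\ge0$ or all $\le0$, those of the first kind being stable under $W^v$; put $\Delta=\Phi\cup\Delta_{im}$. Let $\mathbb A$ be an affine space under $V$ (an origin is chosen, so $\mathbb A=V$)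 with a set $\mathcal M$ of hyperplanes (walls), each of the form $M(\alpha,k)=\{\alpha+k=0\}$ with $\alpha\in\Phi$, infinitely many for each $\alpha\in\Phi$, and stable under the group $W$ generated by the reflections $r_M$ in the walls $M=M(\alpha,k)$ with linear part $r_\alpha$. Put $\Gamma_\alpha=\{k\mid M(\alpha,k)\in\mathcal M\}$ for $\alpha\in\Phi$, $\Gamma_\alpha=\mathbb R$ for $\alpha\in\Delta_{im}$, $D(\alpha,k)=\{\alpha+k\ge0\}$, $D^\circ(\alpha,k)=\{\alpha+k>0\}$, $D(\alpha,\infty)=D^\circ(\alpha,\infty)=\mathbb A$. *Filters.* A set contains a filter if it is a member of it; a map fixes a filter if it fixes pointwise one of its members. The enclosure $cl(F)$ of a filter $F$ is the filter of sets containing a member of $F$ of the form $\bigcap_{\alpha\in\Delta}D(\alpha,k_\alpha)$, $k_\alpha\in\Gamma_\alpha\cup\{\infty\}$. The vectorial facets are the $\pm wF^v(J)$, $w\in W^v$, $J\subset I$, where $F^v(J)=\{v\mid\alpha_i(v)=0\ (i\in J),\ \alpha_i(v)>0\ (i\notin J)\}$; such a facet has type $J$, and it and $J$ are spherical if $W^v(J)$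 is finite. The facet $F(x,F^v)$ is the filter of sets containing an intersection of half-spaces $D(\alpha,k_\alpha)$ or $D^\circ(\alpha,k_\alpha)$ (one $k_\alpha\in\Gamma_\alpha\cup\{\infty\}$ for each $\alpha\in\Delta$) which contains the germ of $x+F^v$ at $x$. A chimney with base the facet $F$ and direction $F^v$ is $cl(F+F^v)$; its germ is the filter of sets containing $cl(F+\xi+F^v)$ for some $\xi\in\overline{F^v}$; it is splayed if $F^v$ is spherical, and solid if the direction of its support (the smallest affine subspace containing it) has finite fixator in $W^v$. The germ of the sector face $x+F^v$ is the filter of sets containing $x+\xi+F^v$ for some $\xi\in\overline{F^v}$. *Masures.* An affine masure of type $\mathbb A$ is a set $\mathcal I$ covered by a set $\mathcal A$ of subsets (apartments) such that: (MA1) each $A\in\mathcal A$ has a set $\mathrm{Isom}(\mathbb A,A)$ of bijections $\mathbb A\to A$ which is a single orbit $f\circ W$ (isomorphisms $A\to A'$ are the maps $f'\circ f^{-1}$; all notions of $\mathbb A$ are transported to $A$); (MA2) if $F$ is a point, the germ at $x$ of an interval $]x,y]$ with $y-x\ne0$ in a vectorial facet, a half-line with nonzero direction vector in a spherical vectorial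 facet, or a solid chimney of $A$, and $A'$ contains $F$, then $A\cap A'\supset cl_A(F)$ and some isomorphism $A\to A'$ fixes $cl_A(F)$; (MA3) a germ $\mathfrak R$ of a splayed chimney and $F$, a facet or a germ of a solid chimney, are contained in a common apartment; (MA4) if $A,A'$ both contain such $\mathfrak R$ and $F$, then $A\cap A'\supset cl_A(\mathfrak R\cup F)$ and some isomorphism $A\to A'$ fixes $cl_A(\mathfrak R\cup F)$. Two germs of spherical sector faces are parallel if, in some apartment containing both, they are germs of $x+F^v$ and $y+F^v$ with the same $F^v$. Let $\mathfrak F^\infty$ be the parallelism class (direction) of the germ of a sector face of spherical type $J$ and sign $\varepsilon=\pm$, and let $\mathcal I(\mathfrak F^\infty)$ be the set of sector-face germs in this class. For $A\in\mathcal A$ let $A(\mathfrak F^\infty)$ be the set of those contained in $A$. For a germ $\mathfrak R$ of a chimney with direction $\mathfrak F^\infty$, let $\mathfrak R_{\mathfrak F^\infty}$ be the filter of subsets of $\mathcal I(\mathfrak F^\infty)$ with base the sets $\{\mathfrak F\in\mathcal I(\mathfrak F^\infty)\mid S\text{ contains }\mathfrak F\}$, $S\in\mathfrak R$. Let $V_J=\bigcap_{i\in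 J}\ker\alpha_i$, let $\mathbb A_J=\mathbb A/V_J$ with walls $\mathcal M_J$ the images of the walls of direction $\ker\alpha$, $\alpha\in\Phi\cap\bigoplus_{i\in J}\mathbb R\alpha_i$, and let $W^J$ be the group of the elements of $W$ with linear part in $W^v(J)$. An $f\in\mathrm{Isom}(\mathbb A,A)$ which sends the direction $\varepsilon F^v(J)$ to $\mathfrak F^\infty$ induces $\bar f:\mathbb A_J\to A(\mathfrak F^\infty)$, $x+V_J\mapsto f(\text{germ of }x+\varepsilon F^v(J))$. **Proposition 4.3.** The set $\mathcal I(\mathfrak F^\infty)$, with facets the filters $\mathfrak R_{\mathfrak F^\infty}$ (for the germs $\mathfrak R$ of chimneys of direction $\mathfrak F^\infty$) and apartments the sets $A(\mathfrak F^\infty)$ (for the $A\in\mathcal A$ containing an element of $\mathcal I(\mathfrak F^\infty)$), is a Euclidean building of type $\mathbb A_J$, called the façade of $\mathcal I$ in the direction $\mathfrak F^\infty$. That is, there is a scalar product on $V/V_J$ such that: * $\mathbb A_J$ is a Euclidean apartment: $\mathcal M_J$ is stable under the orthogonal reflections in its members, and the group generated by the linear parts of these reflections is finite. The group $\overline{W^J}$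 induced by $W^J$ on $\mathbb A_J$ contains the group generated by these reflections and consists of isometries which stabilize $\mathcal M_J$ and have linear part in that finite group. * (I0) The apartments $A(\mathfrak F^\infty)$ cover $\mathcal I(\mathfrak F^\infty)$. For each of them the maps $\bar f$ as above exist, are bijections $\mathbb A_J\to A(\mathfrak F^\infty)$, and form a single orbit under $\overline{W^J}$; each identifies the closed facets of $\mathbb A_J$ (the enclosures, with respect to $\mathcal M_J$, of the germs at $x$ of $x+F'$, for $x\in\mathbb A_J$ and $F'$ a facet of the arrangement of the directions of the walls) with the facets $\mathfrak R_{\mathfrak F^\infty}$ contained in $A(\mathfrak F^\infty)$. * (I1) Any two facets are contained in a common apartment. * (I2) The intersection of two apartments is a union of facets, and for any two facets contained in it there is an isomorphism $\bar f'\circ\bar f^{-1}$ of the first apartment onto the second which fixes both facets. -/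

import Mathlib

open Filter Topology
open scoped Pointwise

/-! ## Euclidean apartments and Euclidean buildings -/

namespace EuclideanBuilding

variable {E : Type*} [AddCommGroup E] [Module ℝ E]

/-- The (affine) Weyl group of a set `walls` of affine hyperplanes of a space with scalar product
`B`: it is generated by the `B`-orthogonal reflections with respect to the walls. -/
def weylGroup (B : LinearMap.BilinForm ℝ E) (walls : Set (Set E)) : Subgroup (E ≃ᵃ[ℝ] E) :=
  Subgroup.closure {s | ∃ (n : E) (c : ℝ), n ≠ 0 ∧ {v | B n v = c} ∈ walls ∧
    ∀ v, s v = v - (2 * (B n v - c) / B n n) • n}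

/-- The vectorial Weyl group, generated by the linear parts of the reflections above. -/
def vectorialWeylGroup (B : LinearMap.BilinForm ℝ E) (walls : Set (Set E)) :
    Subgroup (E ≃ₗ[ℝ] E) :=
  Subgroup.closure {s | ∃ (n : E) (c : ℝ), n ≠ 0 ∧ {v | B n v = c} ∈ walls ∧
    ∀ v, s v = v - (2 * B n v / B n n) • n}

/-- `(E, B, walls)` is a Euclidean apartment: `B` is a scalar product, `walls` is a set of affine
hyperplanes stable under the reflections in its members, and the vectorial Weyl group is finite. -/
structure IsEuclideanApartment (B : LinearMap.BilinForm ℝ E) (walls : Set (Set E)) : Prop where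
  finiteDimensional : FiniteDimensional ℝ E
  symm : ∀ x y, B x y = B y x
  pos : ∀ x, x ≠ 0 → 0 < B x x
  hyperplane : ∀ M ∈ walls, ∃ (n : E) (c : ℝ), n ≠ 0 ∧ M = {v | B n v = c}
  stable : ∀ w ∈ weylGroup B walls, ∀ M ∈ walls, w '' M ∈ walls
  finite : (vectorialWeylGroup B walls : Set (E ≃ₗ[ℝ] E)).Finite

/-- The closed half-spaces bounded by a wall. -/
def halfSpaces (walls : Set (Set E)) : Set (Set E) :=
  {D | ∃ (φ : Module.Dual ℝ E) (k : ℝ), φ ≠ 0 ∧ {v | φ v + k = 0} ∈ walls ∧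
    D = {v | 0 ≤ φ v + k}}

/-- The enclosure of a filter `F`: the filter of sets containing a finite intersection of
half-spaces which are bounded by walls and contain `F`. (The walls of a Euclidean apartment have
finitely many directions, so one half-space for each direction and side amounts to this.) -/
def enclosure (walls : Set (Set E)) (F : Filter E) : Filter E :=
  Filter.generate {D | D ∈ halfSpaces walls ∧ D ∈ F}

/-- The vectorial facet of `u`: all the vectors having the same position as `u` with respect to
every vectorial wall, i.e. every direction of a wall. -/
def vectorialFacet (walls : Set (Set E)) (u : E) : Set E :=
  {u' | ∀ (φ : Module.Dual ℝ E) (k : ℝ), φ ≠ 0 → {v | φ v + k = 0} ∈ walls →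
    SignType.sign (φ u') = SignType.sign (φ u)}

/-- The closed facet attached to the point `x` and the vectorial facet of `u`: the enclosure of the
germ at `x` of `x + vectorialFacet u`. -/
def closedFacet [TopologicalSpace E] (walls : Set (Set E)) (x u : E) : Filter E :=
  enclosure walls (𝓝 x ⊓ 𝓟 ({x} + vectorialFacet walls u))

/-- `Y` with its set `facets` of (closed) facets, which are filters of subsets of `Y`, and its set
`apts` of apartments is a Euclidean building of type the Euclidean apartment `(E, B, walls)`.
For an apartment `A`, `isom A` is the set of isomorphisms of the type onto `A`: it is an orbit of a
group `G` of automorphisms of `(E, B, walls)` containing the Weyl group. An isomorphism `A → A'` is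
a map `f' ∘ f⁻¹` with `f ∈ isom A` and `f' ∈ isom A'`; it fixes a filter if it fixes pointwise
some member of the filter. A set contains a filter if it is a member of this filter. -/
structure IsEuclideanBuilding [TopologicalSpace E] (B : LinearMap.BilinForm ℝ E)
    (walls : Set (Set E)) (G : Subgroup (E ≃ᵃ[ℝ] E)) {Y : Type*} (apts : Set (Set Y))
    (isom : Set Y → Set (E → Y)) (facets : Set (Filter Y)) : Prop where
  apartment : IsEuclideanApartment B walls
  weyl_le : weylGroup B walls ≤ G
  linear_mem : ∀ g ∈ G, g.linear ∈ vectorialWeylGroup B walls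
  isometry : ∀ g ∈ G, ∀ x y, B (g x - g y) (g x - g y) = B (x - y) (x - y)
  walls_stable : ∀ g ∈ G, ∀ M ∈ walls, g '' M ∈ walls
  cover : ⋃₀ apts = Set.univ
  /-- every apartment is a Euclidean apartment isomorphic to the type ... -/
  I0 : ∀ A ∈ apts, (isom A).Nonempty ∧ ∀ f ∈ isom A, Function.Injective f ∧ Set.range f = A ∧
    ∀ g : E → Y, g ∈ isom A ↔ ∃ w ∈ G, g = f ∘ w
  /-- ... in which the facets of `Y` contained in it are the closed facets -/
  I0_facets : ∀ A ∈ apts, ∀ f ∈ isom A, ∀ F : Filter Y,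
    (F ∈ facets ∧ A ∈ F) ↔ ∃ x u : E, F = Filter.map f (closedFacet walls x u)
  /-- two facets are always contained in one apartment -/
  I1 : ∀ F ∈ facets, ∀ F' ∈ facets, ∃ A ∈ apts, A ∈ F ∧ A ∈ F'
  /-- the intersection of two apartments is a union of facets -/
  I2_union : ∀ A ∈ apts, ∀ A' ∈ apts, ∀ y ∈ A ∩ A', ∃ F ∈ facets, pure y ≤ F ∧ A ∩ A' ∈ F
  /-- two facets contained in `A ∩ A'` are fixed by an isomorphism of `A` onto `A'` -/
  I2_isom : ∀ A ∈ apts, ∀ A' ∈ apts, ∀ F ∈ facets, ∀ F' ∈ facets, A ∩ A' ∈ F → A ∩ A' ∈ F' →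
    ∃ f ∈ isom A, ∃ f' ∈ isom A',
      (∃ S ∈ F, ∀ p, f p ∈ S → f' p = f p) ∧ (∃ S ∈ F', ∀ p, f p ∈ S → f' p = f p)

end EuclideanBuilding

/-! ## The vectorial Weyl group and the roots -/

/-- A free family of simple roots `αᵢ` in the dual of `V` and a family of simple coroots in `V`. -/
structure RootBasis (V : Type*) [NormedAddCommGroup V] [NormedSpace ℝ V] (I : Type*) where
  root : I → Module.Dual ℝ V
  coroot : I → V
  root_coroot : ∀ i, root i (coroot i) = 2
  linearIndependent : LinearIndependent ℝ root

namespace RootBasis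

variable {V : Type*} [NormedAddCommGroup V] [NormedSpace ℝ V] {I : Type*} (R : RootBasis V I)

/-- The simple reflection `v ↦ v - αᵢ(v) αᵢ^∨`. -/
def refl (i : I) : V ≃ₗ[ℝ] V := Module.reflection (R.root_coroot i)

/-- The parabolic subgroup `W^v(J)`. -/
def parabolic (J : Set I) : Subgroup (V ≃ₗ[ℝ] V) := Subgroup.closure (R.refl '' J)

/-- The vectorial Weyl group `W^v`. -/
def weyl : Subgroup (V ≃ₗ[ℝ] V) := Subgroup.closure (Set.range R.refl)

/-- The simple reflection as an element of `W^v`. -/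
def reflW (i : I) : R.weyl := ⟨R.refl i, Subgroup.subset_closure ⟨i, rfl⟩⟩

/-- `J` is spherical if `W^v(J)` is finite. -/
def IsSpherical (J : Set I) : Prop := (R.parabolic J : Set (V ≃ₗ[ℝ] V)).Finite

/-- `α` is a real root with coroot `c`: `α = w αᵢ` and `c = w αᵢ^∨` for some `w ∈ W^v` and `i`. -/
def IsRootPair (α : Module.Dual ℝ V) (c : V) : Prop :=
  ∃ w ∈ R.weyl, ∃ i, α = R.root i ∘ₗ (w⁻¹ : V ≃ₗ[ℝ] V).toLinearMap ∧ c = w (R.coroot i)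

/-- The set `Φ` of real roots. -/
def realRoots : Set (Module.Dual ℝ V) := {α | ∃ c, R.IsRootPair α c}

/-- The linear forms which are combinations of simple roots with nonnegative coefficients. -/
def posCone [Fintype I] : Set (Module.Dual ℝ V) :=
  {α | ∃ c : I → ℝ, (∀ i, 0 ≤ c i) ∧ α = ∑ i, c i • R.root i}

/-- The facet `F^v(J)` of the closed fundamental chamber. -/
def fundFacet (J : Set I) : Set V :=
  {v | (∀ i ∈ J, R.root i v = 0) ∧ ∀ i, i ∉ J → 0 < R.root i v}

/-- The vectorial facet `ε w F^v(J)`, of sign `ε` and type `J`. -/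
def facetOf (ε : ℤˣ) (w : V ≃ₗ[ℝ] V) (J : Set I) : Set V :=
  (fun v => ε • w v) '' R.fundFacet J

/-- Vectorial facets, positive or negative. -/
def IsVectorialFacet (F : Set V) : Prop := ∃ ε, ∃ w ∈ R.weyl, ∃ J, F = R.facetOf ε w J

/-- Spherical vectorial facets, positive or negative. -/
def IsSphericalFacet (F : Set V) : Prop :=
  ∃ ε, ∃ w ∈ R.weyl, ∃ J, R.IsSpherical J ∧ F = R.facetOf ε w J

/-- The support `V_J` of `F^v(J)`. -/
def VJ (J : Set I) : Submodule ℝ V := ⨅ i ∈ J, LinearMap.ker (R.root i)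

end RootBasis

/-- The hyperplane `M(α, k)`. -/
def wallOf {V : Type*} [AddCommGroup V] [Module ℝ V] (α : Module.Dual ℝ V) (k : ℝ) : Set V :=
  {v | α v + k = 0}

/-- The closed half-space `D(α, k)`. -/
def halfOf {V : Type*} [AddCommGroup V] [Module ℝ V] (α : Module.Dual ℝ V) (k : ℝ) : Set V :=
  {v | 0 ≤ α v + k}

/-- The open half-space `D°(α, k)`. -/
def openHalfOf {V : Type*} [AddCommGroup V] [Module ℝ V] (α : Module.Dual ℝ V) (k : ℝ) : Set V :=
  {v | 0 < α v + k}

/-- The group generated by the reflections `v ↦ v - (α(v) + k) α^∨` in the hyperplanes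
`M(α, k)` of `walls`, `α` a real root. -/
def RootBasis.affineWeyl {V : Type*} [NormedAddCommGroup V] [NormedSpace ℝ V] {I : Type*}
    (R : RootBasis V I) (walls : Set (Set V)) : Subgroup (V ≃ᵃ[ℝ] V) :=
  Subgroup.closure {s | ∃ (α : Module.Dual ℝ V) (c : V) (k : ℝ), R.IsRootPair α c ∧
    wallOf α k ∈ walls ∧ ∀ v, s v = v - (α v + k) • c}

/-- The model affine apartment `𝔸` in the moderately imaginary case. An origin is chosen in the
affine space, which is thereby identified with its vector space `V`. -/
structure ModelApartment (V : Type*) [NormedAddCommGroup V] [NormedSpace ℝ V]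
    (I : Type*) [Fintype I] extends RootBasis V I where
  /-- `W^v` is a Coxeter group with generators the simple reflections, and the sign of `w αᵢ` is
  given by the length function -/
  coxeter : ∃ (M : CoxeterMatrix I) (cs : CoxeterSystem M toRootBasis.weyl),
    (∀ i, cs.simple i = toRootBasis.reflW i) ∧
    ∀ (w : toRootBasis.weyl) (i : I),
      root i ∘ₗ (w⁻¹ : V ≃ₗ[ℝ] V).toLinearMap ∈ toRootBasis.posCone ↔
        cs.length w < cs.length (w * toRootBasis.reflW i)
  /-- every real root is positive or negative -/
  pos_or_neg : ∀ α ∈ toRootBasis.realRoots, α ∈ toRootBasis.posCone ∨ -α ∈ toRootBasis.posCone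
  /-- the only positive multiple of a real root which is a real root is this root -/
  reduced : ∀ α ∈ toRootBasis.realRoots, ∀ c : ℝ, 0 < c → c • α ∈ toRootBasis.realRoots → c = 1
  /-- the set of imaginary roots -/
  imRoots : Set (Module.Dual ℝ V)
  im_ne_zero : (0 : Module.Dual ℝ V) ∉ imRoots
  im_disjoint : ∀ α ∈ toRootBasis.realRoots, ∀ c : ℝ, c • α ∉ imRoots
  im_neg : ∀ α ∈ imRoots, -α ∈ imRoots
  im_pos_or_neg : ∀ α ∈ imRoots, α ∈ toRootBasis.posCone ∨ -α ∈ toRootBasis.posCone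
  im_stable : ∀ α ∈ imRoots, ∀ w ∈ toRootBasis.weyl,
    α ∘ₗ (w⁻¹ : V ≃ₗ[ℝ] V).toLinearMap ∈ imRoots
  im_pos_stable : ∀ α ∈ imRoots, α ∈ toRootBasis.posCone → ∀ w ∈ toRootBasis.weyl,
    α ∘ₗ (w⁻¹ : V ≃ₗ[ℝ] V).toLinearMap ∈ toRootBasis.posCone
  /-- the set of (real) walls -/
  walls : Set (Set V)
  wall_eq : ∀ M ∈ walls, ∃ α ∈ toRootBasis.realRoots, ∃ k, M = wallOf α k
  infinite_walls : ∀ α ∈ toRootBasis.realRoots, {k | wallOf α k ∈ walls}.Infinite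
  walls_stable : ∀ w ∈ toRootBasis.affineWeyl walls, ∀ M ∈ walls, w '' M ∈ walls

namespace ModelApartment

variable {V : Type*} [NormedAddCommGroup V] [NormedSpace ℝ V] {I : Type*} [Fintype I]
  (𝔸 : ModelApartment V I)

/-- The affine Weyl group `W`. -/
def W : Subgroup (V ≃ᵃ[ℝ] V) := 𝔸.affineWeyl 𝔸.walls

/-- The set `Δ` of all roots. -/
def roots : Set (Module.Dual ℝ V) := 𝔸.realRoots ∪ 𝔸.imRoots

/-- The set `Γ_α`: the `k` such that `M(α, k)` is a wall, and all of `ℝ` for `α` imaginary. -/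
def Gam (α : Module.Dual ℝ V) : Set ℝ :=
  {k | (α ∈ 𝔸.realRoots ∧ wallOf α k ∈ 𝔸.walls) ∨ α ∈ 𝔸.imRoots}

/-- The enclosure `cl(F)`: the filter of sets containing a member of `F` of the form
`⋂_{α ∈ Δ} D(α, k_α)`, with one `k_α ∈ Γ_α ∪ {∞}` for each root `α`, where `D(α, ∞)` is the whole
space. (These intersections are stable under finite intersections.) -/
def cl (F : Filter V) : Filter V :=
  Filter.generate {S | S ∈ F ∧ ∃ D : Module.Dual ℝ V → Set V,
    (∀ α ∈ 𝔸.roots, D α = Set.univ ∨ ∃ k ∈ 𝔸.Gam α, D α = halfOf α k) ∧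
    S = ⋂ α ∈ 𝔸.roots, D α}

/-- The local facet `germ_x(x + F^v)`. -/
def localFacet (x : V) (Fv : Set V) : Filter V := 𝓝 x ⊓ 𝓟 ({x} + Fv)

/-- The facet `F(x, F^v)`: the filter of sets containing an intersection of half-spaces
`D(α, k_α)` or `D°(α, k_α)`, with one `k_α ∈ Γ_α ∪ {∞}` for each root `α`, this intersection
containing the local facet. -/
def facet (x : V) (Fv : Set V) : Filter V :=
  Filter.generate {S | S ∈ localFacet x Fv ∧ ∃ D : Module.Dual ℝ V → Set V,
    (∀ α ∈ 𝔸.roots, D α = Set.univ ∨ ∃ k ∈ 𝔸.Gam α, D α = halfOf α k ∨ D α = openHalfOf α k) ∧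
    S = ⋂ α ∈ 𝔸.roots, D α}

/-- The support of a filter: the smallest affine subspace containing it. -/
def support (F : Filter V) : AffineSubspace ℝ V :=
  sInf {E : AffineSubspace ℝ V | (E : Set V) ∈ F}

/-- The chimney with base `F(x, F₀^v)` and direction `F^v`, shortened by `ξ`
(`ξ = 0` is the chimney itself): `cl(F(x, F₀^v) + ξ + F^v)`. -/
def chimney (x : V) (F₀ Fv : Set V) (ξ : V) : Filter V :=
  𝔸.cl (𝔸.facet x F₀ + 𝓟 ({ξ} + Fv))

/-- The germ of the chimney: the filter of sets containing one of its shortenings. -/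
def chimneyGerm (x : V) (F₀ Fv : Set V) : Filter V :=
  ⨅ ξ ∈ closure Fv, 𝔸.chimney x F₀ Fv ξ

/-- The chimney is solid: the direction of its support has a finite fixator in `W^v`. -/
def IsSolid (x : V) (F₀ Fv : Set V) : Prop :=
  {w | w ∈ 𝔸.weyl ∧ ∀ v ∈ (support (𝔸.chimney x F₀ Fv 0)).direction, w v = v}.Finite

/-- The germ of the sector face `x + F^v`: the filter of sets containing one of its shortenings
`x + ξ + F^v`. -/
def sectorFaceGerm (x : V) (Fv : Set V) : Filter V :=
  ⨅ ξ ∈ closure Fv, 𝓟 ({x + ξ} + Fv)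

/-- Germs of splayed chimneys: those whose direction is spherical. -/
def IsSplayedChimneyGerm (F : Filter V) : Prop :=
  ∃ x F₀ Fv, 𝔸.IsVectorialFacet F₀ ∧ 𝔸.IsSphericalFacet Fv ∧ F = 𝔸.chimneyGerm x F₀ Fv

/-- Facets and germs of solid chimneys. -/
def IsFacetOrSolidChimneyGerm (F : Filter V) : Prop :=
  (∃ x Fv, 𝔸.IsVectorialFacet Fv ∧ F = 𝔸.facet x Fv) ∨
  ∃ x F₀ Fv, 𝔸.IsVectorialFacet F₀ ∧ 𝔸.IsVectorialFacet Fv ∧ 𝔸.IsSolid x F₀ Fv ∧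
    F = 𝔸.chimneyGerm x F₀ Fv

/-- Points, germs of preordered intervals `]x, x + u)`, generic half-lines and solid chimneys. -/
def IsMA2Filter (F : Filter V) : Prop :=
  (∃ x, F = pure x) ∨
  (∃ x u, u ≠ 0 ∧ (∃ Fv, 𝔸.IsVectorialFacet Fv ∧ u ∈ Fv) ∧
    F = 𝓝 x ⊓ 𝓟 ((fun t : ℝ => x + t • u) '' Set.Ioc 0 1)) ∨
  (∃ x u, u ≠ 0 ∧ (∃ Fv, 𝔸.IsSphericalFacet Fv ∧ u ∈ Fv) ∧
    F = 𝓟 ((fun t : ℝ => x + t • u) '' Set.Ici 0)) ∨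
  ∃ x F₀ Fv, 𝔸.IsVectorialFacet F₀ ∧ 𝔸.IsVectorialFacet Fv ∧ 𝔸.IsSolid x F₀ Fv ∧
    F = 𝔸.chimney x F₀ Fv 0

/-- The walls of `𝔸_J = 𝔸 / V_J`: the images of the walls of `𝔸` whose direction is the kernel
of a root `α ∈ Φ_J`, i.e. a real root in the span of the `αᵢ`, `i ∈ J`. -/
def wallsJ (J : Set I) : Set (Set (V ⧸ 𝔸.VJ J)) :=
  {N | ∃ α ∈ 𝔸.realRoots, α ∈ Submodule.span ℝ (𝔸.root '' J) ∧
    ∃ k, wallOf α k ∈ 𝔸.walls ∧ N = (𝔸.VJ J).mkQ '' wallOf α k}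

/-- The group of affine transformations of `𝔸_J` induced by `W^J`, the subgroup of the elements of
`W` with linear part in `W^v(J)`. -/
def WJ (J : Set I) : Subgroup ((V ⧸ 𝔸.VJ J) ≃ᵃ[ℝ] (V ⧸ 𝔸.VJ J)) where
  carrier := {g | ∃ w ∈ 𝔸.W, w.linear ∈ 𝔸.parabolic J ∧
    ∀ x, g ((𝔸.VJ J).mkQ x) = (𝔸.VJ J).mkQ (w x)}
  one_mem' := ⟨1, one_mem _, one_mem (𝔸.parabolic J), fun _ => rfl⟩
  mul_mem' := by
    rintro g h ⟨w, hw, hwl, hg⟩ ⟨w', hw', hwl', hh⟩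
    refine ⟨w * w', mul_mem hw hw', mul_mem (S := Subgroup (V ≃ₗ[ℝ] V)) hwl hwl', fun x => ?_⟩
    simp only [AffineEquiv.coe_mul, Function.comp_apply, hh, hg]
  inv_mem' := by
    rintro g ⟨w, hw, hwl, hg⟩
    refine ⟨w⁻¹, inv_mem hw, inv_mem (S := Subgroup (V ≃ₗ[ℝ] V)) hwl, fun x => ?_⟩
    rw [AffineEquiv.inv_def, AffineEquiv.symm_apply_eq, hg, AffineEquiv.inv_def,
      AffineEquiv.apply_symm_apply]

end ModelApartment

/-! ## Affine masures -/

/-- An affine masure of type `𝔸` with set of points `X`. For an apartment `A`, `isom A` is the set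
`Isom(𝔸, A)`; the objects of `A` (facets, chimneys, ...) are the images of those of `𝔸` under an
element of `isom A`. An isomorphism of `A` onto `A'` is a map `f' ∘ f⁻¹` with `f ∈ isom A` and
`f' ∈ isom A'`; that it fixes the image under `f` of a filter `F` of `𝔸`, i.e. fixes pointwise
a member of it, means `f =ᶠ[F] f'`, and then `A ∩ A'` contains this image. -/
structure Masure {V : Type*} [NormedAddCommGroup V] [NormedSpace ℝ V] {I : Type*} [Fintype I]
    (𝔸 : ModelApartment V I) (X : Type*) where
  apts : Set (Set X)
  cover : ⋃₀ apts = Set.univ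
  isom : Set X → Set (V → X)
  MA1 : ∀ A ∈ apts, (isom A).Nonempty ∧ ∀ f ∈ isom A, Function.Injective f ∧ Set.range f = A ∧
    ∀ g : V → X, g ∈ isom A ↔ ∃ w ∈ 𝔸.W, g = f ∘ w
  MA2 : ∀ A ∈ apts, ∀ A' ∈ apts, ∀ f ∈ isom A, ∀ F, 𝔸.IsMA2Filter F →
    A' ∈ Filter.map f F → ∃ f' ∈ isom A', f =ᶠ[𝔸.cl F] f'
  MA3 : ∀ A₁ ∈ apts, ∀ A₂ ∈ apts, ∀ f₁ ∈ isom A₁, ∀ f₂ ∈ isom A₂, ∀ R F,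
    𝔸.IsSplayedChimneyGerm R → 𝔸.IsFacetOrSolidChimneyGerm F →
    ∃ A ∈ apts, A ∈ Filter.map f₁ R ∧ A ∈ Filter.map f₂ F
  MA4 : ∀ A ∈ apts, ∀ A' ∈ apts, ∀ f ∈ isom A, ∀ R F,
    𝔸.IsSplayedChimneyGerm R → 𝔸.IsFacetOrSolidChimneyGerm F →
    A' ∈ Filter.map f R → A' ∈ Filter.map f F → ∃ f' ∈ isom A', f =ᶠ[𝔸.cl (R ⊔ F)] f'

namespace Masure

variable {V : Type*} [NormedAddCommGroup V] [NormedSpace ℝ V] {I : Type*} [Fintype I]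
  {𝔸 : ModelApartment V I} {X : Type*} (ℐ : Masure 𝔸 X)

/-- `F` is the germ of a sector face of sign `ε` and type `J`. -/
def IsSectorFaceGerm (ε : ℤˣ) (J : Set I) (F : Filter X) : Prop :=
  ∃ A ∈ ℐ.apts, ∃ f ∈ ℐ.isom A, ∃ x, ∃ w ∈ 𝔸.weyl,
    F = Filter.map f (ModelApartment.sectorFaceGerm x (𝔸.facetOf ε w J))

/-- Two germs of spherical sector faces are parallel if they have the same direction in some
apartment containing both. -/
def Parallel (F F' : Filter X) : Prop :=
  ∃ A ∈ ℐ.apts, ∃ f ∈ ℐ.isom A, ∃ (x y : V) (Fv : Set V), 𝔸.IsSphericalFacet Fv ∧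
    F = Filter.map f (ModelApartment.sectorFaceGerm x Fv) ∧
    F' = Filter.map f (ModelApartment.sectorFaceGerm y Fv)

/-- The façade `ℐ(𝔉^∞)` in the direction `𝔉^∞` of the germ `F₀`, i.e. its class for the
parallelism: the set of germs of sector faces parallel to `F₀`. -/
def Facade (F₀ : Filter X) : Type _ := {F : Filter X // ℐ.Parallel F₀ F}

/-- The set `A(𝔉^∞)` of the elements of the façade which are contained in `A`. -/
def facadeApt (F₀ : Filter X) (A : Set X) : Set (ℐ.Facade F₀) := {F | A ∈ F.1}

/-- The apartments of the façade: the `A(𝔉^∞)` for the apartments `A` containing an element of the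
façade. -/
def facadeApts (F₀ : Filter X) : Set (Set (ℐ.Facade F₀)) :=
  {B | ∃ A ∈ ℐ.apts, (ℐ.facadeApt F₀ A).Nonempty ∧ B = ℐ.facadeApt F₀ A}

/-- The identifications of `𝔸_J` with the apartment `B` of the façade: the maps induced by
those isomorphisms `f` of `𝔸` onto an apartment `A` with `B = A(𝔉^∞)` which send the direction
`ε F^v(J)` to `𝔉^∞`; the class of `x` is sent to the image under `f` of the germ of
`x + ε F^v(J)`. -/
def facadeIsom (ε : ℤˣ) (J : Set I) (F₀ : Filter X) (B : Set (ℐ.Facade F₀)) :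
    Set ((V ⧸ 𝔸.VJ J) → ℐ.Facade F₀) :=
  {g | ∃ A ∈ ℐ.apts, B = ℐ.facadeApt F₀ A ∧ ∃ f ∈ ℐ.isom A, ∀ x : V,
    (g ((𝔸.VJ J).mkQ x)).1 =
      Filter.map f (ModelApartment.sectorFaceGerm x (𝔸.facetOf ε 1 J))}

/-- `R` is the germ of a (splayed) chimney with direction the direction of `F₀`. -/
def IsChimneyGermOfDirection (F₀ R : Filter X) : Prop :=
  ∃ A ∈ ℐ.apts, ∃ f ∈ ℐ.isom A, ∃ x F₁ Fv, 𝔸.IsVectorialFacet F₁ ∧ 𝔸.IsSphericalFacet Fv ∧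
    R = Filter.map f (𝔸.chimneyGerm x F₁ Fv) ∧
    ℐ.Parallel F₀ (Filter.map f (ModelApartment.sectorFaceGerm x Fv))

/-- The filter of subsets of the façade attached to a filter `R` on `X`: a base is formed by the
sets of all elements of the façade contained in `S`, for `S ∈ R`. -/
def facadeFilter (F₀ R : Filter X) : Filter (ℐ.Facade F₀) :=
  R.lift' fun S => {F | S ∈ F.1}

/-- The facets of the façade. -/
def facadeFacets (F₀ : Filter X) : Set (Filter (ℐ.Facade F₀)) :=
  {𝓕 | ∃ R, ℐ.IsChimneyGermOfDirection F₀ R ∧ 𝓕 = ℐ.facadeFilter F₀ R}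

end Masure

/-! ## The vectorial Weyl group -/

/-! Let `f` be an isomorphism of the model onto an apartment which sends `ε F^v(J)` to the given
direction. As `F^v(J)` is an open cone of `V_J`, the germ of `x + ε F^v(J)` determines `x` modulo
`V_J` and nothing more (`germ_add`, `sub_mem_VJ_of_germ_eq`), so `f` embeds `V / V_J` in the façade.
Sphericity of `J` makes this picture Euclidean. The roots vanishing at a point of the facet are
those of `Φ_J`, finitely many and all real (`mem_rootsJ_of_apply_eq_zero`, `rootsJ_finite`). The
roots which are positive at this point, possibly infinite in number, are nonnegative on one common
ball, because a neighbourhood of the point lies in the Tits cone (`exists_ball_nonneg`). So far out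
in the direction an enclosed set is seen only through its half-spaces for `Φ_J`
(`IsHalfFamily.mem_germ_iff`), and germs of chimneys of this direction turn into closed facets of `V
/ V_J` (`Induces.facadeFilter_eq`). Averaging over the finite group `W^v(J)` gives the scalar
product.

A chimney of this direction is both splayed and solid (`isSolid_dir`), so (MA3) and (MA4) apply to
any two of them. (MA3) yields (I1). (MA4) yields the isomorphisms of (I2), once it is known that an
apartment whose façade contains a facet contains a chimney germ defining this facet
(`Induces.exists_chim`). The latter is a convexity argument: from two germs in the apartment, (MA4)
produces an enclosed set containing both, hence a chimney germ spanning the segment between them.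

Two facts need separate arguments. Transitivity of parallelism: in one apartment parallel means
equal direction (`facetOf_eq_of_par`), and parallelism to a fixed germ is locally constant along a
line of germs, hence constant (`par_iff_par`). Comparison of two apartments with the same façade
apartment: isomorphisms fixing a common chimney germ based at a chamber all induce the same map,
since an element of `W^v(J)` fixing a regular vector modulo `V_J` is trivial (`Induces.exists_WJ`).
-/

theorem linearEquiv_inv_apply {V : Type*} [AddCommGroup V] [Module ℝ V] (w : V ≃ₗ[ℝ] V) (v : V) :
    w⁻¹ v = w.symm v := rfl

namespace RootBasis

variable {V : Type*} [NormedAddCommGroup V] [NormedSpace ℝ V] {I : Type*} (R : RootBasis V I)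

theorem refl_apply (i : I) (v : V) : R.refl i v = v - R.root i v • R.coroot i :=
  Module.reflection_apply _ _

theorem refl_refl (i : I) (v : V) : R.refl i (R.refl i v) = v :=
  Module.involutive_reflection (R.root_coroot i) v

theorem refl_mul_self (i : I) : R.refl i * R.refl i = 1 := by
  ext v
  exact R.refl_refl i v

theorem refl_mem_weyl (i : I) : R.refl i ∈ R.weyl := Subgroup.subset_closure ⟨i, rfl⟩

theorem parabolic_le_weyl (J : Set I) : R.parabolic J ≤ R.weyl :=
  Subgroup.closure_mono (Set.image_subset_range _ _)

theorem mem_VJ {J : Set I} {v : V} : v ∈ R.VJ J ↔ ∀ j ∈ J, R.root j v = 0 := by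
  simp [VJ]

theorem parabolic_apply_of_mem_VJ {J : Set I} {w : V ≃ₗ[ℝ] V} (hw : w ∈ R.parabolic J) {v : V}
    (hv : v ∈ R.VJ J) : w v = v := by
  induction hw using Subgroup.closure_induction with
  | mem x hx =>
    obtain ⟨j, hj, rfl⟩ := hx
    rw [refl_apply, R.mem_VJ.1 hv j hj]
    simp
  | one => rfl
  | mul x y _ _ hx hy => rw [LinearEquiv.mul_apply, hy, hx]
  | inv x _ hx =>
    rw [linearEquiv_inv_apply, LinearEquiv.symm_apply_eq, hx]

/-- Duality: finitely many forms span the annihilator of the intersection of their kernels.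
Membership in `Φ_J` is always tested through vanishing on `V_J`. -/
theorem eq_zero_of_vanish_VJ_iff [Finite I] {J : Set I} {α : Module.Dual ℝ V} :
    α ∈ Submodule.span ℝ (R.root '' J) ↔ ∀ v ∈ R.VJ J, α v = 0 := by
  constructor
  · intro h v hv
    induction h using Submodule.span_induction with
    | mem x hx =>
      obtain ⟨j, hj, rfl⟩ := hx
      exact R.mem_VJ.1 hv j hj
    | zero => rfl
    | add x y _ _ hx hy => simp [hx, hy]
    | smul a x _ hx => simp [hx]
  · intro h
    have := mem_span_of_iInf_ker_le_ker (L := fun j : J => R.root j) (K := α) (by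
      intro v hv
      refine h v (R.mem_VJ.2 fun j hj => ?_)
      simp only [Submodule.mem_iInf, LinearMap.mem_ker] at hv
      exact hv ⟨j, hj⟩)
    rwa [Set.image_eq_range]

/-- The simple roots are free, so the prescribed values define a form on their span; it extends to
the dual of `V` and is evaluation at a vector by reflexivity. -/
theorem exists_root_eq [FiniteDimensional ℝ V] (c : I → ℝ) : ∃ v, ∀ i, R.root i v = c i := by
  let b := Module.Basis.span R.linearIndependent
  obtain ⟨g, hg⟩ := LinearMap.exists_extend (b.constr ℝ c)
  refine ⟨(Module.evalEquiv ℝ V).symm g, fun i => ?_⟩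
  have h1 : Module.evalEquiv ℝ V ((Module.evalEquiv ℝ V).symm g) = g := by simp
  have h2 : R.root i ((Module.evalEquiv ℝ V).symm g) = g (R.root i) := by
    conv_rhs => rw [← h1]
    rfl
  rw [h2]
  have h3 := congrArg (fun F => F (b i)) hg
  simp only [LinearMap.comp_apply, Module.Basis.constr_basis, Submodule.subtype_apply] at h3
  rw [← h3]
  congr 1
  exact (congrArg Subtype.val (Module.Basis.span_apply R.linearIndependent i)).symm

theorem fundFacet_nonempty [FiniteDimensional ℝ V] (J : Set I) : (R.fundFacet J).Nonempty := by
  classical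
  obtain ⟨v, hv⟩ := R.exists_root_eq (fun i => if i ∈ J then 0 else 1)
  refine ⟨v, fun i hi => by rw [hv, if_pos hi], fun i hi => by rw [hv, if_neg hi]; exact one_pos⟩

theorem fundFacet_subset_VJ (J : Set I) : R.fundFacet J ⊆ R.VJ J := fun _ hv => R.mem_VJ.2 hv.1

theorem IsRootPair.comp {α : Module.Dual ℝ V} {c : V} (h : R.IsRootPair α c) {w : V ≃ₗ[ℝ] V}
    (hw : w ∈ R.weyl) : R.IsRootPair (α ∘ₗ w.toLinearMap) (w⁻¹ c) := by
  obtain ⟨u, hu, i, rfl, rfl⟩ := h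
  refine ⟨w⁻¹ * u, mul_mem (inv_mem hw) hu, i, ?_, rfl⟩
  ext v
  simp only [LinearMap.comp_apply, LinearEquiv.coe_coe, mul_inv_rev, inv_inv,
    LinearEquiv.mul_apply]

theorem comp_mem_realRoots {α : Module.Dual ℝ V} (h : α ∈ R.realRoots) {w : V ≃ₗ[ℝ] V}
    (hw : w ∈ R.weyl) : α ∘ₗ w.toLinearMap ∈ R.realRoots := by
  obtain ⟨c, hc⟩ := h
  exact ⟨_, hc.comp R hw⟩

theorem IsRootPair.apply {α : Module.Dual ℝ V} {c : V} (h : R.IsRootPair α c) : α c = 2 := by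
  obtain ⟨u, hu, i, rfl, rfl⟩ := h
  simp only [LinearMap.comp_apply, LinearEquiv.coe_coe]
  rw [linearEquiv_inv_apply, LinearEquiv.symm_apply_apply, R.root_coroot]

theorem isRootPair_simple (i : I) : R.IsRootPair (R.root i) (R.coroot i) :=
  ⟨1, one_mem _, i, rfl, rfl⟩

theorem root_mem_realRoots (i : I) : R.root i ∈ R.realRoots := ⟨_, R.isRootPair_simple i⟩

theorem IsRootPair.exists_refl {α : Module.Dual ℝ V} {c : V} (h : R.IsRootPair α c) :
    ∃ s ∈ R.weyl, ∀ v, s v = v - α v • c := by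
  obtain ⟨u, hu, i, rfl, rfl⟩ := h
  refine ⟨u * R.refl i * u⁻¹, mul_mem (mul_mem hu (R.refl_mem_weyl i)) (inv_mem hu), fun v => ?_⟩
  rw [LinearEquiv.mul_apply, LinearEquiv.mul_apply, refl_apply, map_sub, map_smul,
    linearEquiv_inv_apply, LinearEquiv.apply_symm_apply]
  rfl

theorem ne_zero_of_mem_realRoots {α : Module.Dual ℝ V} (h : α ∈ R.realRoots) : α ≠ 0 := by
  obtain ⟨c, hc⟩ := h
  rintro rfl
  have := hc.apply R
  simp at this

theorem IsRootPair.neg {α : Module.Dual ℝ V} {c : V} (h : R.IsRootPair α c) :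
    R.IsRootPair (-α) (-c) := by
  obtain ⟨s, hs, hsv⟩ := h.exists_refl R
  have h1 := h.comp R hs
  have h2 := h.apply R
  have e1 : α ∘ₗ s.toLinearMap = -α := by
    ext v
    simp only [LinearMap.comp_apply, LinearEquiv.coe_coe, LinearMap.neg_apply]
    rw [hsv, map_sub, map_smul, h2, smul_eq_mul]
    ring
  have e2 : s⁻¹ c = -c := by
    rw [linearEquiv_inv_apply, LinearEquiv.symm_apply_eq, map_neg, hsv, h2, two_smul]
    abel
  rwa [e1, e2] at h1

theorem neg_mem_realRoots {α : Module.Dual ℝ V} (h : α ∈ R.realRoots) : -α ∈ R.realRoots := by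
  obtain ⟨c, hc⟩ := h
  exact ⟨_, hc.neg R⟩

theorem posCone_apply_nonneg [Fintype I] {α : Module.Dual ℝ V} (h : α ∈ R.posCone) {v : V}
    (hv : ∀ i, 0 ≤ R.root i v) : 0 ≤ α v := by
  obtain ⟨c, hc, rfl⟩ := h
  simp only [LinearMap.sum_apply, LinearMap.smul_apply, smul_eq_mul]
  exact Finset.sum_nonneg fun i _ => mul_nonneg (hc i) (hv i)

end RootBasis

/-! ### Stabilizers of dominant vectors and finiteness of `Φ_J`. -/

namespace ModelApartment

variable {V : Type*} [NormedAddCommGroup V] [NormedSpace ℝ V] {I : Type*} [Fintype I]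
  (𝔸 : ModelApartment V I)

/-- An element of `W^v` which sends a vector of the closed fundamental chamber into this chamber
fixes it, and lies in the parabolic subgroup generated by the simple reflections fixing it. -/
theorem eq_and_mem_parabolic_of_dominant {w : V ≃ₗ[ℝ] V} (hw : w ∈ 𝔸.weyl) {v : V}
    (hv : ∀ i, 0 ≤ 𝔸.root i v) (hv' : ∀ i, 0 ≤ 𝔸.root i (w v)) :
    w v = v ∧ w ∈ 𝔸.parabolic {i | 𝔸.root i v = 0} := by
  obtain ⟨M, cs, hs, hl⟩ := 𝔸.coxeter
  suffices H : ∀ n, ∀ w : 𝔸.weyl, cs.length w = n → (∀ i, 0 ≤ 𝔸.root i (w.1 v)) →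
      w.1 v = v ∧ w.1 ∈ 𝔸.parabolic {i | 𝔸.root i v = 0} from H _ ⟨w, hw⟩ rfl hv'
  intro n
  induction n with
  | zero =>
    intro w h _
    rw [cs.length_eq_zero_iff] at h
    subst h
    exact ⟨rfl, one_mem _⟩
  | succ n ih =>
    intro w h hv'
    have hw1 : w ≠ 1 := by
      rintro rfl
      simp at h
    obtain ⟨i, hi⟩ := cs.exists_rightDescent_of_ne_one hw1
    have hi' := hi
    rw [cs.isRightDescent_iff] at hi'
    unfold CoxeterSystem.IsRightDescent at hi
    rw [hs] at hi hi'
    have hn : ¬ (𝔸.root i ∘ₗ (w⁻¹ : V ≃ₗ[ℝ] V).toLinearMap ∈ 𝔸.posCone) := by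
      rw [hl]
      omega
    have hroot : 𝔸.root i ∘ₗ (w⁻¹ : V ≃ₗ[ℝ] V).toLinearMap ∈ 𝔸.realRoots :=
      𝔸.comp_mem_realRoots (𝔸.root_mem_realRoots i) (inv_mem w.2)
    have hneg := (𝔸.pos_or_neg _ hroot).resolve_left hn
    -- The negative root `w αᵢ`, evaluated at the dominant vector `w v`, gives `αᵢ(v) ≤ 0`. Hence
    -- `rᵢ` fixes `v`, and the shorter element `w rᵢ` takes over in the induction.
    have h1 := 𝔸.posCone_apply_nonneg hneg hv'
    simp only [LinearMap.neg_apply, LinearMap.comp_apply, LinearEquiv.coe_coe] at h1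
    rw [linearEquiv_inv_apply, LinearEquiv.symm_apply_apply] at h1
    have h0 : 𝔸.root i v = 0 := le_antisymm (by linarith) (hv i)
    have hr : 𝔸.refl i v = v := by rw [RootBasis.refl_apply, h0]; simp
    have hwr : (w * 𝔸.reflW i).1 v = w.1 v := congrArg w.1 hr
    obtain ⟨e, hm⟩ := ih (w * 𝔸.reflW i) (by omega) (by rwa [hwr])
    rw [hwr] at e
    refine ⟨e, ?_⟩
    have : w.1 = (w * 𝔸.reflW i).1 * 𝔸.refl i := by
      change w.1 = w.1 * 𝔸.refl i * 𝔸.refl i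
      rw [mul_assoc, 𝔸.refl_mul_self, mul_one]
    rw [this]
    exact mul_mem hm (Subgroup.subset_closure ⟨i, h0, rfl⟩)

theorem mem_parabolic_of_apply_mem {J : Set I} {w : V ≃ₗ[ℝ] V} (hw : w ∈ 𝔸.weyl) {v : V}
    (hv : v ∈ 𝔸.fundFacet J) (hwv : w v ∈ 𝔸.fundFacet J) : w ∈ 𝔸.parabolic J := by
  have key : ∀ u ∈ 𝔸.fundFacet J, ∀ i, 0 ≤ 𝔸.root i u := fun u hu i => by
    by_cases h : i ∈ J
    · exact (hu.1 i h).ge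
    · exact (hu.2 i h).le
  have h := (𝔸.eq_and_mem_parabolic_of_dominant hw (key v hv) (key _ hwv)).2
  convert h using 2
  ext i
  constructor
  · exact fun hi => hv.1 i hi
  · intro hi
    by_contra hn
    exact (hv.2 i hn).ne' hi

/-- The real roots which are combinations of the simple roots of index in `J`. -/
def rootsJ (J : Set I) : Set (Module.Dual ℝ V) :=
  {α | α ∈ 𝔸.realRoots ∧ α ∈ Submodule.span ℝ (𝔸.root '' J)}

theorem rootsJ_apply {J : Set I} {α : Module.Dual ℝ V} (h : α ∈ 𝔸.rootsJ J) {v : V}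
    (hv : v ∈ 𝔸.VJ J) : α v = 0 :=
  𝔸.eq_zero_of_vanish_VJ_iff.1 h.2 v hv

theorem root_mem_rootsJ {J : Set I} {j : I} (hj : j ∈ J) : 𝔸.root j ∈ 𝔸.rootsJ J :=
  ⟨𝔸.root_mem_realRoots j, Submodule.subset_span ⟨j, hj, rfl⟩⟩

theorem neg_mem_rootsJ {J : Set I} {α : Module.Dual ℝ V} (h : α ∈ 𝔸.rootsJ J) :
    -α ∈ 𝔸.rootsJ J :=
  ⟨𝔸.neg_mem_realRoots h.1, neg_mem h.2⟩

theorem rootsJ_comp {J : Set I} {α : Module.Dual ℝ V} (h : α ∈ 𝔸.rootsJ J) {w : V ≃ₗ[ℝ] V}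
    (hw : w ∈ 𝔸.parabolic J) : α ∘ₗ w.toLinearMap ∈ 𝔸.rootsJ J := by
  refine ⟨𝔸.comp_mem_realRoots h.1 (𝔸.parabolic_le_weyl J hw),
    𝔸.eq_zero_of_vanish_VJ_iff.2 fun v hv => ?_⟩
  simp only [LinearMap.comp_apply, LinearEquiv.coe_coe]
  rw [𝔸.parabolic_apply_of_mem_VJ hw hv, 𝔸.rootsJ_apply h hv]

/-- The reflection fixes `V_J` pointwise, in particular a point of `F^v(J)`, whose stabilizer is
`W^v(J)`. -/
theorem exists_refl_mem_parabolic [FiniteDimensional ℝ V] {J : Set I} {α : Module.Dual ℝ V} {c : V}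
    (h : 𝔸.IsRootPair α c) (hα : α ∈ Submodule.span ℝ (𝔸.root '' J)) :
    ∃ s ∈ 𝔸.parabolic J, ∀ v, s v = v - α v • c := by
  obtain ⟨s, hs, hsv⟩ := h.exists_refl
  refine ⟨s, ?_, hsv⟩
  obtain ⟨v, hv⟩ := 𝔸.fundFacet_nonempty J
  refine 𝔸.mem_parabolic_of_apply_mem hs hv ?_
  rwa [hsv, 𝔸.eq_zero_of_vanish_VJ_iff.1 hα v (𝔸.fundFacet_subset_VJ J hv), zero_smul, sub_zero]

/-- A root is recovered from its reflection, an element of the finite group `W^v(J)`, together with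
its sign: the reflection fixes the root up to a scalar, the sign makes the scalar positive, and
`reduced` makes it 1. -/
theorem rootsJ_finite [FiniteDimensional ℝ V] {J : Set I} (hJ : 𝔸.IsSpherical J) :
    (𝔸.rootsJ J).Finite := by
  classical
  have key : ∀ α ∈ 𝔸.rootsJ J, ∃ s ∈ 𝔸.parabolic J, ∃ c, α c = 2 ∧ ∀ v, s v = v - α v • c := by
    rintro α ⟨⟨c, hc⟩, h2⟩
    obtain ⟨s, hs, h⟩ := 𝔸.exists_refl_mem_parabolic hc h2
    exact ⟨s, hs, c, hc.apply, h⟩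
  choose! s hs c hc hsv using key
  -- A point of the open fundamental chamber: no real root vanishes there, so it detects the sign of
  -- each of them.
  obtain ⟨v₀, hv₀⟩ := 𝔸.exists_root_eq fun _ => 1
  have hpos : ∀ α ∈ 𝔸.realRoots, α ∈ 𝔸.posCone → 0 < α v₀ := by
    rintro α hα ⟨n, hn, rfl⟩
    have h0 : ∃ i, n i ≠ 0 := by
      by_contra! h
      exact 𝔸.ne_zero_of_mem_realRoots hα (by simp [h])
    obtain ⟨i, hi⟩ := h0
    simp only [LinearMap.sum_apply, LinearMap.smul_apply, smul_eq_mul, hv₀, mul_one]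
    exact Finset.sum_pos' (fun i _ => hn i) ⟨i, Finset.mem_univ _, (hn i).lt_of_ne' hi⟩
  have hinj : Set.InjOn (fun α => (s α, decide (0 < α v₀))) (𝔸.rootsJ J) := by
    intro α hα β hβ h
    simp only [Prod.mk.injEq] at h
    obtain ⟨h1, h2⟩ := h
    have h3 : ∀ v, α v • c α = β v • c β := fun v => by
      have := hsv α hα v
      rw [h1, hsv β hβ v] at this
      exact (sub_right_injective this).symm
    have h4 : ∀ v, 2 * α v = β v * α (c β) := fun v => by
      have := congrArg α (h3 v)
      rw [map_smul, map_smul, hc α hα, smul_eq_mul, smul_eq_mul] at this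
      linarith
    have h5 : α = (α (c β) / 2) • β := by
      ext v
      rw [LinearMap.smul_apply, smul_eq_mul]
      linarith [h4 v]
    set t := α (c β) / 2
    have hsgn : 0 < t := by
      have e : α v₀ = t * β v₀ := by rw [h5]; rfl
      rcases 𝔸.pos_or_neg α hα.1 with ha | ha
      · have ha' := hpos α hα.1 ha
        have hb' : 0 < β v₀ := by simpa [ha'] using h2
        rw [e] at ha'
        exact pos_of_mul_pos_left ha' hb'.le
      · have ha' := hpos _ (𝔸.neg_mem_realRoots hα.1) ha
        rw [LinearMap.neg_apply] at ha'
        have hn : ¬ 0 < β v₀ := by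
          have : ¬ 0 < α v₀ := by linarith
          simpa [this] using h2
        by_contra hcon
        have := mul_nonneg_of_nonpos_of_nonpos (not_lt.1 hcon) (not_lt.1 hn)
        linarith
    have := 𝔸.reduced β hβ.1 t hsgn (h5 ▸ hα.1)
    rw [h5, this, one_smul]
  refine Set.Finite.of_finite_image ?_ hinj
  refine (hJ.prod (Set.finite_univ (α := Bool))).subset ?_
  rintro _ ⟨α, hα, rfl⟩
  exact ⟨hs α hα, trivial⟩

end ModelApartment

/-! ## Open faces of simplicial cones and germs of sector faces -/

section facetCone

variable {V : Type*} [NormedAddCommGroup V] [NormedSpace ℝ V] {I : Type*}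

/-- The cone on which the forms `a i` vanish for `i ∈ J` and are positive for `i ∉ J`. -/
def facetCone (a : I → Module.Dual ℝ V) (J : Set I) : Set V :=
  {v | (∀ i ∈ J, a i v = 0) ∧ ∀ i, i ∉ J → 0 < a i v}

variable {a : I → Module.Dual ℝ V} {J : Set I}

theorem facetCone_smul {v : V} (hv : v ∈ facetCone a J) {t : ℝ} (ht : 0 < t) :
    t • v ∈ facetCone a J :=
  ⟨fun i hi => by rw [map_smul, hv.1 i hi, smul_zero],
    fun i hi => by rw [map_smul]; exact mul_pos ht (hv.2 i hi)⟩

theorem closure_facetCone [FiniteDimensional ℝ V] (hne : (facetCone a J).Nonempty) :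
    closure (facetCone a J) = {v | (∀ i ∈ J, a i v = 0) ∧ ∀ i, i ∉ J → 0 ≤ a i v} := by
  have hcont : ∀ i, Continuous (a i) := fun i => (a i).continuous_of_finiteDimensional
  apply subset_antisymm
  · apply closure_minimal
    · exact fun v hv => ⟨hv.1, fun i hi => (hv.2 i hi).le⟩
    · rw [Set.ofPred_and]
      refine IsClosed.inter ?_ ?_
      · simp only [Set.ofPred_forall]
        exact isClosed_iInter fun i => isClosed_iInter fun _ =>
          isClosed_eq (hcont i) continuous_const
      · simp only [Set.ofPred_forall]
        exact isClosed_iInter fun i => isClosed_iInter fun _ =>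
          isClosed_le continuous_const (hcont i)
  · rintro v ⟨h1, h2⟩
    obtain ⟨u, hu⟩ := hne
    have hlim : Tendsto (fun t : ℝ => v + t • u) (𝓝[>] 0) (𝓝 v) := by
      have : Tendsto (fun t : ℝ => v + t • u) (𝓝 0) (𝓝 (v + (0 : ℝ) • u)) :=
        (by fun_prop : Continuous fun t : ℝ => v + t • u).tendsto 0
      rw [zero_smul, add_zero] at this
      exact this.mono_left nhdsWithin_le_nhds
    refine mem_closure_of_tendsto hlim ?_
    filter_upwards [self_mem_nhdsWithin] with t ht
    refine ⟨fun i hi => ?_, fun i hi => ?_⟩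
    · rw [map_add, map_smul, h1 i hi, hu.1 i hi, smul_zero, add_zero]
    · rw [map_add, map_smul, smul_eq_mul]
      exact add_pos_of_nonneg_of_pos (h2 i hi) (mul_pos ht (hu.2 i hi))

theorem facetCone_add_closure [FiniteDimensional ℝ V] {u v : V} (hu : u ∈ closure (facetCone a J))
    (hv : v ∈ facetCone a J) : u + v ∈ facetCone a J := by
  rw [closure_facetCone ⟨v, hv⟩] at hu
  refine ⟨fun i hi => ?_, fun i hi => ?_⟩
  · rw [map_add, hu.1 i hi, hv.1 i hi, add_zero]
  · rw [map_add]
    exact add_pos_of_nonneg_of_pos (hu.2 i hi) (hv.2 i hi)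

theorem facetCone_add {u v : V} (hu : u ∈ facetCone a J)
    (hv : v ∈ facetCone a J) : u + v ∈ facetCone a J :=
  ⟨fun i hi => by rw [map_add, hu.1 i hi, hv.1 i hi, add_zero],
    fun i hi => by rw [map_add]; exact add_pos (hu.2 i hi) (hv.2 i hi)⟩

theorem closure_facetCone_add [FiniteDimensional ℝ V] (hne : (facetCone a J).Nonempty) {u v : V}
    (hu : u ∈ closure (facetCone a J)) (hv : v ∈ closure (facetCone a J)) :
    u + v ∈ closure (facetCone a J) := by
  rw [closure_facetCone hne] at *
  refine ⟨fun i hi => ?_, fun i hi => ?_⟩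
  · rw [map_add, hu.1 i hi, hv.1 i hi, add_zero]
  · rw [map_add]
    exact add_nonneg (hu.2 i hi) (hv.2 i hi)

theorem zero_mem_closure_facetCone [FiniteDimensional ℝ V] (hne : (facetCone a J).Nonempty) :
    (0 : V) ∈ closure (facetCone a J) := by
  rw [closure_facetCone hne]
  simp

/-- A facet is determined by its closure. -/
theorem mem_facetCone_iff_closure [FiniteDimensional ℝ V] [Finite I]
    (hne : (facetCone a J).Nonempty) {v : V} :
    v ∈ facetCone a J ↔ v ∈ closure (facetCone a J) ∧
      ∀ u ∈ closure (facetCone a J), ∃ δ > (0 : ℝ), v - δ • u ∈ closure (facetCone a J) := by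
  constructor
  · intro hv
    refine ⟨subset_closure hv, fun u hu => ?_⟩
    rw [closure_facetCone hne] at hu ⊢
    have : ∀ᶠ δ in 𝓝[>] (0 : ℝ), ∀ i, i ∉ J → 0 ≤ a i (v - δ • u) := by
      rw [eventually_all]
      intro i
      by_cases hi : i ∈ J
      · simp [hi]
      have h1 : ContinuousAt (fun δ : ℝ => a i v - δ * a i u) 0 := by fun_prop
      have h2 := h1.eventually (lt_mem_nhds (show (0 : ℝ) < a i v - 0 * a i u by
        simpa using hv.2 i hi))
      filter_upwards [nhdsWithin_le_nhds h2] with δ hδ _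
      rw [map_sub, map_smul, smul_eq_mul]
      exact hδ.le
    obtain ⟨δ, h1, h2⟩ := (this.and self_mem_nhdsWithin).exists
    refine ⟨δ, h2, fun i hi => ?_, h1⟩
    rw [map_sub, map_smul, hu.1 i hi, hv.1 i hi, smul_zero, sub_zero]
  · rintro ⟨h1, h2⟩
    obtain ⟨u, hu⟩ := hne
    obtain ⟨δ, hδ, h3⟩ := h2 u (subset_closure hu)
    rw [closure_facetCone ⟨u, hu⟩] at h1 h3
    refine ⟨h1.1, fun i hi => ?_⟩
    have h4 := h3.2 i hi
    rw [map_sub, map_smul, smul_eq_mul] at h4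
    have := mul_pos hδ (hu.2 i hi)
    linarith

/-- The shortening by `ξ + η` refines those by `ξ` and by `η`, so the infimum is directed and a
single shortening suffices. -/
theorem mem_sectorFaceGerm [FiniteDimensional ℝ V] (hne : (facetCone a J).Nonempty) {x : V}
    {S : Set V} : S ∈ ModelApartment.sectorFaceGerm x (facetCone a J) ↔
      ∃ ξ ∈ closure (facetCone a J), ∀ v ∈ facetCone a J, x + ξ + v ∈ S := by
  unfold ModelApartment.sectorFaceGerm
  rw [mem_biInf_of_directed]
  · simp only [mem_principal, Set.singleton_add, Set.image_subset_iff]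
    rfl
  · intro ξ hξ η hη
    have key : ∀ ξ η, ξ ∈ closure (facetCone a J) → η ∈ closure (facetCone a J) →
        𝓟 ({x + (ξ + η)} + facetCone a J) ≤ 𝓟 ({x + ξ} + facetCone a J) := by
      intro ξ η hξ hη
      rw [principal_le_iff]
      intro S hS
      refine subset_trans ?_ hS
      simp only [Set.singleton_add, Set.image_subset_iff]
      intro v hv
      exact ⟨η + v, facetCone_add_closure hη hv, by simp only; abel⟩
    refine ⟨ξ + η, closure_facetCone_add hne hξ hη, key ξ η hξ hη, ?_⟩
    rw [add_comm ξ η]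
    exact key η ξ hη hξ
  · exact ⟨0, zero_mem_closure_facetCone hne⟩

/-- A translate of the first cone contains a translate of the second, hence an open ray in each
direction of the second; directions of such rays lie in the closure of the first cone. -/
theorem closure_subset_of_sectorFaceGerm_eq [FiniteDimensional ℝ V] {b : I → Module.Dual ℝ V}
    {K : Set I} (hne : (facetCone a J).Nonempty) (hne' : (facetCone b K).Nonempty) {x y : V}
    (h : ModelApartment.sectorFaceGerm x (facetCone a J) =
      ModelApartment.sectorFaceGerm y (facetCone b K)) :
    closure (facetCone b K) ⊆ closure (facetCone a J) := by
  apply closure_minimal _ isClosed_closure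
  have h0 : {x} + facetCone a J ∈ ModelApartment.sectorFaceGerm x (facetCone a J) :=
    (mem_sectorFaceGerm hne).2 ⟨0, zero_mem_closure_facetCone hne, fun v hv => by
      rw [add_zero]; exact Set.add_mem_add rfl hv⟩
  rw [h, mem_sectorFaceGerm hne'] at h0
  obtain ⟨η, -, hη⟩ := h0
  intro v hv
  have key : ∀ t : ℝ, 0 < t → y + η + t • v - x ∈ facetCone a J := fun t ht => by
    obtain ⟨x', hx', u, hu, e⟩ := hη _ (facetCone_smul hv ht)
    rw [Set.mem_singleton_iff] at hx'
    subst hx'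
    simp only at e
    rw [← e, add_sub_cancel_left]
    exact hu
  rw [closure_facetCone hne]
  constructor
  · intro i hi
    have h1 := (key 1 one_pos).1 i hi
    have h2 := (key 2 two_pos).1 i hi
    simp only [map_sub, map_add, map_smul, smul_eq_mul] at h1 h2
    linarith
  · intro i hi
    by_contra! hneg
    obtain ⟨t, ht, hlt⟩ : ∃ t : ℝ, 0 < t ∧ a i (y + η - x) + t * a i v < 0 := by
      -- This `t` makes `t * a i v` equal to minus (the absolute value plus 1), so the sum is at
      -- most `-1`.
      refine ⟨(|a i (y + η - x)| + 1) / -(a i v), div_pos (by positivity) (by linarith), ?_⟩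
      have : (|a i (y + η - x)| + 1) / -(a i v) * a i v = -(|a i (y + η - x)| + 1) := by
        rw [div_neg, neg_mul, div_mul_cancel₀ _ hneg.ne]
      rw [this]
      linarith [le_abs_self (a i (y + η - x))]
    have h1 := (key t ht).2 i hi
    have e : y + η + t • v - x = (y + η - x) + t • v := by abel
    rw [e, map_add, map_smul, smul_eq_mul] at h1
    linarith

/-- The germ of a sector face determines its direction. -/
theorem facetCone_eq_of_sectorFaceGerm_eq [FiniteDimensional ℝ V] [Finite I]
    {b : I → Module.Dual ℝ V}
    {K : Set I} (hne : (facetCone a J).Nonempty) (hne' : (facetCone b K).Nonempty) {x y : V}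
    (h : ModelApartment.sectorFaceGerm x (facetCone a J) =
      ModelApartment.sectorFaceGerm y (facetCone b K)) : facetCone a J = facetCone b K := by
  have e : closure (facetCone a J) = closure (facetCone b K) :=
    subset_antisymm (closure_subset_of_sectorFaceGerm_eq hne' hne h.symm)
      (closure_subset_of_sectorFaceGerm_eq hne hne' h)
  ext v
  rw [mem_facetCone_iff_closure hne, mem_facetCone_iff_closure hne', e]

end facetCone

/-! ### Vectorial facets of arbitrary sign as simplicial cones. -/

namespace RootBasis

variable {V : Type*} [NormedAddCommGroup V] [NormedSpace ℝ V] {I : Type*} (R : RootBasis V I)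

theorem units_smul_smul {V : Type*} [AddCommGroup V] (ε : ℤˣ) (v : V) : ε • ε • v = v := by
  rw [smul_smul, Int.units_mul_self, one_smul]

theorem map_units_smul {E : Type*} [AddCommGroup E] [Module ℝ E] (φ : V →ₗ[ℝ] E) (ε : ℤˣ) (v : V) :
    φ (ε • v) = ε • φ v := by
  rcases Int.units_eq_one_or ε with rfl | rfl <;> simp

theorem mem_facetOf {ε : ℤˣ} {w : V ≃ₗ[ℝ] V} {J : Set I} {v : V} :
    v ∈ R.facetOf ε w J ↔ ε • w⁻¹ v ∈ R.fundFacet J := by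
  constructor
  · rintro ⟨u, hu, rfl⟩
    have : ε • w⁻¹ (ε • w u) = u := by
      rw [← LinearEquiv.coe_toLinearMap, map_units_smul, units_smul_smul]
      exact w.symm_apply_apply u
    rwa [this]
  · intro h
    refine ⟨_, h, ?_⟩
    simp only
    rw [← LinearEquiv.coe_toLinearMap, map_units_smul, units_smul_smul]
    exact w.apply_symm_apply v

theorem facetOf_eq_facetCone (ε : ℤˣ) (w : V ≃ₗ[ℝ] V) (J : Set I) :
    R.facetOf ε w J =
      facetCone (fun i => (ε : ℤ) • (R.root i ∘ₗ (w⁻¹ : V ≃ₗ[ℝ] V).toLinearMap)) J := by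
  ext v
  rw [mem_facetOf]
  have : ∀ i, R.root i (ε • w⁻¹ v) =
      ((ε : ℤ) • (R.root i ∘ₗ (w⁻¹ : V ≃ₗ[ℝ] V).toLinearMap)) v := fun i => by
    rw [map_units_smul]
    rfl
  simp only [fundFacet, Set.mem_ofPred_eq, this]
  rfl

theorem facetOf_nonempty [FiniteDimensional ℝ V] (ε : ℤˣ) (w : V ≃ₗ[ℝ] V) (J : Set I) :
    (R.facetOf ε w J).Nonempty :=
  (R.fundFacet_nonempty J).image _

theorem image_facetOf (ε : ℤˣ) (w u : V ≃ₗ[ℝ] V) (J : Set I) :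
    u '' R.facetOf ε w J = R.facetOf ε (u * w) J := by
  unfold facetOf
  rw [Set.image_image]
  refine Set.image_congr fun v _ => ?_
  rw [← LinearEquiv.coe_toLinearMap, map_units_smul]
  rfl

theorem facetOf_smul {ε : ℤˣ} {w : V ≃ₗ[ℝ] V} {J : Set I} {v : V} (hv : v ∈ R.facetOf ε w J)
    {t : ℝ} (ht : 0 < t) : t • v ∈ R.facetOf ε w J := by
  rw [facetOf_eq_facetCone] at *
  exact facetCone_smul hv ht

theorem eq_of_sectorFaceGerm_eq [FiniteDimensional ℝ V] [Finite I] {ε ε' : ℤˣ}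
    {w w' : V ≃ₗ[ℝ] V} {J J' : Set I} {x y : V}
    (h : ModelApartment.sectorFaceGerm x (R.facetOf ε w J) =
      ModelApartment.sectorFaceGerm y (R.facetOf ε' w' J')) :
    R.facetOf ε w J = R.facetOf ε' w' J' := by
  have h1 := R.facetOf_nonempty ε w J
  have h2 := R.facetOf_nonempty ε' w' J'
  simp only [facetOf_eq_facetCone] at *
  exact facetCone_eq_of_sectorFaceGerm_eq h1 h2 h

end RootBasis

/-! ### Signs of roots on vectorial facets. -/

namespace ModelApartment

variable {V : Type*} [NormedAddCommGroup V] [NormedSpace ℝ V] {I : Type*} [Fintype I]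
  (𝔸 : ModelApartment V I)

theorem neg_mem_roots {α : Module.Dual ℝ V} (h : α ∈ 𝔸.roots) : -α ∈ 𝔸.roots :=
  h.imp 𝔸.neg_mem_realRoots (𝔸.im_neg α)

theorem comp_mem_imRoots {α : Module.Dual ℝ V} (h : α ∈ 𝔸.imRoots) {w : V ≃ₗ[ℝ] V}
    (hw : w ∈ 𝔸.weyl) : α ∘ₗ w.toLinearMap ∈ 𝔸.imRoots := by
  have := 𝔸.im_stable α h _ (inv_mem hw)
  rwa [inv_inv] at this

theorem comp_mem_roots {α : Module.Dual ℝ V} (h : α ∈ 𝔸.roots) {w : V ≃ₗ[ℝ] V}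
    (hw : w ∈ 𝔸.weyl) : α ∘ₗ w.toLinearMap ∈ 𝔸.roots :=
  h.imp (fun h => 𝔸.comp_mem_realRoots h hw) (fun h => 𝔸.comp_mem_imRoots h hw)

theorem units_smul_mem_roots {α : Module.Dual ℝ V} (h : α ∈ 𝔸.roots) (ε : ℤˣ) :
    (ε : ℤ) • α ∈ 𝔸.roots := by
  rcases Int.units_eq_one_or ε with rfl | rfl
  · simpa using h
  · simpa using 𝔸.neg_mem_roots h

theorem rootsJ_subset_roots (J : Set I) : 𝔸.rootsJ J ⊆ 𝔸.roots := fun _ h => Or.inl h.1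

theorem roots_pos_or_neg {α : Module.Dual ℝ V} (h : α ∈ 𝔸.roots) :
    α ∈ 𝔸.posCone ∨ -α ∈ 𝔸.posCone :=
  h.elim (𝔸.pos_or_neg α) (𝔸.im_pos_or_neg α)

theorem dominant_of_mem_fundFacet {J : Set I} {v : V} (hv : v ∈ 𝔸.fundFacet J) (i : I) :
    0 ≤ 𝔸.root i v := by
  by_cases h : i ∈ J
  · exact (hv.1 i h).ge
  · exact (hv.2 i h).le

theorem mem_posCone_of_pos {α : Module.Dual ℝ V} (h : α ∈ 𝔸.roots) {v : V}
    (hv : ∀ i, 0 ≤ 𝔸.root i v) (hα : 0 < α v) : α ∈ 𝔸.posCone := by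
  refine (𝔸.roots_pos_or_neg h).resolve_right fun hn => ?_
  have := 𝔸.posCone_apply_nonneg hn hv
  rw [LinearMap.neg_apply] at this
  linarith

/-- All coefficients of a root have the same sign. Positivity at one point of the facet therefore
means a positive coefficient at some simple root outside `J`, and that simple root is positive on
the whole facet. -/
theorem roots_pos_of_fundFacet {α : Module.Dual ℝ V} (h : α ∈ 𝔸.roots) {J : Set I} {v v' : V}
    (hv : v ∈ 𝔸.fundFacet J) (hv' : v' ∈ 𝔸.fundFacet J) (hα : 0 < α v) : 0 < α v' := by
  obtain ⟨c, hc, rfl⟩ := 𝔸.mem_posCone_of_pos h (𝔸.dominant_of_mem_fundFacet hv) hα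
  simp only [LinearMap.sum_apply, LinearMap.smul_apply, smul_eq_mul] at hα ⊢
  obtain ⟨i, hi⟩ : ∃ i, 0 < c i * 𝔸.root i v := by
    by_contra! hn
    exact absurd hα (not_lt.2 (Finset.sum_nonpos fun i _ => hn i))
  refine Finset.sum_pos' (fun i _ => mul_nonneg (hc i) (𝔸.dominant_of_mem_fundFacet hv' i))
    ⟨i, Finset.mem_univ _, ?_⟩
  have hc0 : 0 < c i := (hc i).lt_of_ne fun h => by simp [← h] at hi
  refine mul_pos hc0 (hv'.2 i fun hJ => ?_)
  simp [hv.1 i hJ] at hi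

/-- The sign of a root is constant on each vectorial facet. -/
theorem roots_pos_of_facetOf {α : Module.Dual ℝ V} (h : α ∈ 𝔸.roots) {ε : ℤˣ} {w : V ≃ₗ[ℝ] V}
    (hw : w ∈ 𝔸.weyl) {J : Set I} {v v' : V}
    (hv : v ∈ 𝔸.facetOf ε w J) (hv' : v' ∈ 𝔸.facetOf ε w J) (hα : 0 < α v) : 0 < α v' := by
  obtain ⟨u, hu, rfl⟩ := hv
  obtain ⟨u', hu', rfl⟩ := hv'
  rw [RootBasis.map_units_smul] at hα ⊢
  exact 𝔸.roots_pos_of_fundFacet (𝔸.units_smul_mem_roots (𝔸.comp_mem_roots h hw) ε) hu hu' hα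

theorem roots_nonneg_of_facetOf {α : Module.Dual ℝ V} (h : α ∈ 𝔸.roots) {ε : ℤˣ} {w : V ≃ₗ[ℝ] V}
    (hw : w ∈ 𝔸.weyl) {J : Set I} {v v' : V}
    (hv : v ∈ 𝔸.facetOf ε w J) (hv' : v' ∈ 𝔸.facetOf ε w J) (hα : 0 ≤ α v) : 0 ≤ α v' := by
  by_contra! hn
  have := 𝔸.roots_pos_of_facetOf (𝔸.neg_mem_roots h) hw hv' hv (by simpa using hn)
  simp only [LinearMap.neg_apply] at this
  linarith

/-! ### Consequences of sphericity: the invariant form, the Tits cone, the roots vanishing on the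
facet. -/

section Spherical

variable {J : Set I}

theorem mem_sphericalFinset (hJ : 𝔸.IsSpherical J) {w : V ≃ₗ[ℝ] V} :
    w ∈ hJ.toFinset ↔ w ∈ 𝔸.parabolic J :=
  Set.Finite.mem_toFinset hJ

/-- A symmetric bilinear form with kernel `V_J` which is invariant under `W^v(J)`. -/
noncomputable def formJ (hJ : 𝔸.IsSpherical J) : LinearMap.BilinForm ℝ V :=
  ∑ w ∈ hJ.toFinset, ∑ j ∈ (Set.toFinite J).toFinset,
    LinearMap.BilinForm.linMulLin (𝔸.root j ∘ₗ w.toLinearMap) (𝔸.root j ∘ₗ w.toLinearMap)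

variable (hJ : 𝔸.IsSpherical J)

theorem formJ_apply (x y : V) : 𝔸.formJ hJ x y =
    ∑ w ∈ hJ.toFinset, ∑ j ∈ (Set.toFinite J).toFinset, 𝔸.root j (w x) * 𝔸.root j (w y) := by
  simp [formJ, LinearMap.sum_apply]

theorem formJ_comm (x y : V) : 𝔸.formJ hJ x y = 𝔸.formJ hJ y x := by
  simp only [formJ_apply, mul_comm]

theorem formJ_inv {u : V ≃ₗ[ℝ] V} (hu : u ∈ 𝔸.parabolic J) (x y : V) :
    𝔸.formJ hJ (u x) (u y) = 𝔸.formJ hJ x y := by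
  simp only [formJ_apply]
  refine Finset.sum_nbij' (fun w => w * u) (fun w => w * u⁻¹) ?_ ?_ ?_ ?_ ?_
  · intro w hw
    rw [𝔸.mem_sphericalFinset hJ] at hw ⊢
    exact mul_mem hw hu
  · intro w hw
    rw [𝔸.mem_sphericalFinset hJ] at hw ⊢
    exact mul_mem hw (inv_mem hu)
  · intro w _
    simp
  · intro w _
    simp
  · intro w _
    rfl

theorem formJ_pos {x : V} (hx : x ∉ 𝔸.VJ J) : 0 < 𝔸.formJ hJ x x := by
  rw [formJ_apply]
  refine Finset.sum_pos' (fun w _ => Finset.sum_nonneg fun j _ => mul_self_nonneg _)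
    ⟨1, hJ.mem_toFinset.2 (one_mem (𝔸.parabolic J)), ?_⟩
  rw [𝔸.mem_VJ] at hx
  push Not at hx
  obtain ⟨j, hj, hx⟩ := hx
  exact Finset.sum_pos' (fun j _ => mul_self_nonneg _)
    ⟨j, (Set.toFinite J).mem_toFinset.2 hj, mul_self_pos.2 hx⟩

theorem formJ_eq_zero {x : V} (hx : x ∈ 𝔸.VJ J) (y : V) : 𝔸.formJ hJ x y = 0 := by
  rw [formJ_apply]
  refine Finset.sum_eq_zero fun w hw => Finset.sum_eq_zero fun j hj => ?_
  rw [𝔸.parabolic_apply_of_mem_VJ (hJ.mem_toFinset.1 hw) hx,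
    𝔸.mem_VJ.1 hx j ((Set.toFinite J).mem_toFinset.1 hj), zero_mul]

theorem coroot_notMem_VJ {α : Module.Dual ℝ V} {c : V} (h : 𝔸.IsRootPair α c)
    (hα : α ∈ Submodule.span ℝ (𝔸.root '' J)) : c ∉ 𝔸.VJ J := fun hc => by
  have := h.apply
  rw [𝔸.eq_zero_of_vanish_VJ_iff.1 hα c hc] at this
  norm_num at this

variable [FiniteDimensional ℝ V]

/-- Invariance under the reflection of `α` turns `B(c, x)` into `B(-c, x - α(x) c)`, and the formula
follows by solving for `B(c, x)`. -/
theorem formJ_coroot {α : Module.Dual ℝ V} {c : V} (h : 𝔸.IsRootPair α c)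
    (hα : α ∈ Submodule.span ℝ (𝔸.root '' J)) (x : V) :
    𝔸.formJ hJ c x = 𝔸.formJ hJ c c / 2 * α x := by
  obtain ⟨s, hs, hsv⟩ := 𝔸.exists_refl_mem_parabolic h hα
  have h1 := 𝔸.formJ_inv hJ hs c x
  have e : s c = -c := by
    rw [hsv, h.apply, two_smul]
    abel
  rw [e, hsv x, map_neg, LinearMap.neg_apply, map_sub, map_smul, smul_eq_mul] at h1
  linarith

/-- In the finite orbit of `v` take the point with the largest product with a vector `c` of the open
chamber: if some `αⱼ` were negative there, the reflection `rⱼ` would increase this product. -/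
theorem exists_parabolic_nonneg (hJ : 𝔸.IsSpherical J) (v : V) :
    ∃ w ∈ 𝔸.parabolic J, ∀ j ∈ J, 0 ≤ 𝔸.root j (w v) := by
  obtain ⟨c, hc⟩ := 𝔸.exists_root_eq fun _ => 1
  obtain ⟨w, hw, hmax⟩ := Finset.exists_max_image hJ.toFinset (fun w => 𝔸.formJ hJ (w v) c)
    ⟨1, hJ.mem_toFinset.2 (one_mem (𝔸.parabolic J))⟩
  rw [𝔸.mem_sphericalFinset hJ] at hw
  refine ⟨w, hw, fun j hj => ?_⟩
  by_contra! hneg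
  have h1 := hmax (𝔸.refl j * w) (hJ.mem_toFinset.2
    (mul_mem (Subgroup.subset_closure ⟨j, hj, rfl⟩) hw))
  have hsp := Submodule.subset_span (R := ℝ) (Set.mem_image_of_mem 𝔸.root hj)
  have h2 := 𝔸.formJ_coroot hJ (𝔸.isRootPair_simple j) hsp c
  have h3 := 𝔸.formJ_pos hJ (𝔸.coroot_notMem_VJ (𝔸.isRootPair_simple j) hsp)
  rw [LinearEquiv.mul_apply, RootBasis.refl_apply, map_sub, map_smul, LinearMap.sub_apply,
    LinearMap.smul_apply, smul_eq_mul, h2, hc] at h1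
  have := mul_pos (neg_pos.2 hneg) h3
  linarith

/-- The points near a point of a spherical facet of the closed fundamental chamber are in the
Tits cone. -/
theorem exists_ball_subset_tits (hJ : 𝔸.IsSpherical J) {η : V} (hη : η ∈ 𝔸.fundFacet J) :
    ∃ r > 0, ∀ v, ‖v‖ < r → ∃ w ∈ 𝔸.parabolic J, ∀ i, 0 ≤ 𝔸.root i (w (η + v)) := by
  -- Each of the finitely many `w ∈ W^v(J)` fixes `η`, so near `η` the simple roots outside `J` stay
  -- positive after applying any `w`. The choice of `w` then only has to deal with the roots of `J`.
  have key : ∀ᶠ v in 𝓝 (0 : V), ∀ w ∈ (𝔸.parabolic J : Set (V ≃ₗ[ℝ] V)), ∀ i, i ∉ J →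
      0 < 𝔸.root i (w (η + v)) := by
    rw [eventually_all_finite hJ]
    intro w hw
    rw [eventually_all]
    intro i
    by_cases hi : i ∈ J
    · simp [hi]
    have hcont : Continuous fun v => 𝔸.root i (w (η + v)) :=
      (𝔸.root i ∘ₗ w.toLinearMap).continuous_of_finiteDimensional.comp
        (continuous_const.add continuous_id)
    have h0 : 0 < 𝔸.root i (w (η + 0)) := by
      rw [add_zero, 𝔸.parabolic_apply_of_mem_VJ hw (𝔸.fundFacet_subset_VJ J hη)]
      exact hη.2 i hi
    filter_upwards [hcont.continuousAt.eventually (lt_mem_nhds h0)] with v hv _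
    exact hv
  rw [Metric.eventually_nhds_iff] at key
  obtain ⟨r, hr, h⟩ := key
  refine ⟨r, hr, fun v hv => ?_⟩
  obtain ⟨w, hw, hw'⟩ := 𝔸.exists_parabolic_nonneg hJ (η + v)
  refine ⟨w, hw, fun i => ?_⟩
  by_cases hi : i ∈ J
  · exact hw' i hi
  · exact (h (by simpa using hv) w hw i hi).le

/-- A root which is positive on a spherical facet is nonnegative in a neighborhood of each of its
points, which does not depend on the root. -/
theorem exists_ball_nonneg (hJ : 𝔸.IsSpherical J) {ε : ℤˣ} {η : V} (hη : η ∈ 𝔸.facetOf ε 1 J) :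
    ∃ r > 0, ∀ v, ‖v‖ < r → ∀ α ∈ 𝔸.roots, 0 < α η → 0 ≤ α (η + v) := by
  have key : ∀ η ∈ 𝔸.fundFacet J,
      ∃ r > 0, ∀ v, ‖v‖ < r → ∀ α ∈ 𝔸.roots, 0 < α η → 0 ≤ α (η + v) := by
    intro η hη
    obtain ⟨r, hr, h⟩ := 𝔸.exists_ball_subset_tits hJ hη
    refine ⟨r, hr, fun v hv α hα hpos => ?_⟩
    obtain ⟨w, hw, hw'⟩ := h v hv
    have hα' := 𝔸.comp_mem_roots hα (inv_mem (𝔸.parabolic_le_weyl J hw))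
    have h1 : (w⁻¹) η = η :=
      𝔸.parabolic_apply_of_mem_VJ (inv_mem hw) (𝔸.fundFacet_subset_VJ J hη)
    -- As `w` fixes `η`, the root `α ∘ w⁻¹` is positive at `η`, hence a positive root, hence
    -- nonnegative at the dominant vector `w (η + v)`. The radius depends on the Tits cone only,
    -- whence the uniformity in `α`.
    have h2 := 𝔸.posCone_apply_nonneg (𝔸.mem_posCone_of_pos hα' (𝔸.dominant_of_mem_fundFacet hη)
      (by rwa [LinearMap.comp_apply, LinearEquiv.coe_coe, h1])) hw'
    simp only [LinearMap.comp_apply, LinearEquiv.coe_coe] at h2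
    rwa [linearEquiv_inv_apply, LinearEquiv.symm_apply_apply] at h2
  rw [𝔸.mem_facetOf, inv_one] at hη
  obtain ⟨r, hr, h⟩ := key _ hη
  refine ⟨r, hr, fun v hv α hα hpos => ?_⟩
  have e : ∀ u : V, ((ε : ℤ) • α) (ε • u) = α u := fun u => by
    rw [RootBasis.map_units_smul]
    exact RootBasis.units_smul_smul ε (α u)
  have h1 := h (ε • v) (by rcases Int.units_eq_one_or ε with rfl | rfl <;> simpa using hv)
    _ (𝔸.units_smul_mem_roots hα ε)
  simp only [LinearEquiv.coe_one, id_eq, ← smul_add, e] at h1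
  exact h1 hpos

/-- Every class modulo `V_J` meets the Tits cone: `η + t u` is in this cone for small `t > 0`, and
dividing by `t` gives `u + t⁻¹ η`. Thus a direction in `V / V_J` always comes from a vectorial
facet, which can serve as base of a chimney. -/
theorem exists_vectorialFacet_add (hJ : 𝔸.IsSpherical J) (u : V) :
    ∃ n ∈ 𝔸.VJ J, ∃ F, 𝔸.IsVectorialFacet F ∧ u + n ∈ F := by
  obtain ⟨η, hη⟩ := 𝔸.fundFacet_nonempty J
  obtain ⟨r, hr, h⟩ := 𝔸.exists_ball_subset_tits hJ hη
  set t : ℝ := r / (‖u‖ + 1) with ht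
  have hpos : 0 < ‖u‖ + 1 := by positivity
  have ht0 : 0 < t := div_pos hr hpos
  obtain ⟨w, hw, hw'⟩ := h (t • u) (by
    rw [norm_smul, Real.norm_of_nonneg ht0.le, ht, div_mul_eq_mul_div, div_lt_iff₀ hpos]
    exact mul_lt_mul_of_pos_left (by linarith) hr)
  refine ⟨t⁻¹ • η, Submodule.smul_mem _ _ (𝔸.fundFacet_subset_VJ J hη),
    𝔸.facetOf 1 w⁻¹ {i | 𝔸.root i (w (η + t • u)) = 0},
    ⟨1, w⁻¹, inv_mem (𝔸.parabolic_le_weyl J hw), _, rfl⟩, ?_⟩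
  have e : u + t⁻¹ • η = t⁻¹ • (η + t • u) := by
    rw [smul_add, smul_smul, inv_mul_cancel₀ ht0.ne', one_smul, add_comm]
  rw [e]
  apply 𝔸.facetOf_smul _ (inv_pos.2 ht0)
  rw [𝔸.mem_facetOf, inv_inv, one_smul]
  exact ⟨fun i hi => hi, fun i hi => (hw' i).lt_of_ne' hi⟩

/-- If `α` vanished at `η` it would be a combination of the `αⱼ`, `j ∈ J`, hence zero on `V_J`. The
sum over `W^v(J)` of the orbit of a chamber point `v` lies in `V_J`, and `α` is nonnegative on this
orbit because positive imaginary roots are permuted by `W^v`. So `α(v) = 0`, which forces `α = 0`.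
-/
theorem imRoots_pos_of_fundFacet (hJ : 𝔸.IsSpherical J) {α : Module.Dual ℝ V}
    (h : α ∈ 𝔸.imRoots) (hα : α ∈ 𝔸.posCone) {η : V} (hη : η ∈ 𝔸.fundFacet J) :
    0 < α η := by
  refine (𝔸.posCone_apply_nonneg hα (𝔸.dominant_of_mem_fundFacet hη)).lt_of_ne' fun h0 => ?_
  obtain ⟨v, hv⟩ := 𝔸.exists_root_eq fun _ => 1
  have hle : ∀ w ∈ hJ.toFinset, 0 ≤ α (w v) := fun w hw => by
    have hw' := 𝔸.parabolic_le_weyl J (hJ.mem_toFinset.1 hw)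
    have := 𝔸.im_pos_stable α h hα _ (inv_mem hw')
    rw [inv_inv] at this
    exact 𝔸.posCone_apply_nonneg this fun i => by rw [hv]; exact zero_le_one
  -- The sum is invariant under each `rⱼ`, `j ∈ J`, and a vector fixed by `rⱼ` is killed by `αⱼ`
  -- since the coroot is nonzero.
  have hsum : ∑ w ∈ hJ.toFinset, w v ∈ 𝔸.VJ J := by
    rw [𝔸.mem_VJ]
    intro j hj
    have hr : 𝔸.refl j (∑ w ∈ hJ.toFinset, w v) = ∑ w ∈ hJ.toFinset, w v := by
      rw [map_sum]
      have hm : 𝔸.refl j ∈ 𝔸.parabolic J := Subgroup.subset_closure ⟨j, hj, rfl⟩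
      refine Finset.sum_nbij' (fun w => 𝔸.refl j * w) (fun w => 𝔸.refl j * w) ?_ ?_ ?_ ?_ ?_
      · intro w hw
        rw [𝔸.mem_sphericalFinset hJ] at hw ⊢
        exact mul_mem hm hw
      · intro w hw
        rw [𝔸.mem_sphericalFinset hJ] at hw ⊢
        exact mul_mem hm hw
      · intro w _
        simp only [← mul_assoc, 𝔸.refl_mul_self, one_mul]
      · intro w _
        simp only [← mul_assoc, 𝔸.refl_mul_self, one_mul]
      · intro w _
        rfl
    rw [RootBasis.refl_apply, sub_eq_self, smul_eq_zero] at hr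
    refine hr.resolve_right fun hc => ?_
    have := 𝔸.root_coroot j
    rw [hc, map_zero] at this
    norm_num at this
  have hvan : ∀ u ∈ 𝔸.VJ J, α u = 0 := by
    obtain ⟨c, hc, rfl⟩ := hα
    intro u hu
    simp only [LinearMap.sum_apply, LinearMap.smul_apply, smul_eq_mul] at h0 ⊢
    rw [Finset.sum_eq_zero_iff_of_nonneg fun i _ =>
      mul_nonneg (hc i) (𝔸.dominant_of_mem_fundFacet hη i)] at h0
    refine Finset.sum_eq_zero fun i _ => ?_
    by_cases hi : i ∈ J
    · rw [𝔸.mem_VJ.1 hu i hi, mul_zero]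
    · have := (mul_eq_zero.1 (h0 i (Finset.mem_univ _))).resolve_right (hη.2 i hi).ne'
      rw [this, zero_mul]
  have hs := hvan _ hsum
  rw [map_sum, Finset.sum_eq_zero_iff_of_nonneg hle] at hs
  have hαv : α v = 0 := hs 1 (hJ.mem_toFinset.2 (one_mem (𝔸.parabolic J)))
  obtain ⟨c, hc, rfl⟩ := hα
  simp only [LinearMap.sum_apply, LinearMap.smul_apply, smul_eq_mul, hv, mul_one] at hαv
  rw [Finset.sum_eq_zero_iff_of_nonneg fun i _ => hc i] at hαv
  exact 𝔸.im_ne_zero (by simpa [fun i => hαv i (Finset.mem_univ i)] using h)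

/-- The roots vanishing at a point of a spherical facet of type `J` are the roots of `Φ_J`. -/
theorem mem_rootsJ_of_apply_eq_zero (hJ : 𝔸.IsSpherical J) {ε : ℤˣ} {η : V}
    (hη : η ∈ 𝔸.facetOf ε 1 J) {α : Module.Dual ℝ V} (h : α ∈ 𝔸.roots) (h0 : α η = 0) :
    α ∈ 𝔸.rootsJ J := by
  rw [𝔸.mem_facetOf, inv_one] at hη
  have h0' : α (ε • η) = 0 := by rw [RootBasis.map_units_smul, h0, smul_zero]
  change ε • η ∈ _ at hη
  have key : ∀ α ∈ 𝔸.posCone, α (ε • η) = 0 → α ∈ Submodule.span ℝ (𝔸.root '' J) := by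
    rintro _ ⟨c, hc, rfl⟩ h0
    simp only [LinearMap.sum_apply, LinearMap.smul_apply, smul_eq_mul] at h0
    rw [Finset.sum_eq_zero_iff_of_nonneg fun i _ =>
      mul_nonneg (hc i) (𝔸.dominant_of_mem_fundFacet hη i)] at h0
    refine Submodule.sum_mem _ fun i _ => ?_
    by_cases hi : i ∈ J
    · exact Submodule.smul_mem _ _ (Submodule.subset_span ⟨i, hi, rfl⟩)
    · rw [(mul_eq_zero.1 (h0 i (Finset.mem_univ _))).resolve_right (hη.2 i hi).ne', zero_smul]
      exact zero_mem _
  refine ⟨h.resolve_right fun him => ?_, ?_⟩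
  · rcases 𝔸.im_pos_or_neg α him with hp | hp
    · exact (𝔸.imRoots_pos_of_fundFacet hJ him hp hη).ne' h0'
    · exact (𝔸.imRoots_pos_of_fundFacet hJ (𝔸.im_neg α him) hp hη).ne'
        (by rw [LinearMap.neg_apply, h0', neg_zero])
  · rcases 𝔸.roots_pos_or_neg h with hp | hp
    · exact key α hp h0'
    · rw [← neg_neg α]
      exact neg_mem (key _ hp (by rw [LinearMap.neg_apply, h0', neg_zero]))

end Spherical

end ModelApartment

/-! ## Enclosed sets and the action of the affine Weyl group -/

theorem Filter.mem_generate_of_inter {α : Type*} {G : Set (Set α)} (huniv : Set.univ ∈ G)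
    (hinter : ∀ s ∈ G, ∀ t ∈ G, s ∩ t ∈ G) {U : Set α} :
    U ∈ Filter.generate G ↔ ∃ S ∈ G, S ⊆ U := by
  constructor
  · intro h
    induction h with
    | basic hs => exact ⟨_, hs, subset_rfl⟩
    | univ => exact ⟨_, huniv, subset_rfl⟩
    | superset _ hst ih =>
      obtain ⟨S, hS, h⟩ := ih
      exact ⟨S, hS, h.trans hst⟩
    | inter _ _ ih₁ ih₂ =>
      obtain ⟨S, hS, h⟩ := ih₁
      obtain ⟨T, hT, h'⟩ := ih₂
      exact ⟨_, hinter S hS T hT, Set.inter_subset_inter h h'⟩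
  · rintro ⟨S, hS, h⟩
    exact mem_of_superset (GenerateSets.basic hS) h

namespace ModelApartment

variable {V : Type*} [NormedAddCommGroup V] [NormedSpace ℝ V] {I : Type*} [Fintype I]
  (𝔸 : ModelApartment V I)

/-- A choice, for each root `α`, of a half-space `D(α, k)` with `k ∈ Γ_α ∪ {∞}`. -/
def IsHalfFamily (D : Module.Dual ℝ V → Set V) : Prop :=
  ∀ α ∈ 𝔸.roots, D α = Set.univ ∨ ∃ k ∈ 𝔸.Gam α, D α = halfOf α k

/-- The enclosed sets. -/
def IsEnclosed (S : Set V) : Prop :=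
  ∃ D : Module.Dual ℝ V → Set V, 𝔸.IsHalfFamily D ∧ S = ⋂ α ∈ 𝔸.roots, D α

theorem isEnclosed_univ : 𝔸.IsEnclosed Set.univ :=
  ⟨fun _ => Set.univ, fun _ _ => Or.inl rfl, by simp⟩

variable {𝔸}

/-- For each root the smaller of the two constants wins, and it is still in `Γ_α`. Enclosed sets are
thus closed under finite intersection and form a base of `cl F`. -/
theorem IsHalfFamily.inter {D D' : Module.Dual ℝ V → Set V} (h : 𝔸.IsHalfFamily D)
    (h' : 𝔸.IsHalfFamily D') : 𝔸.IsHalfFamily fun α => D α ∩ D' α := by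
  intro α hα
  dsimp only
  rcases h α hα with h1 | ⟨k, hk, h1⟩
  · rw [h1, Set.univ_inter]
    exact h' α hα
  · rcases h' α hα with h2 | ⟨k', hk', h2⟩
    · rw [h2, Set.inter_univ]
      exact h α hα
    · rw [h1, h2]
      refine Or.inr ⟨min k k', ?_, ?_⟩
      · rcases min_choice k k' with e | e <;> rw [e] <;> assumption
      · ext v
        simp only [halfOf, Set.mem_inter_iff, Set.mem_ofPred_eq]
        constructor
        · rintro ⟨h3, h4⟩
          rcases min_choice k k' with e | e <;> rw [e] <;> assumption
        · intro h3
          exact ⟨h3.trans (by linarith [min_le_left k k']),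
            h3.trans (by linarith [min_le_right k k'])⟩

theorem IsEnclosed.inter {S T : Set V} (hS : 𝔸.IsEnclosed S) (hT : 𝔸.IsEnclosed T) :
    𝔸.IsEnclosed (S ∩ T) := by
  obtain ⟨D, hD, rfl⟩ := hS
  obtain ⟨D', hD', rfl⟩ := hT
  exact ⟨_, hD.inter hD', by simp only [Set.iInter_inter_distrib]⟩

theorem IsEnclosed.sInter {t : Set (Set V)} (ht : t.Finite) (h : ∀ S ∈ t, 𝔸.IsEnclosed S) :
    𝔸.IsEnclosed (⋂₀ t) := by
  induction t, ht using Set.Finite.induction_on with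
  | empty =>
    rw [Set.sInter_empty]
    exact 𝔸.isEnclosed_univ
  | insert _ _ ih =>
    rw [Set.sInter_insert]
    exact (h _ (Set.mem_insert _ _)).inter (ih fun S hS => h S (Set.mem_insert_of_mem _ hS))

theorem isEnclosed_halfOf {α : Module.Dual ℝ V} (hα : α ∈ 𝔸.roots) {k : ℝ} (hk : k ∈ 𝔸.Gam α) :
    𝔸.IsEnclosed (halfOf α k) := by
  classical
  refine ⟨fun β => if β = α then halfOf α k else Set.univ, fun β _ => ?_, ?_⟩
  · by_cases h : β = α
    · subst h
      exact Or.inr ⟨k, hk, if_pos rfl⟩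
    · exact Or.inl (if_neg h)
  · ext v
    simp only [Set.mem_iInter]
    constructor
    · intro hv β _
      split_ifs
      · exact hv
      · trivial
    · intro hv
      have := hv α hα
      rwa [if_pos rfl] at this

theorem IsHalfFamily.isClosed [FiniteDimensional ℝ V] {D : Module.Dual ℝ V → Set V}
    (hD : 𝔸.IsHalfFamily D) {α : Module.Dual ℝ V} (hα : α ∈ 𝔸.roots) : IsClosed (D α) := by
  rcases hD α hα with h | ⟨k, -, h⟩ <;> rw [h]
  · exact isClosed_univ
  · exact isClosed_le continuous_const
      (α.continuous_of_finiteDimensional.add continuous_const)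

theorem IsEnclosed.isClosed [FiniteDimensional ℝ V] {S : Set V} (hS : 𝔸.IsEnclosed S) :
    IsClosed S := by
  obtain ⟨D, hD, rfl⟩ := hS
  exact isClosed_iInter fun α => isClosed_iInter fun hα => hD.isClosed hα

variable (𝔸)

theorem mem_cl {F : Filter V} {T : Set V} :
    T ∈ 𝔸.cl F ↔ ∃ S, 𝔸.IsEnclosed S ∧ S ∈ F ∧ S ⊆ T := by
  unfold cl
  rw [mem_generate_of_inter]
  · constructor
    · rintro ⟨S, ⟨h1, h2⟩, h3⟩
      exact ⟨S, h2, h1, h3⟩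
    · rintro ⟨S, h2, h1, h3⟩
      exact ⟨S, ⟨h1, h2⟩, h3⟩
  · exact ⟨univ_mem, 𝔸.isEnclosed_univ⟩
  · rintro s ⟨hs, hs'⟩ t ⟨ht, ht'⟩
    exact ⟨inter_mem hs ht, IsEnclosed.inter (𝔸 := 𝔸) hs' ht'⟩

theorem cl_mono {F G : Filter V} (h : F ≤ G) : 𝔸.cl F ≤ 𝔸.cl G := by
  intro T hT
  rw [mem_cl] at hT ⊢
  obtain ⟨S, h1, h2, h3⟩ := hT
  exact ⟨S, h1, h h2, h3⟩

theorem localFacet_le_facet (x : V) (F : Set V) : localFacet x F ≤ 𝔸.facet x F :=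
  le_generate_iff.2 fun _ hS => hS.1

theorem IsEnclosed.mem_facet {𝔸 : ModelApartment V I} {S : Set V} (hS : 𝔸.IsEnclosed S) {x : V}
    {F : Set V} (h : S ∈ localFacet x F) : S ∈ 𝔸.facet x F := by
  obtain ⟨D, hD, rfl⟩ := hS
  refine GenerateSets.basic ⟨h, D, fun α hα => ?_, rfl⟩
  rcases hD α hα with h | ⟨k, hk, h⟩
  · exact Or.inl h
  · exact Or.inr ⟨k, hk, Or.inl h⟩

/-! ### Equivariance -/

theorem affineEquiv_add (w : V ≃ᵃ[ℝ] V) (x v : V) : w (x + v) = w x + w.linear v := by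
  have := w.map_vadd x v
  rw [vadd_eq_add, vadd_eq_add, add_comm, add_comm _ (w x)] at this
  exact this

theorem affineEquiv_apply (w : V ≃ᵃ[ℝ] V) (v : V) : w v = w 0 + w.linear v := by
  rw [← affineEquiv_add, zero_add]

theorem affineEquiv_inv_apply (w : V ≃ᵃ[ℝ] V) (v : V) : w⁻¹ (w v) = v := w.symm_apply_apply v

theorem affineEquiv_apply_inv (w : V ≃ᵃ[ℝ] V) (v : V) : w (w⁻¹ v) = v := w.apply_symm_apply v

theorem linear_mem_weyl {w : V ≃ᵃ[ℝ] V} (hw : w ∈ 𝔸.W) : w.linear ∈ 𝔸.weyl := by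
  refine Subgroup.closure_induction (p := fun w _ => w.linear ∈ 𝔸.weyl) ?_ ?_ ?_ ?_ hw
  · rintro s ⟨α, c, k, hα, -, hs⟩
    obtain ⟨r, hr, hrv⟩ := hα.exists_refl
    have : s.linear = r := by
      ext v
      have h1 := affineEquiv_apply s v
      rw [hs, hs, map_zero] at h1
      rw [hrv, ← sub_eq_iff_eq_add'.2 h1]
      simp only [add_smul, zero_smul]
      abel
    rwa [this]
  · exact one_mem 𝔸.weyl
  · intro x y _ _ hx hy
    exact mul_mem (S := Subgroup (V ≃ₗ[ℝ] V)) hx hy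
  · intro x _ hx
    exact inv_mem (S := Subgroup (V ≃ₗ[ℝ] V)) hx

/-- The affine reflection `v ↦ v - (α(v) + k) c`. -/
noncomputable def affineReflection {α : Module.Dual ℝ V} {c : V} (h : α c = 2) (k : ℝ) :
    V ≃ᵃ[ℝ] V :=
  (Module.reflection h).toAffineEquiv.trans (AffineEquiv.constVAdd ℝ V (-(k • c)))

theorem affineReflection_apply {α : Module.Dual ℝ V} {c : V} (h : α c = 2) (k : ℝ) (v : V) :
    affineReflection h k v = v - (α v + k) • c := by
  simp only [affineReflection, AffineEquiv.trans_apply, LinearEquiv.coe_toAffineEquiv,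
    AffineEquiv.constVAdd_apply, vadd_eq_add]
  rw [Module.reflection_apply, add_smul]
  abel

theorem affineReflection_linear {α : Module.Dual ℝ V} {c : V} (h : α c = 2) (k : ℝ) :
    (affineReflection h k).linear = Module.reflection h := by
  rfl

theorem affineReflection_mem_W {α : Module.Dual ℝ V} {c : V} (h : 𝔸.IsRootPair α c) {k : ℝ}
    (hk : wallOf α k ∈ 𝔸.walls) : affineReflection h.apply k ∈ 𝔸.W :=
  Subgroup.subset_closure ⟨α, c, k, h, hk, affineReflection_apply _ _⟩

theorem exists_wall {α : Module.Dual ℝ V} (hα : α ∈ 𝔸.realRoots) :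
    ∃ k, wallOf α k ∈ 𝔸.walls :=
  (𝔸.infinite_walls α hα).nonempty

/-- Every simple root has a wall, so each simple reflection is the linear part of a reflection in
`W`. This allows any facet direction to be moved to the standard one by changing the isomorphism
`f`. -/
theorem exists_lift {u : V ≃ₗ[ℝ] V} (hu : u ∈ 𝔸.weyl) : ∃ w ∈ 𝔸.W, w.linear = u := by
  induction hu using Subgroup.closure_induction with
  | mem x hx =>
    obtain ⟨i, rfl⟩ := hx
    obtain ⟨k, hk⟩ := 𝔸.exists_wall (𝔸.root_mem_realRoots i)
    exact ⟨_, 𝔸.affineReflection_mem_W (𝔸.isRootPair_simple i) hk, rfl⟩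
  | one => exact ⟨1, one_mem _, rfl⟩
  | mul x y _ _ hx hy =>
    obtain ⟨w, hw, rfl⟩ := hx
    obtain ⟨w', hw', rfl⟩ := hy
    exact ⟨w * w', mul_mem hw hw', rfl⟩
  | inv x _ hx =>
    obtain ⟨w, hw, rfl⟩ := hx
    exact ⟨w⁻¹, inv_mem hw, rfl⟩

theorem image_wallOf (w : V ≃ᵃ[ℝ] V) (α : Module.Dual ℝ V) (k : ℝ) :
    (w⁻¹ : V ≃ᵃ[ℝ] V) '' wallOf α k = wallOf (α ∘ₗ w.linear.toLinearMap) (α (w 0) + k) := by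
  ext v
  simp only [wallOf, Set.mem_image, Set.mem_ofPred_eq, LinearMap.comp_apply, LinearEquiv.coe_coe]
  have e : α (w v) + k = α (w.linear v) + (α (w 0) + k) := by
    rw [affineEquiv_apply w v, map_add]
    ring
  rw [← e]
  constructor
  · rintro ⟨u, hu, rfl⟩
    rwa [affineEquiv_apply_inv]
  · intro h
    exact ⟨w v, h, affineEquiv_inv_apply w v⟩

theorem preimage_halfOf (w : V ≃ᵃ[ℝ] V) (α : Module.Dual ℝ V) (k : ℝ) :
    w ⁻¹' halfOf α k = halfOf (α ∘ₗ w.linear.toLinearMap) (α (w 0) + k) := by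
  ext v
  simp only [halfOf, Set.mem_preimage, Set.mem_ofPred_eq, LinearMap.comp_apply,
    LinearEquiv.coe_coe]
  rw [affineEquiv_apply w v, map_add, add_comm (α (w 0)), add_assoc]

theorem preimage_openHalfOf (w : V ≃ᵃ[ℝ] V) (α : Module.Dual ℝ V) (k : ℝ) :
    w ⁻¹' openHalfOf α k = openHalfOf (α ∘ₗ w.linear.toLinearMap) (α (w 0) + k) := by
  ext v
  simp only [openHalfOf, Set.mem_preimage, Set.mem_ofPred_eq, LinearMap.comp_apply,
    LinearEquiv.coe_coe]
  rw [affineEquiv_apply w v, map_add, add_comm (α (w 0)), add_assoc]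

theorem Gam_comp {w : V ≃ᵃ[ℝ] V} (hw : w ∈ 𝔸.W) {α : Module.Dual ℝ V} {k : ℝ}
    (hk : k ∈ 𝔸.Gam α) : α (w 0) + k ∈ 𝔸.Gam (α ∘ₗ w.linear.toLinearMap) := by
  rcases hk with ⟨h1, h2⟩ | h
  · refine Or.inl ⟨𝔸.comp_mem_realRoots h1 (𝔸.linear_mem_weyl hw), ?_⟩
    rw [← image_wallOf]
    exact 𝔸.walls_stable _ (inv_mem hw) _ h2
  · exact Or.inr (𝔸.comp_mem_imRoots h (𝔸.linear_mem_weyl hw))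

theorem preimage_iInter_roots {w : V ≃ᵃ[ℝ] V} (hw : w ∈ 𝔸.W) (D : Module.Dual ℝ V → Set V) :
    w ⁻¹' (⋂ α ∈ 𝔸.roots, D α) =
      ⋂ α ∈ 𝔸.roots, w ⁻¹' D (α ∘ₗ (w.linear⁻¹ : V ≃ₗ[ℝ] V).toLinearMap) := by
  ext v
  simp only [Set.mem_preimage, Set.mem_iInter]
  have hl := 𝔸.linear_mem_weyl hw
  constructor
  · intro h α hα
    exact h _ (𝔸.comp_mem_roots hα (inv_mem hl))
  · intro h α hα
    have := h _ (𝔸.comp_mem_roots hα hl)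
    convert this using 2
    ext u
    simp only [LinearMap.comp_apply, LinearEquiv.coe_coe]
    rw [linearEquiv_inv_apply, LinearEquiv.apply_symm_apply]

theorem comp_inv_comp (α : Module.Dual ℝ V) (u : V ≃ₗ[ℝ] V) :
    (α ∘ₗ (u⁻¹ : V ≃ₗ[ℝ] V).toLinearMap) ∘ₗ u.toLinearMap = α := by
  ext v
  simp only [LinearMap.comp_apply, LinearEquiv.coe_coe]
  rw [linearEquiv_inv_apply, LinearEquiv.symm_apply_apply]

theorem IsEnclosed.preimage {𝔸 : ModelApartment V I} {S : Set V} (hS : 𝔸.IsEnclosed S)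
    {w : V ≃ᵃ[ℝ] V} (hw : w ∈ 𝔸.W) : 𝔸.IsEnclosed (w ⁻¹' S) := by
  obtain ⟨D, hD, rfl⟩ := hS
  refine ⟨_, fun α hα => ?_, 𝔸.preimage_iInter_roots hw D⟩
  rcases hD _ (𝔸.comp_mem_roots hα (inv_mem (𝔸.linear_mem_weyl hw))) with h | ⟨k, hk, h⟩
  · exact Or.inl (by rw [h]; rfl)
  · refine Or.inr ⟨_, ?_, by rw [h, preimage_halfOf, comp_inv_comp]⟩
    have := 𝔸.Gam_comp hw hk
    rwa [comp_inv_comp] at this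

theorem map_cl_le {w : V ≃ᵃ[ℝ] V} (hw : w ∈ 𝔸.W) (F : Filter V) :
    map w (𝔸.cl F) ≤ 𝔸.cl (map w F) := by
  intro T hT
  rw [mem_cl] at hT
  obtain ⟨S, h1, h2, h3⟩ := hT
  rw [mem_map, mem_cl]
  exact ⟨_, h1.preimage hw, h2, Set.preimage_mono h3⟩

theorem map_principal_singleton_add (w : V ≃ᵃ[ℝ] V) (x : V) (F : Set V) :
    map w (𝓟 ({x} + F)) = 𝓟 ({w x} + w.linear '' F) := by
  rw [map_principal]
  congr 1
  simp only [Set.singleton_add, Set.image_image, affineEquiv_add]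

theorem map_localFacet_le [FiniteDimensional ℝ V] (w : V ≃ᵃ[ℝ] V) (x : V) (F : Set V) :
    map w (localFacet x F) ≤ localFacet (w x) (w.linear '' F) := by
  unfold localFacet
  refine map_inf_le.trans (inf_le_inf ?_ (map_principal_singleton_add w x F).le)
  exact (AffineMap.continuous_of_finiteDimensional w.toAffineMap).continuousAt

theorem map_facet_le [FiniteDimensional ℝ V] {w : V ≃ᵃ[ℝ] V} (hw : w ∈ 𝔸.W) (x : V) (F : Set V) :
    map w (𝔸.facet x F) ≤ 𝔸.facet (w x) (w.linear '' F) := by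
  refine le_generate_iff.2 ?_
  rintro S ⟨h1, D, hD, rfl⟩
  change _ ∈ map w _
  rw [mem_map]
  refine GenerateSets.basic ⟨map_localFacet_le w x F h1, _, fun α hα => ?_,
    𝔸.preimage_iInter_roots hw D⟩
  rcases hD _ (𝔸.comp_mem_roots hα (inv_mem (𝔸.linear_mem_weyl hw))) with h | ⟨k, hk, h⟩
  · exact Or.inl (by rw [h]; rfl)
  · have hg := 𝔸.Gam_comp hw hk
    rw [comp_inv_comp] at hg
    refine Or.inr ⟨_, hg, ?_⟩
    rcases h with h | h
    · exact Or.inl (by rw [h, preimage_halfOf, comp_inv_comp])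
    · exact Or.inr (by rw [h, preimage_openHalfOf, comp_inv_comp])

theorem map_chimney_le [FiniteDimensional ℝ V] {w : V ≃ᵃ[ℝ] V} (hw : w ∈ 𝔸.W) (x : V)
    (F₀ Fv : Set V) (ξ : V) : map w (𝔸.chimney x F₀ Fv ξ) ≤
      𝔸.chimney (w x) (w.linear '' F₀) (w.linear '' Fv) (w.linear ξ) := by
  refine (𝔸.map_cl_le hw _).trans (𝔸.cl_mono ?_)
  have e : map w (𝔸.facet x F₀ + 𝓟 ({ξ} + Fv)) =
      map w (𝔸.facet x F₀) + map w.linear (𝓟 ({ξ} + Fv)) :=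
    map_map₂_distrib fun a b => affineEquiv_add w a b
  have e' : map w.linear (𝓟 ({ξ} + Fv)) = 𝓟 ({w.linear ξ} + w.linear '' Fv) := by
    rw [map_principal]
    congr 1
    simp only [Set.singleton_add, Set.image_image, map_add]
  rw [e, e']
  exact add_le_add (𝔸.map_facet_le hw x F₀) le_rfl

theorem image_closure_linear [FiniteDimensional ℝ V] (u : V ≃ₗ[ℝ] V) (F : Set V) :
    u '' closure F = closure (u '' F) :=
  u.toContinuousLinearEquiv.toHomeomorph.image_closure F

theorem map_chimneyGerm_le [FiniteDimensional ℝ V] {w : V ≃ᵃ[ℝ] V} (hw : w ∈ 𝔸.W) (x : V)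
    (F₀ Fv : Set V) : map w (𝔸.chimneyGerm x F₀ Fv) ≤
      𝔸.chimneyGerm (w x) (w.linear '' F₀) (w.linear '' Fv) := by
  refine le_iInf₂ fun ξ hξ => ?_
  rw [← image_closure_linear] at hξ
  obtain ⟨ξ', hξ', rfl⟩ := hξ
  exact (map_mono (iInf₂_le ξ' hξ')).trans (𝔸.map_chimney_le hw x F₀ Fv ξ')

theorem map_sectorFaceGerm_le [FiniteDimensional ℝ V] (w : V ≃ᵃ[ℝ] V) (x : V)
    (Fv : Set V) : map w (sectorFaceGerm x Fv) ≤ sectorFaceGerm (w x) (w.linear '' Fv) := by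
  refine le_iInf₂ fun ξ hξ => ?_
  rw [← image_closure_linear] at hξ
  obtain ⟨ξ', hξ', rfl⟩ := hξ
  refine (map_mono (iInf₂_le ξ' hξ')).trans ?_
  rw [map_principal_singleton_add, affineEquiv_add]

theorem map_map_inv (w : V ≃ᵃ[ℝ] V) (F : Filter V) : map w (map (w⁻¹ : V ≃ᵃ[ℝ] V) F) = F := by
  rw [map_map]
  convert map_id
  ext v
  exact affineEquiv_apply_inv w v

theorem inv_linear_image (w : V ≃ᵃ[ℝ] V) (F : Set V) :
    (w⁻¹ : V ≃ᵃ[ℝ] V).linear '' (w.linear '' F) = F := by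
  rw [Set.image_image]
  convert Set.image_id F
  exact w.linear.symm_apply_apply _

/-- The inequality holds for every element of the group `W`; applied to `w⁻¹`, it gives the reverse
one. -/
theorem map_chimneyGerm [FiniteDimensional ℝ V] {w : V ≃ᵃ[ℝ] V} (hw : w ∈ 𝔸.W) (x : V)
    (F₀ Fv : Set V) : map w (𝔸.chimneyGerm x F₀ Fv) =
      𝔸.chimneyGerm (w x) (w.linear '' F₀) (w.linear '' Fv) := by
  refine le_antisymm (𝔸.map_chimneyGerm_le hw x F₀ Fv) ?_
  have := map_mono (m := w) (𝔸.map_chimneyGerm_le (inv_mem hw) (w x) (w.linear '' F₀)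
    (w.linear '' Fv))
  rwa [map_map_inv, affineEquiv_inv_apply, inv_linear_image, inv_linear_image] at this

theorem map_sectorFaceGerm [FiniteDimensional ℝ V] (w : V ≃ᵃ[ℝ] V) (x : V)
    (Fv : Set V) : map w (sectorFaceGerm x Fv) = sectorFaceGerm (w x) (w.linear '' Fv) := by
  refine le_antisymm (map_sectorFaceGerm_le w x Fv) ?_
  have := map_mono (m := w) (map_sectorFaceGerm_le w⁻¹ (w x) (w.linear '' Fv))
  rwa [map_map_inv, affineEquiv_inv_apply, inv_linear_image] at this

end ModelApartment

/-! ## Chimneys with a given spherical direction -/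

namespace ModelApartment

variable {V : Type*} [NormedAddCommGroup V] [NormedSpace ℝ V] {I : Type*} [Fintype I]
  (𝔸 : ModelApartment V I)

theorem tendsto_localFacet {F : Set V} (hF : 𝔸.IsVectorialFacet F) (x : V) {u : V} (hu : u ∈ F) :
    Tendsto (fun t : ℝ => x + t • u) (𝓝[>] 0) (localFacet x F) := by
  obtain ⟨ε, w, -, J, rfl⟩ := hF
  refine tendsto_inf.2 ⟨?_, ?_⟩
  · have : Tendsto (fun t : ℝ => x + t • u) (𝓝 0) (𝓝 (x + (0 : ℝ) • u)) :=
      (by fun_prop : Continuous fun t : ℝ => x + t • u).tendsto 0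
    rw [zero_smul, add_zero] at this
    exact this.mono_left nhdsWithin_le_nhds
  · rw [tendsto_principal]
    filter_upwards [self_mem_nhdsWithin] with t ht
    exact Set.add_mem_add rfl (𝔸.facetOf_smul hu ht)

theorem vectorialFacet_nonempty [FiniteDimensional ℝ V] {F : Set V} (hF : 𝔸.IsVectorialFacet F) :
    F.Nonempty := by
  obtain ⟨ε, w, -, J, rfl⟩ := hF
  exact 𝔸.facetOf_nonempty ε w J

theorem mem_closure_of_mem_localFacet [FiniteDimensional ℝ V] {F : Set V}
    (hF : 𝔸.IsVectorialFacet F) {x : V} {T : Set V} (hT : T ∈ localFacet x F) : x ∈ closure T := by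
  obtain ⟨u, hu⟩ := 𝔸.vectorialFacet_nonempty hF
  have h1 := 𝔸.tendsto_localFacet hF x hu
  exact mem_closure_of_tendsto (tendsto_inf.1 h1).1 (h1.eventually hT)

/-- Since a root has constant sign on a vectorial facet, one vector `u` decides: either `x` is
strictly inside, or it is on the boundary and the root is nonnegative at `u`. -/
theorem halfOf_mem_localFacet_iff [FiniteDimensional ℝ V] {F : Set V} (hF : 𝔸.IsVectorialFacet F)
    {x u : V} (hu : u ∈ F) {α : Module.Dual ℝ V} (hα : α ∈ 𝔸.roots) {k : ℝ} :
    halfOf α k ∈ localFacet x F ↔ 0 < α x + k ∨ α x + k = 0 ∧ 0 ≤ α u := by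
  constructor
  · intro h
    obtain ⟨t, h1, ht⟩ := (((𝔸.tendsto_localFacet hF x hu).eventually h).and
      self_mem_nhdsWithin).exists
    have h2 : x ∈ halfOf α k := by
      have hcl : IsClosed (halfOf α k) := isClosed_le continuous_const
        (α.continuous_of_finiteDimensional.add continuous_const)
      have := 𝔸.mem_closure_of_mem_localFacet hF h
      rwa [hcl.closure_eq] at this
    rcases (show 0 ≤ α x + k from h2).lt_or_eq with h3 | h3
    · exact Or.inl h3
    · refine Or.inr ⟨h3.symm, ?_⟩
      have h4 : 0 ≤ α (x + t • u) + k := h1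
      rw [map_add, map_smul, smul_eq_mul] at h4
      exact nonneg_of_mul_nonneg_right (by linarith : 0 ≤ t * α u) ht
  · rintro (h | ⟨h1, h2⟩)
    · refine mem_inf_of_left ?_
      have hcont : Continuous fun v => α v + k :=
        α.continuous_of_finiteDimensional.add continuous_const
      filter_upwards [hcont.continuousAt.eventually (lt_mem_nhds h)] with v hv
      exact hv.le
    · refine mem_inf_of_right ?_
      obtain ⟨ε, w, hw, J, rfl⟩ := hF
      rw [mem_principal]
      rw [Set.singleton_add, Set.image_subset_iff]
      intro v hv
      have := 𝔸.roots_nonneg_of_facetOf hα hw hu hv h2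
      change 0 ≤ α (x + v) + k
      rw [map_add]
      linarith

/-! ### Cones of spherical direction -/

section Direction

variable {ε : ℤˣ} {J : Set I}

theorem isVectorialFacet_dir (ε : ℤˣ) (J : Set I) : 𝔸.IsVectorialFacet (𝔸.facetOf ε 1 J) :=
  ⟨ε, 1, one_mem _, J, rfl⟩

theorem isSphericalFacet_dir (hJ : 𝔸.IsSpherical J) (ε : ℤˣ) :
    𝔸.IsSphericalFacet (𝔸.facetOf ε 1 J) :=
  ⟨ε, 1, one_mem _, J, hJ, rfl⟩

theorem mem_dir {v : V} : v ∈ 𝔸.facetOf ε 1 J ↔ ε • v ∈ 𝔸.fundFacet J := by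
  rw [𝔸.mem_facetOf, inv_one]
  rfl

theorem dir_subset_VJ {v : V} (hv : v ∈ 𝔸.facetOf ε 1 J) : v ∈ 𝔸.VJ J := by
  rw [mem_dir] at hv
  have := 𝔸.fundFacet_subset_VJ J hv
  rw [← RootBasis.units_smul_smul ε v]
  rcases Int.units_eq_one_or ε with rfl | rfl
  · simpa using this
  · simpa using this

theorem closure_dir_subset_VJ [FiniteDimensional ℝ V] {v : V}
    (hv : v ∈ closure (𝔸.facetOf ε 1 J)) : v ∈ 𝔸.VJ J := by
  have hcl : IsClosed (𝔸.VJ J : Set V) := Submodule.closed_of_finiteDimensional _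
  exact closure_minimal (fun v hv => 𝔸.dir_subset_VJ hv) hcl hv

theorem dir_add {u v : V} (hu : u ∈ 𝔸.facetOf ε 1 J) (hv : v ∈ 𝔸.facetOf ε 1 J) :
    u + v ∈ 𝔸.facetOf ε 1 J := by
  rw [RootBasis.facetOf_eq_facetCone] at *
  exact facetCone_add hu hv

theorem dir_closure_add [FiniteDimensional ℝ V] {u v : V} (hu : u ∈ closure (𝔸.facetOf ε 1 J))
    (hv : v ∈ 𝔸.facetOf ε 1 J) : u + v ∈ 𝔸.facetOf ε 1 J := by
  rw [RootBasis.facetOf_eq_facetCone] at *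
  exact facetCone_add_closure hu hv

theorem closure_dir_add [FiniteDimensional ℝ V] {u v : V} (hu : u ∈ closure (𝔸.facetOf ε 1 J))
    (hv : v ∈ closure (𝔸.facetOf ε 1 J)) : u + v ∈ closure (𝔸.facetOf ε 1 J) := by
  have := 𝔸.facetOf_nonempty ε 1 J
  rw [RootBasis.facetOf_eq_facetCone] at *
  exact closure_facetCone_add this hu hv

theorem zero_mem_closure_dir [FiniteDimensional ℝ V] :
    (0 : V) ∈ closure (𝔸.facetOf ε 1 J) := by
  have := 𝔸.facetOf_nonempty ε 1 J
  rw [RootBasis.facetOf_eq_facetCone] at *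
  exact zero_mem_closure_facetCone this

theorem mem_germ [FiniteDimensional ℝ V] {x : V} {S : Set V} :
    S ∈ sectorFaceGerm x (𝔸.facetOf ε 1 J) ↔
      ∃ ξ ∈ closure (𝔸.facetOf ε 1 J), ∀ v ∈ 𝔸.facetOf ε 1 J, x + ξ + v ∈ S := by
  have := 𝔸.facetOf_nonempty ε 1 J
  rw [RootBasis.facetOf_eq_facetCone] at *
  exact mem_sectorFaceGerm this

/-- The facet is open in `V_J`, so pushing any vector of `V_J` far enough along `η` brings it into
the facet. -/
theorem exists_add_smul_mem_dir (n : V) (hn : n ∈ 𝔸.VJ J) {η : V}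
    (hη : η ∈ 𝔸.facetOf ε 1 J) : ∃ t : ℝ, 0 < t ∧ n + t • η ∈ 𝔸.facetOf ε 1 J := by
  have hev : ∀ i, ∀ᶠ t : ℝ in atTop, i ∉ J → 0 < 𝔸.root i (ε • (n + t • η)) := by
    intro i
    by_cases hi : i ∈ J
    · simp [hi]
    have hpos := (𝔸.mem_dir.1 hη).2 i hi
    filter_upwards [eventually_gt_atTop (|𝔸.root i (ε • n)| / 𝔸.root i (ε • η))] with t ht _
    rw [div_lt_iff₀ hpos] at ht
    have e : ε • t • η = t • ε • η := by
      rcases Int.units_eq_one_or ε with rfl | rfl <;> simp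
    rw [smul_add, e, map_add, map_smul (𝔸.root i) t, smul_eq_mul]
    linarith [neg_abs_le (𝔸.root i (ε • n))]
  obtain ⟨t, ht, ht0⟩ := ((eventually_all.2 hev).and (eventually_gt_atTop 0)).exists
  refine ⟨t, ht0, 𝔸.mem_dir.2 ⟨fun i hi => ?_, ht⟩⟩
  rw [RootBasis.map_units_smul, map_add, map_smul, 𝔸.mem_VJ.1 hn i hi,
    𝔸.mem_VJ.1 (𝔸.dir_subset_VJ hη) i hi, smul_zero, add_zero, smul_zero]

theorem germ_le_germ_add [FiniteDimensional ℝ V] (x n : V) (hn : n ∈ 𝔸.VJ J) :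
    sectorFaceGerm x (𝔸.facetOf ε 1 J) ≤ sectorFaceGerm (x + n) (𝔸.facetOf ε 1 J) := by
  intro S hS
  rw [mem_germ] at hS ⊢
  obtain ⟨ξ, hξ, h⟩ := hS
  obtain ⟨η, hη⟩ := 𝔸.facetOf_nonempty ε 1 J
  obtain ⟨t, ht, hm⟩ := 𝔸.exists_add_smul_mem_dir n hn hη
  refine ⟨ξ + (n + t • η), closure_dir_add 𝔸 hξ (subset_closure hm), fun v hv => ?_⟩
  have := h (t • η + v) (𝔸.dir_add (𝔸.facetOf_smul hη ht) hv)
  convert this using 1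
  abel

/-- The germ of `x + F^v` only depends on the class of `x` modulo the support of `F^v`. -/
theorem germ_add [FiniteDimensional ℝ V] (x n : V) (hn : n ∈ 𝔸.VJ J) :
    sectorFaceGerm (x + n) (𝔸.facetOf ε 1 J) = sectorFaceGerm x (𝔸.facetOf ε 1 J) := by
  refine le_antisymm ?_ (𝔸.germ_le_germ_add x n hn)
  have := 𝔸.germ_le_germ_add (ε := ε) (x + n) (-n) (neg_mem hn)
  rwa [add_neg_cancel_right] at this

theorem sub_mem_VJ_of_germ_eq [FiniteDimensional ℝ V] {x y : V}
    (h : sectorFaceGerm x (𝔸.facetOf ε 1 J) = sectorFaceGerm y (𝔸.facetOf ε 1 J)) :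
    y - x ∈ 𝔸.VJ J := by
  have h0 : {x} + 𝔸.facetOf ε 1 J ∈ sectorFaceGerm x (𝔸.facetOf ε 1 J) :=
    𝔸.mem_germ.2 ⟨0, 𝔸.zero_mem_closure_dir, fun v hv => by
      rw [add_zero]; exact Set.add_mem_add rfl hv⟩
  rw [h, mem_germ] at h0
  obtain ⟨ξ, hξ, h1⟩ := h0
  obtain ⟨η, hη⟩ := 𝔸.facetOf_nonempty ε 1 J
  obtain ⟨x', hx', u, hu, e⟩ := h1 η hη
  rw [Set.mem_singleton_iff] at hx'
  subst hx'
  have e' : y - x' = u - ξ - η := by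
    have : x' + u = y + ξ + η := e
    rw [← sub_eq_zero] at this ⊢
    rw [← neg_eq_zero, ← this]
    abel
  rw [e']
  exact sub_mem (sub_mem (𝔸.dir_subset_VJ hu) (𝔸.closure_dir_subset_VJ hξ)) (𝔸.dir_subset_VJ hη)

theorem mem_parabolic_of_image_dir [FiniteDimensional ℝ V] {w : V ≃ₗ[ℝ] V} (hw : w ∈ 𝔸.weyl)
    (h : w '' 𝔸.facetOf ε 1 J = 𝔸.facetOf ε 1 J) : w ∈ 𝔸.parabolic J := by
  obtain ⟨η, hη⟩ := 𝔸.facetOf_nonempty ε 1 J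
  have h1 : w η ∈ 𝔸.facetOf ε 1 J := h ▸ Set.mem_image_of_mem w hη
  rw [mem_dir] at hη h1
  refine 𝔸.mem_parabolic_of_apply_mem hw hη ?_
  rwa [← LinearEquiv.coe_toLinearMap, RootBasis.map_units_smul]

theorem image_dir_of_mem_parabolic {w : V ≃ₗ[ℝ] V} (hw : w ∈ 𝔸.parabolic J) :
    w '' 𝔸.facetOf ε 1 J = 𝔸.facetOf ε 1 J := by
  conv_rhs => rw [← Set.image_id (𝔸.facetOf ε 1 J)]
  exact Set.image_congr fun v hv => 𝔸.parabolic_apply_of_mem_VJ hw (𝔸.dir_subset_VJ hv)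

theorem roots_nonneg_dir_of_sector {α : Module.Dual ℝ V} {x : V} {k : ℝ}
    (h : ∀ v ∈ 𝔸.facetOf ε 1 J, 0 ≤ α (x + v) + k) {v : V} (hv : v ∈ 𝔸.facetOf ε 1 J) :
    0 ≤ α v := by
  by_contra! hneg
  have h1 := h _ (𝔸.facetOf_smul hv (t := (|α x + k| + 1) / -(α v))
    (div_pos (by positivity) (by linarith)))
  have : (|α x + k| + 1) / -(α v) * α v = -(|α x + k| + 1) := by
    rw [div_neg, neg_mul, div_mul_cancel₀ _ hneg.ne]
  rw [map_add, map_smul, smul_eq_mul, this] at h1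
  linarith [le_abs_self (α x + k)]

/-- A half-space which contains a sector face has a root nonnegative on the direction, hence is
stable under translation by this direction. -/
theorem IsEnclosed.add_dir_mem {𝔸 : ModelApartment V I} {S : Set V} (hS : 𝔸.IsEnclosed S) {x : V}
    (h : ∀ v ∈ 𝔸.facetOf ε 1 J, x + v ∈ S) {y v : V} (hy : y ∈ S)
    (hv : v ∈ 𝔸.facetOf ε 1 J) : y + v ∈ S := by
  obtain ⟨D, hD, rfl⟩ := hS
  simp only [Set.mem_iInter] at *
  intro α hα
  have h1 := fun v hv => h v hv α hα
  have h2 := hy α hα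
  rcases hD α hα with e | ⟨k, -, e⟩
  · rw [e]
    trivial
  · rw [e] at h1 h2 ⊢
    have h3 := 𝔸.roots_nonneg_dir_of_sector h1 hv
    have h4 : 0 ≤ α y + k := h2
    change 0 ≤ α (y + v) + k
    rw [map_add]
    linarith

theorem IsHalfFamily.add_mem_iff {𝔸 : ModelApartment V I} {D : Module.Dual ℝ V → Set V}
    (hD : 𝔸.IsHalfFamily D) {α : Module.Dual ℝ V} (hα : α ∈ 𝔸.rootsJ J) {y n : V}
    (hn : n ∈ 𝔸.VJ J) : y + n ∈ D α ↔ y ∈ D α := by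
  rcases hD α (𝔸.rootsJ_subset_roots J hα) with e | ⟨k, -, e⟩
  · simp [e]
  · rw [e]
    change 0 ≤ α (y + n) + k ↔ 0 ≤ α y + k
    rw [map_add, 𝔸.rootsJ_apply hα hn, add_zero]

variable [FiniteDimensional ℝ V]

theorem nonneg_of_sector {α : Module.Dual ℝ V} {x : V} {k : ℝ}
    (h : ∀ v ∈ 𝔸.facetOf ε 1 J, 0 ≤ α (x + v) + k) : 0 ≤ α x + k := by
  obtain ⟨η, hη⟩ := 𝔸.facetOf_nonempty ε 1 J
  have hlim : Tendsto (fun t : ℝ => α x + t * α η + k) (𝓝[>] 0) (𝓝 (α x + 0 * α η + k)) :=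
    ((by fun_prop : Continuous fun t : ℝ => α x + t * α η + k).tendsto 0).mono_left
      nhdsWithin_le_nhds
  rw [zero_mul, add_zero] at hlim
  refine ge_of_tendsto hlim ?_
  filter_upwards [self_mem_nhdsWithin] with t ht
  have := h _ (𝔸.facetOf_smul hη ht)
  rwa [map_add, map_smul, smul_eq_mul] at this

/-- An enclosed set containing the sector face `x + F^v` and the germ of `x + F₁` contains the germ
of the chimney. -/
theorem IsEnclosed.mem_chimneyGerm {𝔸 : ModelApartment V I} {S : Set V} (hS : 𝔸.IsEnclosed S)
    {x : V} {F₁ : Set V} (h₁ : S ∈ localFacet x F₁) (h : ∀ v ∈ 𝔸.facetOf ε 1 J, x + v ∈ S) :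
    S ∈ 𝔸.chimneyGerm x F₁ (𝔸.facetOf ε 1 J) := by
  refine mem_iInf_of_mem 0 (mem_iInf_of_mem 𝔸.zero_mem_closure_dir ?_)
  unfold chimney
  rw [mem_cl]
  refine ⟨S, hS, mem_add.2 ⟨S, hS.mem_facet h₁, _, mem_principal_self _, ?_⟩, subset_rfl⟩
  rintro _ ⟨y, hy, _, ⟨z, hz, v, hv, rfl⟩, rfl⟩
  rw [Set.mem_singleton_iff] at hz
  subst hz
  simp only [zero_add]
  exact hS.add_dir_mem h hy hv

theorem mem_chimneyGerm_iff {x : V} {F₁ T : Set V} :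
    T ∈ 𝔸.chimneyGerm x F₁ (𝔸.facetOf ε 1 J) ↔
      ∃ ξ ∈ closure (𝔸.facetOf ε 1 J), T ∈ 𝔸.chimney x F₁ (𝔸.facetOf ε 1 J) ξ := by
  unfold chimneyGerm
  rw [mem_biInf_of_directed]
  · intro ξ hξ η hη
    have key : ∀ ξ η, η ∈ closure (𝔸.facetOf ε 1 J) →
        𝔸.chimney x F₁ (𝔸.facetOf ε 1 J) (ξ + η) ≤ 𝔸.chimney x F₁ (𝔸.facetOf ε 1 J) ξ := by
      intro ξ η hη
      refine 𝔸.cl_mono (add_le_add le_rfl (principal_mono.2 ?_))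
      rw [Set.singleton_add, Set.image_subset_iff]
      intro v hv
      exact ⟨ξ, rfl, η + v, 𝔸.dir_closure_add hη hv, by simp only; abel⟩
    refine ⟨ξ + η, 𝔸.closure_dir_add hξ hη, key ξ η hη, ?_⟩
    rw [add_comm ξ η]
    exact key η ξ hξ
  · exact ⟨0, 𝔸.zero_mem_closure_dir⟩

/-- The point `x` is in the closure of every member of the base facet; the sector face at `x` is
reached as a limit because `S` is closed. -/
theorem sector_subset_of_mem_chimney {x ξ : V} {F₁ S : Set V} (hF : 𝔸.IsVectorialFacet F₁)
    (h : S ∈ 𝔸.facet x F₁ + 𝓟 ({ξ} + 𝔸.facetOf ε 1 J)) (hS : IsClosed S) {v : V}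
    (hv : v ∈ 𝔸.facetOf ε 1 J) : x + ξ + v ∈ S := by
  obtain ⟨T, hT, P, hP, hsub⟩ := mem_add.1 h
  have hx := 𝔸.mem_closure_of_mem_localFacet hF (𝔸.localFacet_le_facet x F₁ hT)
  have : T ⊆ (fun y => y + (ξ + v)) ⁻¹' S := fun y hy =>
    hsub (Set.add_mem_add hy (hP (Set.add_mem_add rfl hv)))
  have h2 := closure_minimal this (hS.preimage (by fun_prop)) hx
  rw [add_assoc]
  exact h2

/-- The shortening vector is in `V_J`, where the roots of `Φ_J` vanish: their half-spaces therefore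
still contain the unshifted local facet, whereas for the other roots only the shifted sector face is
retained. -/
theorem exists_family_of_mem_chimneyGerm {x : V} {F₁ T : Set V} (hF : 𝔸.IsVectorialFacet F₁)
    (hT : T ∈ 𝔸.chimneyGerm x F₁ (𝔸.facetOf ε 1 J)) :
    ∃ D, 𝔸.IsHalfFamily D ∧ (⋂ α ∈ 𝔸.roots, D α) ⊆ T ∧
      (∃ ξ ∈ closure (𝔸.facetOf ε 1 J), ∀ v ∈ 𝔸.facetOf ε 1 J,
        x + ξ + v ∈ ⋂ α ∈ 𝔸.roots, D α) ∧
      ∀ α ∈ 𝔸.rootsJ J, D α ∈ localFacet x F₁ := by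
  rw [mem_chimneyGerm_iff] at hT
  obtain ⟨ξ, hξ, hT⟩ := hT
  unfold chimney at hT
  rw [mem_cl] at hT
  obtain ⟨S, hS, h1, h2⟩ := hT
  have hcl := hS.isClosed
  obtain ⟨D, hD, rfl⟩ := hS
  refine ⟨D, hD, h2, ⟨ξ, hξ, fun v hv => 𝔸.sector_subset_of_mem_chimney hF h1 hcl hv⟩,
    fun α hα => ?_⟩
  obtain ⟨T, hT, P, hP, hsub⟩ := mem_add.1 h1
  refine mem_of_superset (𝔸.localFacet_le_facet x F₁ hT) fun y hy => ?_
  obtain ⟨η, hη⟩ := 𝔸.facetOf_nonempty ε 1 J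
  have h3 := hsub (Set.add_mem_add hy (hP (Set.add_mem_add rfl hη)))
  simp only [Set.mem_iInter] at h3
  have h4 := h3 α (𝔸.rootsJ_subset_roots J hα)
  rcases hD α (𝔸.rootsJ_subset_roots J hα) with e | ⟨k, -, e⟩
  · rw [e]
    trivial
  · rw [e] at h4 ⊢
    have h5 : 0 ≤ α (y + (ξ + η)) + k := h4
    rwa [map_add, map_add, 𝔸.rootsJ_apply hα (𝔸.closure_dir_subset_VJ hξ),
      𝔸.rootsJ_apply hα (𝔸.dir_subset_VJ hη), add_zero, add_zero] at h5

/-- The uniform ball of `exists_ball_nonneg`, rescaled: one `t` serves for all roots positive at `η`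
at once. -/
theorem exists_smul_add_nonneg (hJ : 𝔸.IsSpherical J) {η : V} (hη : η ∈ 𝔸.facetOf ε 1 J) (v : V) :
    ∃ t : ℝ, 0 < t ∧ ∀ α ∈ 𝔸.roots, 0 < α η → 0 ≤ α (t • η + v) := by
  obtain ⟨r, hr, h⟩ := 𝔸.exists_ball_nonneg hJ hη
  have hpos : 0 < ‖v‖ + 1 := by positivity
  have ht0 : 0 < r / (‖v‖ + 1) := div_pos hr hpos
  refine ⟨(r / (‖v‖ + 1))⁻¹, inv_pos.2 ht0, fun α hα hα' => ?_⟩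
  have h1 := h ((r / (‖v‖ + 1)) • v) (by
    rw [norm_smul, Real.norm_of_nonneg ht0.le, div_mul_eq_mul_div, div_lt_iff₀ hpos]
    exact mul_lt_mul_of_pos_left (by linarith) hr) α hα hα'
  have e : (r / (‖v‖ + 1))⁻¹ • η + v =
      (r / (‖v‖ + 1))⁻¹ • (η + (r / (‖v‖ + 1)) • v) := by
    rw [smul_add, smul_smul, inv_mul_cancel₀ ht0.ne', one_smul]
  rw [e, map_smul]
  exact mul_nonneg (inv_pos.2 ht0).le h1

/-- The germs of sector faces of direction `F^v` contained in an enclosed set which contains one of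
them are determined by the half-spaces associated to the roots vanishing on `F^v`. -/
theorem IsHalfFamily.mem_germ_iff {𝔸 : ModelApartment V I} {D : Module.Dual ℝ V → Set V}
    (hD : 𝔸.IsHalfFamily D) (hJ : 𝔸.IsSpherical J) {x : V}
    (h : ∀ v ∈ 𝔸.facetOf ε 1 J, x + v ∈ ⋂ α ∈ 𝔸.roots, D α) {z : V} :
    (⋂ α ∈ 𝔸.roots, D α) ∈ sectorFaceGerm z (𝔸.facetOf ε 1 J) ↔
      ∀ α ∈ 𝔸.rootsJ J, z ∈ D α := by
  obtain ⟨η, hη⟩ := 𝔸.facetOf_nonempty ε 1 J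
  rw [mem_germ]
  simp only [Set.mem_iInter] at h ⊢
  constructor
  · rintro ⟨ξ, hξ, h1⟩ α hα
    have h2 := h1 η hη α (𝔸.rootsJ_subset_roots J hα)
    rwa [hD.add_mem_iff hα (𝔸.dir_subset_VJ hη),
      hD.add_mem_iff hα (𝔸.closure_dir_subset_VJ hξ)] at h2
  · intro h1
    -- Far enough along `η`, the passage from `x` to `z` costs nothing for the roots positive at
    -- `η`. The remaining roots that bound a half-space of the family vanish at `η`, hence are in
    -- `Φ_J`, and do not see the translation.
    obtain ⟨t, ht, hpos⟩ := 𝔸.exists_smul_add_nonneg hJ hη (z - x)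
    have htη := 𝔸.facetOf_smul hη ht
    refine ⟨t • η, subset_closure htη, fun v hv α hα => ?_⟩
    rcases hD α hα with e | ⟨k, -, e⟩
    · rw [e]
      trivial
    have h2 : ∀ v ∈ 𝔸.facetOf ε 1 J, 0 ≤ α (x + v) + k := fun v hv => by
      have := h v hv α hα
      rwa [e] at this
    have hx := 𝔸.nonneg_of_sector h2
    have h0 := 𝔸.roots_nonneg_dir_of_sector h2 hη
    rcases h0.lt_or_eq with h0 | h0
    · rw [e]
      have h3 := hpos α hα h0
      have h4 := 𝔸.roots_nonneg_dir_of_sector h2 hv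
      change 0 ≤ α (z + t • η + v) + k
      rw [map_add, map_sub] at h3
      rw [map_add, map_add]
      linarith
    · have hαJ := 𝔸.mem_rootsJ_of_apply_eq_zero hJ hη hα h0.symm
      rw [hD.add_mem_iff hαJ (𝔸.dir_subset_VJ hv), hD.add_mem_iff hαJ (𝔸.dir_subset_VJ htη)]
      exact h1 α hαJ

theorem mem_of_mem_localFacet {x : V} {F₁ : Set V} (hF : 𝔸.IsVectorialFacet F₁)
    {D : Module.Dual ℝ V → Set V} (hD : 𝔸.IsHalfFamily D) {α : Module.Dual ℝ V}
    (hα : α ∈ 𝔸.roots) (h : D α ∈ localFacet x F₁) : x ∈ D α := by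
  have := 𝔸.mem_closure_of_mem_localFacet hF h
  rwa [(hD.isClosed hα).closure_eq] at this

theorem chimneyGerm_mem_germ (hJ : 𝔸.IsSpherical J) {x : V} {F₁ T : Set V}
    (hF : 𝔸.IsVectorialFacet F₁) (hT : T ∈ 𝔸.chimneyGerm x F₁ (𝔸.facetOf ε 1 J)) :
    T ∈ sectorFaceGerm x (𝔸.facetOf ε 1 J) := by
  obtain ⟨D, hD, hsub, ⟨ξ, hξ, h⟩, hloc⟩ := 𝔸.exists_family_of_mem_chimneyGerm hF hT
  refine mem_of_superset ((hD.mem_germ_iff hJ h).2 fun α hα => ?_) hsub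
  exact 𝔸.mem_of_mem_localFacet hF hD (𝔸.rootsJ_subset_roots J hα) (hloc α hα)

/-- The direction of the support contains a vector of the spherical facet, whose fixator lies in the
finite group `W^v(J)`. Chimney germs of this direction can thus occupy either place in (MA3) and
(MA4). -/
theorem isSolid_dir (hJ : 𝔸.IsSpherical J) (x : V) {F₁ : Set V} (hF : 𝔸.IsVectorialFacet F₁) :
    𝔸.IsSolid x F₁ (𝔸.facetOf ε 1 J) := by
  refine Set.Finite.subset hJ ?_
  rintro w ⟨hw, hfix⟩
  obtain ⟨η, hη⟩ := 𝔸.facetOf_nonempty ε 1 J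
  have hmem : ∀ v ∈ 𝔸.facetOf ε 1 J,
      x + v ∈ support (𝔸.chimney x F₁ (𝔸.facetOf ε 1 J) 0) := by
    intro v hv
    unfold support
    rw [← SetLike.mem_coe, AffineSubspace.coe_sInf, Set.mem_iInter₂]
    intro E hE
    have hE' : (E : Set V) ∈ 𝔸.chimney x F₁ (𝔸.facetOf ε 1 J) 0 := hE
    unfold chimney at hE'
    rw [mem_cl] at hE'
    obtain ⟨S, hS, h1, h2⟩ := hE'
    have := 𝔸.sector_subset_of_mem_chimney hF h1 hS.isClosed hv
    rw [add_zero] at this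
    exact h2 this
  have hdir : η ∈ (support (𝔸.chimney x F₁ (𝔸.facetOf ε 1 J) 0)).direction := by
    have := AffineSubspace.vsub_mem_direction (hmem _ (𝔸.dir_add hη hη)) (hmem _ hη)
    rwa [vsub_eq_sub, add_sub_add_left_eq_sub, add_sub_cancel_right] at this
  have h1 := hfix η hdir
  rw [mem_dir] at hη
  refine 𝔸.mem_parabolic_of_apply_mem hw hη ?_
  rwa [← LinearEquiv.coe_toLinearMap, RootBasis.map_units_smul, LinearEquiv.coe_toLinearMap, h1]

end Direction

end ModelApartment

/-! ## The Euclidean apartment `𝔸_J` -/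

theorem exists_smul_eq_of_hyperplane_eq {E : Type*} [AddCommGroup E] [Module ℝ E]
    {φ ψ : Module.Dual ℝ E} {k l : ℝ} (hφ : φ ≠ 0)
    (h : {v | φ v + k = 0} = {v | ψ v + l = 0}) : ∃ c : ℝ, c ≠ 0 ∧ φ = c • ψ ∧ k = c * l := by
  obtain ⟨x, hx⟩ := LinearMap.surjective hφ (-k)
  have hx1 : φ x + k = 0 := by rw [hx, neg_add_cancel]
  have hx2 : ψ x + l = 0 := by
    have : x ∈ {v | φ v + k = 0} := hx1
    rwa [h] at this
  have hker : LinearMap.ker ψ ≤ LinearMap.ker φ := by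
    intro v hv
    rw [LinearMap.mem_ker] at hv ⊢
    have : x + v ∈ {v | ψ v + l = 0} := by
      change ψ (x + v) + l = 0
      rw [map_add, hv, add_zero, hx2]
    rw [← h] at this
    have h3 : φ (x + v) + k = 0 := this
    rw [map_add] at h3
    linarith
  have := mem_span_of_iInf_ker_le_ker (L := fun _ : Unit => ψ) (K := φ) (by
    simpa using hker)
  rw [Set.range_const, Submodule.mem_span_singleton] at this
  obtain ⟨c, rfl⟩ := this
  refine ⟨c, ?_, rfl, ?_⟩
  · rintro rfl
    simp at hφ
  · rw [LinearMap.smul_apply, smul_eq_mul] at hx1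
    linear_combination hx1 - c * hx2

namespace ModelApartment

variable {V : Type*} [NormedAddCommGroup V] [NormedSpace ℝ V] {I : Type*} [Fintype I]
  (𝔸 : ModelApartment V I) {J : Set I}

/-- The linear form on `V / V_J` induced by a root of `Φ_J`. -/
def barJ {α : Module.Dual ℝ V} (h : α ∈ 𝔸.rootsJ J) : Module.Dual ℝ (V ⧸ 𝔸.VJ J) :=
  (𝔸.VJ J).liftQ α fun _ hv => 𝔸.rootsJ_apply h hv

theorem barJ_mk {α : Module.Dual ℝ V} (h : α ∈ 𝔸.rootsJ J) (x : V) :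
    𝔸.barJ h ((𝔸.VJ J).mkQ x) = α x := rfl

theorem barJ_ne_zero {α : Module.Dual ℝ V} (h : α ∈ 𝔸.rootsJ J) : 𝔸.barJ h ≠ 0 := by
  intro h0
  apply 𝔸.ne_zero_of_mem_realRoots h.1
  ext x
  rw [← 𝔸.barJ_mk h, h0]
  rfl

theorem image_mkQ_wallOf {α : Module.Dual ℝ V} (h : α ∈ 𝔸.rootsJ J) (k : ℝ) :
    (𝔸.VJ J).mkQ '' wallOf α k = {v | 𝔸.barJ h v + k = 0} := by
  ext v
  obtain ⟨x, rfl⟩ := (𝔸.VJ J).mkQ_surjective v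
  constructor
  · rintro ⟨y, hy, e⟩
    rw [← e]
    exact hy
  · intro hx
    exact ⟨x, hx, rfl⟩

theorem mem_wallsJ_of_wall {α : Module.Dual ℝ V} (h : α ∈ 𝔸.rootsJ J) {k : ℝ}
    (hk : wallOf α k ∈ 𝔸.walls) : {v | 𝔸.barJ h v + k = 0} ∈ 𝔸.wallsJ J :=
  ⟨α, h.1, h.2, k, hk, (𝔸.image_mkQ_wallOf h k).symm⟩

theorem exists_smul_of_mem_wallsJ {φ : Module.Dual ℝ (V ⧸ 𝔸.VJ J)} (hφ : φ ≠ 0) {k : ℝ}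
    (h : {v | φ v + k = 0} ∈ 𝔸.wallsJ J) : ∃ (α : Module.Dual ℝ V) (hα : α ∈ 𝔸.rootsJ J) (l : ℝ),
      wallOf α l ∈ 𝔸.walls ∧ ∃ c : ℝ, c ≠ 0 ∧ φ = c • 𝔸.barJ hα ∧ k = c * l := by
  obtain ⟨α, h1, h2, l, hl, e⟩ := h
  have hα : α ∈ 𝔸.rootsJ J := ⟨h1, h2⟩
  rw [𝔸.image_mkQ_wallOf hα] at e
  exact ⟨α, hα, l, hl, exists_smul_eq_of_hyperplane_eq hφ e⟩

/-! ### Closed facets of `𝔸_J` -/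

theorem wallOf_neg (α : Module.Dual ℝ V) (k : ℝ) : wallOf (-α) (-k) = wallOf α k := by
  ext v
  simp only [wallOf, Set.mem_ofPred_eq, LinearMap.neg_apply]
  constructor <;> intro h <;> linarith

theorem mem_halfSpaces_iff {H : Set (V ⧸ 𝔸.VJ J)} :
    H ∈ EuclideanBuilding.halfSpaces (𝔸.wallsJ J) ↔
      ∃ (α : Module.Dual ℝ V) (hα : α ∈ 𝔸.rootsJ J) (k : ℝ), wallOf α k ∈ 𝔸.walls ∧
        H = {v | 0 ≤ 𝔸.barJ hα v + k} := by
  constructor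
  · rintro ⟨φ, k, hφ, hw, rfl⟩
    obtain ⟨α, hα, l, hl, c, hc, rfl, rfl⟩ := 𝔸.exists_smul_of_mem_wallsJ hφ hw
    have e : ∀ v, (c • 𝔸.barJ hα) v + c * l = c * (𝔸.barJ hα v + l) := fun v => by
      rw [LinearMap.smul_apply, smul_eq_mul]
      ring
    rcases hc.lt_or_gt with hc | hc
    -- A negative factor exchanges the two sides of the wall, and the opposite root describes the
    -- other side.
    · refine ⟨-α, 𝔸.neg_mem_rootsJ hα, -l, by rwa [wallOf_neg], ?_⟩
      ext v
      simp only [Set.mem_ofPred_eq, e]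
      have e2 : 𝔸.barJ (𝔸.neg_mem_rootsJ hα) v = -𝔸.barJ hα v := by
        obtain ⟨x, rfl⟩ := (𝔸.VJ J).mkQ_surjective v
        rfl
      rw [e2, ← neg_add, neg_nonneg]
      exact ⟨fun h => nonpos_of_mul_nonneg_right h hc,
        fun h => mul_nonneg_of_nonpos_of_nonpos hc.le h⟩
    · refine ⟨α, hα, l, hl, ?_⟩
      ext v
      simp only [Set.mem_ofPred_eq, e]
      exact mul_nonneg_iff_of_pos_left hc
  · rintro ⟨α, hα, k, hk, rfl⟩
    exact ⟨𝔸.barJ hα, k, 𝔸.barJ_ne_zero hα, 𝔸.mem_wallsJ_of_wall hα hk, rfl⟩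

theorem continuous_mkQ (J : Set I) : Continuous (𝔸.VJ J).mkQ :=
  (𝔸.VJ J).isOpenQuotientMap_mkQ.continuous

theorem continuous_barJ [FiniteDimensional ℝ V] {α : Module.Dual ℝ V} (h : α ∈ 𝔸.rootsJ J) :
    Continuous (𝔸.barJ h) := by
  rw [(𝔸.VJ J).isOpenQuotientMap_mkQ.isQuotientMap.continuous_iff]
  exact α.continuous_of_finiteDimensional

/-- The criterion is literally that of `halfOf_mem_localFacet_iff`, so local facets of `𝔸` and
closed facets of the quotient lie in the same half-spaces for `Φ_J`. -/
theorem half_mem_germ_iff [FiniteDimensional ℝ V] {α : Module.Dual ℝ V} (hα : α ∈ 𝔸.rootsJ J)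
    {k : ℝ} {x u : V} :
    {v | 0 ≤ 𝔸.barJ hα v + k} ∈ 𝓝 ((𝔸.VJ J).mkQ x) ⊓ 𝓟 ({(𝔸.VJ J).mkQ x} +
      EuclideanBuilding.vectorialFacet (𝔸.wallsJ J) ((𝔸.VJ J).mkQ u)) ↔
      0 < α x + k ∨ α x + k = 0 ∧ 0 ≤ α u := by
  constructor
  · intro h
    have hlim : Tendsto (fun t : ℝ => (𝔸.VJ J).mkQ (x + t • u)) (𝓝[>] 0)
        (𝓝 ((𝔸.VJ J).mkQ x) ⊓ 𝓟 ({(𝔸.VJ J).mkQ x} +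
          EuclideanBuilding.vectorialFacet (𝔸.wallsJ J) ((𝔸.VJ J).mkQ u))) := by
      refine tendsto_inf.2 ⟨?_, ?_⟩
      · have : Tendsto (fun t : ℝ => (𝔸.VJ J).mkQ (x + t • u)) (𝓝 0)
            (𝓝 ((𝔸.VJ J).mkQ (x + (0 : ℝ) • u))) :=
          ((𝔸.continuous_mkQ J).comp
            (by fun_prop : Continuous fun t : ℝ => x + t • u)).tendsto 0
        rw [zero_smul, add_zero] at this
        exact this.mono_left nhdsWithin_le_nhds
      · rw [tendsto_principal]
        filter_upwards [self_mem_nhdsWithin] with t ht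
        rw [map_add]
        refine Set.add_mem_add rfl fun φ l _ _ => ?_
        rw [map_smul, map_smul, smul_eq_mul, sign_mul, sign_pos ht, one_mul]
    have hev := hlim.eventually h
    have h2 : 0 ≤ α x + k := by
      have hc : Tendsto (fun t : ℝ => α x + t * α u + k) (𝓝[>] 0) (𝓝 (α x + 0 * α u + k)) :=
        ((by fun_prop : Continuous fun t : ℝ => α x + t * α u + k).tendsto 0).mono_left
          nhdsWithin_le_nhds
      rw [zero_mul, add_zero] at hc
      refine ge_of_tendsto hc ?_
      filter_upwards [hev] with t ht
      have ht' : 0 ≤ α (x + t • u) + k := ht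
      rwa [map_add, map_smul, smul_eq_mul] at ht'
    rcases h2.lt_or_eq with h3 | h3
    · exact Or.inl h3
    · obtain ⟨t, h1, ht⟩ := (hev.and self_mem_nhdsWithin).exists
      refine Or.inr ⟨h3.symm, ?_⟩
      have h4 : 0 ≤ α (x + t • u) + k := h1
      rw [map_add, map_smul, smul_eq_mul] at h4
      exact nonneg_of_mul_nonneg_right (by linarith : 0 ≤ t * α u) ht
  · rintro (h | ⟨h1, h2⟩)
    · refine mem_inf_of_left ?_
      have hcont : Continuous fun v => 𝔸.barJ hα v + k :=
        (𝔸.continuous_barJ hα).add continuous_const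
      have h' : 0 < 𝔸.barJ hα ((𝔸.VJ J).mkQ x) + k := h
      filter_upwards [hcont.continuousAt.eventually (lt_mem_nhds h')] with v hv
      exact hv.le
    · refine mem_inf_of_right ?_
      rw [mem_principal, Set.singleton_add, Set.image_subset_iff]
      intro v hv
      obtain ⟨l, hl⟩ := 𝔸.exists_wall hα.1
      have h3 := hv _ l (𝔸.barJ_ne_zero hα) (𝔸.mem_wallsJ_of_wall hα hl)
      have h4 : 0 ≤ 𝔸.barJ hα v := by
        rw [← sign_nonneg_iff, h3, sign_nonneg_iff]
        exact h2
      change 0 ≤ 𝔸.barJ hα ((𝔸.VJ J).mkQ x + v) + k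
      rw [map_add, barJ_mk]
      linarith

/-- A half-space bounded by a wall of `𝔸_J` is in the closed facet of `x` and `u` if and only if
the corresponding half-space of `𝔸` contains the germ of `x + F`, when `u ∈ F`. -/
theorem half_mem_germ_iff_localFacet [FiniteDimensional ℝ V] {α : Module.Dual ℝ V}
    (hα : α ∈ 𝔸.rootsJ J) {k : ℝ} {x u : V} {F : Set V} (hF : 𝔸.IsVectorialFacet F) (hu : u ∈ F) :
    {v | 0 ≤ 𝔸.barJ hα v + k} ∈ 𝓝 ((𝔸.VJ J).mkQ x) ⊓ 𝓟 ({(𝔸.VJ J).mkQ x} +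
      EuclideanBuilding.vectorialFacet (𝔸.wallsJ J) ((𝔸.VJ J).mkQ u)) ↔
      halfOf α k ∈ localFacet x F := by
  rw [half_mem_germ_iff, 𝔸.halfOf_mem_localFacet_iff hF hu (𝔸.rootsJ_subset_roots J hα)]

/-- Finiteness of `Φ_J` is essential: the enclosure in the quotient is generated by finite
intersections, while `D` assigns a half-space to every root. -/
theorem mem_closedFacet_of_family [FiniteDimensional ℝ V] (hJ : 𝔸.IsSpherical J)
    {D : Module.Dual ℝ V → Set V} (hD : 𝔸.IsHalfFamily D) {x u : V}
    {F : Set V} (hF : 𝔸.IsVectorialFacet F) (hu : u ∈ F)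
    (h : ∀ α ∈ 𝔸.rootsJ J, D α ∈ localFacet x F) {T : Set (V ⧸ 𝔸.VJ J)}
    (hT : ∀ z, (∀ α ∈ 𝔸.rootsJ J, z ∈ D α) → (𝔸.VJ J).mkQ z ∈ T) :
    T ∈ EuclideanBuilding.closedFacet (𝔸.wallsJ J) ((𝔸.VJ J).mkQ x) ((𝔸.VJ J).mkQ u) := by
  have hm : (⋂ α ∈ 𝔸.rootsJ J, (𝔸.VJ J).mkQ '' D α) ∈
      EuclideanBuilding.closedFacet (𝔸.wallsJ J) ((𝔸.VJ J).mkQ x) ((𝔸.VJ J).mkQ u) := by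
    rw [biInter_mem (𝔸.rootsJ_finite hJ)]
    intro α hα
    rcases hD α (𝔸.rootsJ_subset_roots J hα) with e | ⟨k, hk, e⟩
    · rw [e, Set.image_univ, Set.range_eq_univ.2 (𝔸.VJ J).mkQ_surjective]
      exact univ_mem
    · have hk' : wallOf α k ∈ 𝔸.walls := by
        rcases hk with hk | hk
        · exact hk.2
        · exact absurd hk (by simpa using 𝔸.im_disjoint α hα.1 1)
      have e2 : (𝔸.VJ J).mkQ '' D α = {v | 0 ≤ 𝔸.barJ hα v + k} := by
        rw [e]
        ext v
        obtain ⟨y, rfl⟩ := (𝔸.VJ J).mkQ_surjective v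
        constructor
        · rintro ⟨y', hy, e⟩
          rw [← e]
          exact hy
        · exact fun hy => ⟨y, hy, rfl⟩
      rw [e2]
      refine GenerateSets.basic ⟨𝔸.mem_halfSpaces_iff.2 ⟨α, hα, k, hk', rfl⟩, ?_⟩
      rw [𝔸.half_mem_germ_iff_localFacet hα hF hu, ← e]
      exact h α hα
  refine mem_of_superset hm fun v hv => ?_
  obtain ⟨z, rfl⟩ := (𝔸.VJ J).mkQ_surjective v
  refine hT z fun α hα => ?_
  simp only [Set.mem_iInter] at hv
  obtain ⟨y, hy, e⟩ := hv α hα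
  have hyz : z - y ∈ 𝔸.VJ J := by
    rw [← Submodule.ker_mkQ (𝔸.VJ J), LinearMap.mem_ker, map_sub, e, sub_self]
  have := (hD.add_mem_iff hα hyz (y := y)).2 hy
  rwa [add_sub_cancel] at this

/-- Half-spaces of the quotient pull back to half-spaces for roots of `Φ_J`; a finite intersection
of them is enclosed, invariant under `V_J`, and thus contains sector faces without any shortening.
-/
theorem exists_enclosed_of_mem_closedFacet [FiniteDimensional ℝ V] (ε : ℤˣ) {x u : V}
    {F : Set V} (hF : 𝔸.IsVectorialFacet F) (hu : u ∈ F) {T : Set (V ⧸ 𝔸.VJ J)}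
    (hT : T ∈ EuclideanBuilding.closedFacet (𝔸.wallsJ J) ((𝔸.VJ J).mkQ x) ((𝔸.VJ J).mkQ u)) :
    ∃ S ∈ 𝔸.chimneyGerm x F (𝔸.facetOf ε 1 J), S ⊆ (𝔸.VJ J).mkQ ⁻¹' T ∧
      (∀ y, ∀ n ∈ 𝔸.VJ J, y + n ∈ S → y ∈ S) ∧ S ∈ localFacet x F ∧ x ∈ S := by
  unfold EuclideanBuilding.closedFacet EuclideanBuilding.enclosure at hT
  rw [mem_generate_iff] at hT
  obtain ⟨t, ht, hfin, hsub⟩ := hT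
  have key : ∀ H ∈ t, 𝔸.IsEnclosed ((𝔸.VJ J).mkQ ⁻¹' H) ∧
      (𝔸.VJ J).mkQ ⁻¹' H ∈ localFacet x F := by
    intro H hH
    obtain ⟨h1, h2⟩ := ht hH
    obtain ⟨α, hα, k, hk, rfl⟩ := 𝔸.mem_halfSpaces_iff.1 h1
    exact ⟨isEnclosed_halfOf (𝔸.rootsJ_subset_roots J hα) (Or.inl ⟨hα.1, hk⟩),
      (𝔸.half_mem_germ_iff_localFacet hα hF hu).1 h2⟩
  have e : (𝔸.VJ J).mkQ ⁻¹' (⋂₀ t) = ⋂₀ ((fun H => (𝔸.VJ J).mkQ ⁻¹' H) '' t) := by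
    rw [Set.sInter_image, Set.preimage_sInter]
  have henc : 𝔸.IsEnclosed ((𝔸.VJ J).mkQ ⁻¹' (⋂₀ t)) := by
    rw [e]
    refine IsEnclosed.sInter (hfin.image _) ?_
    rintro _ ⟨H, hH, rfl⟩
    exact (key H hH).1
  have hloc : (𝔸.VJ J).mkQ ⁻¹' (⋂₀ t) ∈ localFacet x F := by
    rw [e, sInter_mem (hfin.image _)]
    rintro _ ⟨H, hH, rfl⟩
    exact (key H hH).2
  have hx : x ∈ (𝔸.VJ J).mkQ ⁻¹' (⋂₀ t) := by
    have := 𝔸.mem_closure_of_mem_localFacet hF hloc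
    rwa [henc.isClosed.closure_eq] at this
  have hsat : ∀ y, ∀ n ∈ 𝔸.VJ J, (𝔸.VJ J).mkQ (y + n) = (𝔸.VJ J).mkQ y := by
    intro y n hn
    rw [map_add, add_eq_left]
    exact (Submodule.Quotient.mk_eq_zero _).2 hn
  refine ⟨_, henc.mem_chimneyGerm hloc fun v hv => ?_, Set.preimage_mono hsub, ?_, hloc, hx⟩
  · rw [Set.mem_preimage, hsat _ _ (𝔸.dir_subset_VJ hv)]
    exact hx
  · intro y n hn h
    rwa [Set.mem_preimage, hsat y n hn] at h

/-! ### The scalar product -/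

/-- The scalar product of `V / V_J`. -/
noncomputable def formBar (hJ : 𝔸.IsSpherical J) : LinearMap.BilinForm ℝ (V ⧸ 𝔸.VJ J) :=
  (𝔸.VJ J).liftQ ((𝔸.VJ J).liftQ (𝔸.formJ hJ) (fun x hx => by
    rw [LinearMap.mem_ker]
    ext y
    exact 𝔸.formJ_eq_zero hJ hx y)).flip (fun x hx => by
    rw [LinearMap.mem_ker]
    ext y
    exact (𝔸.formJ_comm hJ y x).trans (𝔸.formJ_eq_zero hJ hx y))

variable (hJ : 𝔸.IsSpherical J)

theorem formBar_mk (x y : V) :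
    𝔸.formBar hJ ((𝔸.VJ J).mkQ x) ((𝔸.VJ J).mkQ y) = 𝔸.formJ hJ x y :=
  𝔸.formJ_comm hJ y x

theorem formBar_comm (x y : V ⧸ 𝔸.VJ J) : 𝔸.formBar hJ x y = 𝔸.formBar hJ y x := by
  obtain ⟨x, rfl⟩ := (𝔸.VJ J).mkQ_surjective x
  obtain ⟨y, rfl⟩ := (𝔸.VJ J).mkQ_surjective y
  rw [formBar_mk, formBar_mk, formJ_comm]

theorem formBar_pos (x : V ⧸ 𝔸.VJ J) (hx : x ≠ 0) : 0 < 𝔸.formBar hJ x x := by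
  obtain ⟨x, rfl⟩ := (𝔸.VJ J).mkQ_surjective x
  rw [formBar_mk]
  exact 𝔸.formJ_pos hJ fun h => hx ((Submodule.Quotient.mk_eq_zero _).2 h)

theorem mkQ_coroot_ne_zero {α : Module.Dual ℝ V} {c : V} (hc : 𝔸.IsRootPair α c)
    (hα : α ∈ Submodule.span ℝ (𝔸.root '' J)) : (𝔸.VJ J).mkQ c ≠ 0 := fun h =>
  𝔸.coroot_notMem_VJ hc hα ((Submodule.Quotient.mk_eq_zero _).1 h)

theorem WJ_walls_stable {g : (V ⧸ 𝔸.VJ J) ≃ᵃ[ℝ] (V ⧸ 𝔸.VJ J)} (hg : g ∈ 𝔸.WJ J)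
    {M : Set (V ⧸ 𝔸.VJ J)} (hM : M ∈ 𝔸.wallsJ J) : g '' M ∈ 𝔸.wallsJ J := by
  obtain ⟨w, hw, hwl, hgw⟩ := hg
  obtain ⟨α, h1, h2, k, hk, rfl⟩ := hM
  have e : g '' ((𝔸.VJ J).mkQ '' wallOf α k) = (𝔸.VJ J).mkQ '' (w '' wallOf α k) := by
    rw [Set.image_image, Set.image_image]
    exact Set.image_congr fun x _ => hgw x
  have e2 := image_wallOf w⁻¹ α k
  rw [inv_inv] at e2
  have hr := 𝔸.rootsJ_comp ⟨h1, h2⟩ (inv_mem hwl)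
  have hs := 𝔸.walls_stable w hw _ hk
  rw [e2] at hs
  rw [e, e2]
  exact ⟨_, hr.1, hr.2, _, hs, rfl⟩

theorem WJ_linear_mk {g : (V ⧸ 𝔸.VJ J) ≃ᵃ[ℝ] (V ⧸ 𝔸.VJ J)} {w : V ≃ᵃ[ℝ] V}
    (h : ∀ x, g ((𝔸.VJ J).mkQ x) = (𝔸.VJ J).mkQ (w x)) (x : V) :
    g.linear ((𝔸.VJ J).mkQ x) = (𝔸.VJ J).mkQ (w.linear x) := by
  have h1 := affineEquiv_apply w x
  have h2 : g ((𝔸.VJ J).mkQ x) = g.linear ((𝔸.VJ J).mkQ x) + g 0 := by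
    have := g.map_vadd 0 ((𝔸.VJ J).mkQ x)
    rwa [vadd_eq_add, vadd_eq_add, add_zero] at this
  have h3 : g 0 = (𝔸.VJ J).mkQ (w 0) := by
    rw [← h, (𝔸.VJ J).mkQ.map_zero]
  rw [h, h1, h3, map_add, add_comm] at h2
  exact (add_right_cancel h2).symm

theorem WJ_isometry {g : (V ⧸ 𝔸.VJ J) ≃ᵃ[ℝ] (V ⧸ 𝔸.VJ J)} (hg : g ∈ 𝔸.WJ J)
    (x y : V ⧸ 𝔸.VJ J) :
    𝔸.formBar hJ (g x - g y) (g x - g y) = 𝔸.formBar hJ (x - y) (x - y) := by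
  obtain ⟨w, hw, hwl, hgw⟩ := hg
  obtain ⟨x, rfl⟩ := (𝔸.VJ J).mkQ_surjective x
  obtain ⟨y, rfl⟩ := (𝔸.VJ J).mkQ_surjective y
  have e : w x - w y = w.linear (x - y) := by
    rw [affineEquiv_apply w x, affineEquiv_apply w y, map_sub]
    abel
  rw [hgw, hgw, ← map_sub (𝔸.VJ J).mkQ, ← map_sub (𝔸.VJ J).mkQ, e, formBar_mk, formBar_mk]
  exact 𝔸.formJ_inv hJ hwl _ _

variable [FiniteDimensional ℝ V]

theorem formBar_coroot {α : Module.Dual ℝ V} {c : V} (hc : 𝔸.IsRootPair α c)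
    (hα : α ∈ 𝔸.rootsJ J) (v : V ⧸ 𝔸.VJ J) :
    𝔸.formBar hJ ((𝔸.VJ J).mkQ c) v = 𝔸.formJ hJ c c / 2 * 𝔸.barJ hα v := by
  obtain ⟨x, rfl⟩ := (𝔸.VJ J).mkQ_surjective v
  rw [formBar_mk, barJ_mk]
  exact 𝔸.formJ_coroot hJ hc hα.2 x

/-- The orthogonal reflections in the walls of `𝔸_J` are induced by the reflections in the
walls of `𝔸`. -/
theorem exists_rootPair_of_wall {n : V ⧸ 𝔸.VJ J} {d : ℝ} (hn : n ≠ 0)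
    (hw : {v | 𝔸.formBar hJ n v = d} ∈ 𝔸.wallsJ J) :
    ∃ (α : Module.Dual ℝ V) (hα : α ∈ 𝔸.rootsJ J) (c : V) (k : ℝ), 𝔸.IsRootPair α c ∧
      wallOf α k ∈ 𝔸.walls ∧
      (∀ v, (2 * (𝔸.formBar hJ n v - d) / 𝔸.formBar hJ n n) • n =
        (𝔸.barJ hα v + k) • (𝔸.VJ J).mkQ c) ∧
      ∀ v, (2 * 𝔸.formBar hJ n v / 𝔸.formBar hJ n n) • n =
        𝔸.barJ hα v • (𝔸.VJ J).mkQ c := by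
  have hpos := 𝔸.formBar_pos hJ n hn
  have h0 : 𝔸.formBar hJ n ≠ 0 := by
    intro h
    rw [h] at hpos
    simp at hpos
  have hw' : {v | 𝔸.formBar hJ n v + -d = 0} ∈ 𝔸.wallsJ J := by
    convert hw using 3
    rw [← sub_eq_add_neg, sub_eq_zero]
  obtain ⟨α, hα, k, hk, t, ht, e1, e2⟩ := 𝔸.exists_smul_of_mem_wallsJ h0 hw'
  obtain ⟨c, hc⟩ := hα.1
  have hb := 𝔸.formJ_pos hJ (𝔸.coroot_notMem_VJ hc hα.2)
  set b := 𝔸.formJ hJ c c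
  -- Both `n` and the coroot represent multiples of the same form, namely `t` and `b / 2` times the
  -- root, and the scalar product is nondegenerate.
  have hn' : n = (2 * t / b) • (𝔸.VJ J).mkQ c := by
    rw [← sub_eq_zero]
    by_contra hne
    have h1 := 𝔸.formBar_pos hJ _ hne
    have h2 : ∀ v, 𝔸.formBar hJ (n - (2 * t / b) • (𝔸.VJ J).mkQ c) v = 0 := fun v => by
      rw [map_sub, map_smul, LinearMap.sub_apply, LinearMap.smul_apply,
        𝔸.formBar_coroot hJ hc hα, e1, LinearMap.smul_apply, smul_eq_mul, smul_eq_mul]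
      field_simp
      ring
    rw [h2] at h1
    exact lt_irrefl _ h1
  have hnn : 𝔸.formBar hJ n n = 4 * t ^ 2 / b := by
    rw [e1, LinearMap.smul_apply, hn', map_smul, barJ_mk, hc.apply, smul_eq_mul, smul_eq_mul]
    field_simp
    norm_num
  have hd : d = -(t * k) := by linarith
  have hv : ∀ v, 𝔸.formBar hJ n v = t * 𝔸.barJ hα v := fun v => by
    rw [e1]
    rfl
  refine ⟨α, hα, c, k, hc, hk, fun v => ?_, fun v => ?_⟩
  · rw [hnn, hv, hd]
    conv_lhs => rw [hn', smul_smul]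
    congr 1
    field_simp
    ring
  · rw [hnn, hv]
    conv_lhs => rw [hn', smul_smul]
    congr 1
    field_simp
    ring

/-- The walls of `𝔸_J` and the orthogonal reflections in them. -/
theorem wall_of_rootPair {α : Module.Dual ℝ V} (hα : α ∈ 𝔸.rootsJ J) {c : V} (k : ℝ)
    (hc : 𝔸.IsRootPair α c) :
    ∃ d : ℝ, {v | 𝔸.barJ hα v + k = 0} = {v | 𝔸.formBar hJ ((𝔸.VJ J).mkQ c) v = d} ∧
      ∀ v, (2 * 𝔸.formBar hJ ((𝔸.VJ J).mkQ c) v /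
        𝔸.formBar hJ ((𝔸.VJ J).mkQ c) ((𝔸.VJ J).mkQ c)) • (𝔸.VJ J).mkQ c =
        𝔸.barJ hα v • (𝔸.VJ J).mkQ c := by
  have hb := 𝔸.formJ_pos hJ (𝔸.coroot_notMem_VJ hc hα.2)
  refine ⟨-(𝔸.formJ hJ c c / 2 * k), ?_, fun v => ?_⟩
  · ext v
    simp only [Set.mem_ofPred_eq]
    rw [𝔸.formBar_coroot hJ hc hα]
    constructor
    · intro h
      linear_combination (𝔸.formJ hJ c c / 2) * h
    · intro h
      have : 𝔸.formJ hJ c c / 2 * (𝔸.barJ hα v + k) = 0 := by linarith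
      exact (mul_eq_zero.1 this).resolve_left (by positivity)
  · rw [formBar_mk, 𝔸.formBar_coroot hJ hc hα]
    congr 1
    field_simp

theorem weylGroup_le_WJ :
    EuclideanBuilding.weylGroup (𝔸.formBar hJ) (𝔸.wallsJ J) ≤ 𝔸.WJ J := by
  refine (Subgroup.closure_le _).2 ?_
  rintro s ⟨n, d, hn, hw, hs⟩
  obtain ⟨α, hα, c, k, hc, hk, h1, -⟩ := 𝔸.exists_rootPair_of_wall hJ hn hw
  obtain ⟨r, hr, hrv⟩ := 𝔸.exists_refl_mem_parabolic hc hα.2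
  refine ⟨affineReflection hc.apply k, 𝔸.affineReflection_mem_W hc hk, ?_, fun x => ?_⟩
  · convert hr using 1
    ext v
    rw [hrv, affineReflection_linear, Module.reflection_apply]
  · rw [hs, h1, affineReflection_apply, map_sub, map_smul, barJ_mk]

/-- The lift `u` determines `L`, so the vectorial Weyl group of the quotient injects into the finite
group `W^v(J)`. -/
theorem exists_parabolic_of_mem_vectorialWeylGroup {L : (V ⧸ 𝔸.VJ J) ≃ₗ[ℝ] (V ⧸ 𝔸.VJ J)}
    (hL : L ∈ EuclideanBuilding.vectorialWeylGroup (𝔸.formBar hJ) (𝔸.wallsJ J)) :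
    ∃ u ∈ 𝔸.parabolic J, ∀ x, L ((𝔸.VJ J).mkQ x) = (𝔸.VJ J).mkQ (u x) := by
  induction hL using Subgroup.closure_induction with
  | mem s hs =>
    obtain ⟨n, d, hn, hw, hs⟩ := hs
    obtain ⟨α, hα, c, k, hc, hk, -, h2⟩ := 𝔸.exists_rootPair_of_wall hJ hn hw
    obtain ⟨r, hr, hrv⟩ := 𝔸.exists_refl_mem_parabolic hc hα.2
    refine ⟨r, hr, fun x => ?_⟩
    rw [hs, h2, hrv, map_sub, map_smul, barJ_mk]
  | one => exact ⟨1, one_mem _, fun x => rfl⟩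
  | mul L L' _ _ h h' =>
    obtain ⟨u, hu, e⟩ := h
    obtain ⟨u', hu', e'⟩ := h'
    refine ⟨u * u', mul_mem hu hu', fun x => ?_⟩
    rw [LinearEquiv.mul_apply, e', e, LinearEquiv.mul_apply]
  | inv L _ h =>
    obtain ⟨u, hu, e⟩ := h
    refine ⟨u⁻¹, inv_mem hu, fun x => ?_⟩
    rw [linearEquiv_inv_apply, LinearEquiv.symm_apply_eq, e, linearEquiv_inv_apply,
      LinearEquiv.apply_symm_apply]

theorem exists_vectorialWeylGroup_of_mem_parabolic {u : V ≃ₗ[ℝ] V} (hu : u ∈ 𝔸.parabolic J) :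
    ∃ L ∈ EuclideanBuilding.vectorialWeylGroup (𝔸.formBar hJ) (𝔸.wallsJ J),
      ∀ x, L ((𝔸.VJ J).mkQ x) = (𝔸.VJ J).mkQ (u x) := by
  induction hu using Subgroup.closure_induction with
  | mem s hs =>
    obtain ⟨j, hj, rfl⟩ := hs
    have hα := 𝔸.root_mem_rootsJ hj
    have hc := 𝔸.isRootPair_simple j
    obtain ⟨k, hk⟩ := 𝔸.exists_wall hα.1
    obtain ⟨d, hd, h2⟩ := 𝔸.wall_of_rootPair hJ hα k hc
    have h : 𝔸.barJ hα ((𝔸.VJ J).mkQ (𝔸.coroot j)) = 2 := hc.apply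
    refine ⟨Module.reflection h, Subgroup.subset_closure
      ⟨_, d, 𝔸.mkQ_coroot_ne_zero hc hα.2, hd ▸ 𝔸.mem_wallsJ_of_wall hα hk, fun v => ?_⟩,
      fun x => ?_⟩
    · rw [Module.reflection_apply, h2]
    · rw [Module.reflection_apply, barJ_mk, RootBasis.refl_apply, map_sub, map_smul]
  | one => exact ⟨1, one_mem _, fun x => rfl⟩
  | mul u u' _ _ h h' =>
    obtain ⟨L, hL, e⟩ := h
    obtain ⟨L', hL', e'⟩ := h'
    refine ⟨L * L', mul_mem hL hL', fun x => ?_⟩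
    rw [LinearEquiv.mul_apply, e', e, LinearEquiv.mul_apply]
  | inv u _ h =>
    obtain ⟨L, hL, e⟩ := h
    refine ⟨L⁻¹, inv_mem hL, fun x => ?_⟩
    rw [linearEquiv_inv_apply, LinearEquiv.symm_apply_eq, e, linearEquiv_inv_apply,
      LinearEquiv.apply_symm_apply]

theorem WJ_linear_mem {g : (V ⧸ 𝔸.VJ J) ≃ᵃ[ℝ] (V ⧸ 𝔸.VJ J)} (hg : g ∈ 𝔸.WJ J) :
    g.linear ∈ EuclideanBuilding.vectorialWeylGroup (𝔸.formBar hJ) (𝔸.wallsJ J) := by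
  obtain ⟨w, hw, hwl, hgw⟩ := hg
  obtain ⟨L, hL, e⟩ := 𝔸.exists_vectorialWeylGroup_of_mem_parabolic hJ hwl
  convert hL
  ext v
  obtain ⟨x, rfl⟩ := (𝔸.VJ J).mkQ_surjective v
  rw [𝔸.WJ_linear_mk hgw, e]

theorem isEuclideanApartment :
    EuclideanBuilding.IsEuclideanApartment (𝔸.formBar hJ) (𝔸.wallsJ J) where
  finiteDimensional := inferInstance
  symm := 𝔸.formBar_comm hJ
  pos := 𝔸.formBar_pos hJ
  hyperplane := by
    rintro M ⟨α, h1, h2, k, hk, rfl⟩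
    obtain ⟨c, hc⟩ := h1
    have hα : α ∈ 𝔸.rootsJ J := ⟨⟨c, hc⟩, h2⟩
    obtain ⟨d, hd, -⟩ := 𝔸.wall_of_rootPair hJ hα k hc
    exact ⟨_, d, 𝔸.mkQ_coroot_ne_zero hc h2, by rw [𝔸.image_mkQ_wallOf hα, hd]⟩
  stable := fun w hw M hM => 𝔸.WJ_walls_stable (𝔸.weylGroup_le_WJ hJ hw) hM
  finite := by
    have key := fun L (hL : L ∈ EuclideanBuilding.vectorialWeylGroup (𝔸.formBar hJ)
      (𝔸.wallsJ J)) => 𝔸.exists_parabolic_of_mem_vectorialWeylGroup hJ hL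
    choose! u hu he using key
    refine Set.Finite.of_finite_image (f := u) (hJ.subset ?_) ?_
    · rintro _ ⟨L, hL, rfl⟩
      exact hu L hL
    · intro L hL L' hL' h
      ext v
      obtain ⟨x, rfl⟩ := (𝔸.VJ J).mkQ_surjective v
      rw [he L hL, he L' hL', h]

end ModelApartment

/-! ## Parallelism of germs of sector faces in a masure -/

namespace ModelApartment

variable {V : Type*} [NormedAddCommGroup V] [NormedSpace ℝ V] {I : Type*} [Fintype I]
  (𝔸 : ModelApartment V I)

/-- The germ of the sector face `x + ε F^v(J)`. -/
abbrev germ (ε : ℤˣ) (J : Set I) (x : V) : Filter V := sectorFaceGerm x (𝔸.facetOf ε 1 J)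

/-- The germ of the chimney of base the facet of `x + F` and direction `ε F^v(J)`. -/
abbrev chim (ε : ℤˣ) (J : Set I) (x : V) (F : Set V) : Filter V :=
  𝔸.chimneyGerm x F (𝔸.facetOf ε 1 J)

theorem map_germ [FiniteDimensional ℝ V] {X : Type*} (f : V → X) (w : V ≃ᵃ[ℝ] V) (ε : ℤˣ)
    (J : Set I) (x : V) :
    map (f ∘ w) (𝔸.germ ε J x) = map f (sectorFaceGerm (w x) (𝔸.facetOf ε w.linear J)) := by
  rw [← map_map, map_sectorFaceGerm, RootBasis.image_facetOf, mul_one]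

theorem facetOf_linear_eq {ε : ℤˣ} {J : Set I} (w : V ≃ₗ[ℝ] V) :
    𝔸.facetOf ε w J = w '' 𝔸.facetOf ε 1 J := by
  rw [RootBasis.image_facetOf, mul_one]

/-- If `u` is a point of a vectorial facet, an enclosed set containing germs of sector faces at
`x` and `x + u` contains the germ of a chimney based at the corresponding facet. -/
theorem IsEnclosed.mem_chim_of_segment [FiniteDimensional ℝ V] {𝔸 : ModelApartment V I} {ε : ℤˣ}
    {J : Set I} (hJ : 𝔸.IsSpherical J) {S : Set V} (hS : 𝔸.IsEnclosed S) {x u : V}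
    (hx : S ∈ 𝔸.germ ε J x) (hxu : S ∈ 𝔸.germ ε J (x + u)) {F : Set V}
    (hF : 𝔸.IsVectorialFacet F) (hu : u ∈ F) : ∃ n ∈ 𝔸.VJ J, S ∈ 𝔸.chim ε J (x + n) F := by
  have hS' := hS
  obtain ⟨D, hD, rfl⟩ := hS'
  obtain ⟨ξ, hξ, h⟩ := 𝔸.mem_germ.1 hx
  have hxD := (hD.mem_germ_iff hJ h).1 hx
  have hxuD := (hD.mem_germ_iff hJ h).1 hxu
  obtain ⟨η, hη⟩ := 𝔸.facetOf_nonempty ε 1 J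
  obtain ⟨r, hr, hball⟩ := 𝔸.exists_ball_nonneg hJ hη
  have hn : ξ + η ∈ 𝔸.VJ J := add_mem (𝔸.closure_dir_subset_VJ hξ) (𝔸.dir_subset_VJ hη)
  -- Moving the base point by `ξ + η` changes nothing for `Φ_J`, where convexity along the segment
  -- decides, and it leaves a ball of room for the roots positive at `η`.
  refine ⟨ξ + η, hn, hS.mem_chimneyGerm ?_ fun v hv => ?_⟩
  · have h1 : ∀ α ∈ 𝔸.rootsJ J, D α ∈ localFacet (x + (ξ + η)) F := by
      intro α hα
      have h2 := hxD α hα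
      have h3 := hxuD α hα
      rcases hD α (𝔸.rootsJ_subset_roots J hα) with e | ⟨k, -, e⟩
      · rw [e]
        exact univ_mem
      · rw [e] at h2 h3 ⊢
        rw [𝔸.halfOf_mem_localFacet_iff hF hu (𝔸.rootsJ_subset_roots J hα), map_add,
          𝔸.rootsJ_apply hα hn, add_zero]
        have h2' : 0 ≤ α x + k := h2
        have h3' : 0 ≤ α (x + u) + k := h3
        rw [map_add] at h3'
        rcases h2'.lt_or_eq with h4 | h4
        · exact Or.inl h4
        · exact Or.inr ⟨h4.symm, by linarith⟩
    have h2 := (biInter_mem (𝔸.rootsJ_finite hJ)).2 h1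
    have h3 : Metric.ball (x + (ξ + η)) r ∈ localFacet (x + (ξ + η)) F :=
      mem_inf_of_left (Metric.ball_mem_nhds _ hr)
    filter_upwards [h2, h3] with y hy hyr
    simp only [Set.mem_iInter] at hy h ⊢
    intro α hα
    rcases hD α hα with e | ⟨k, -, e⟩
    · rw [e]
      trivial
    have hs : ∀ v ∈ 𝔸.facetOf ε 1 J, 0 ≤ α (x + ξ + v) + k := fun v hv => by
      have := h v hv α hα
      rwa [e] at this
    rcases (𝔸.roots_nonneg_dir_of_sector hs hη).lt_or_eq with h0 | h0
    · rw [e]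
      have h4 := 𝔸.nonneg_of_sector hs
      have h5 := hball (y - (x + (ξ + η))) (by rwa [← dist_eq_norm]) α hα h0
      have e2 : y = (x + ξ) + (η + (y - (x + (ξ + η)))) := by abel
      change 0 ≤ α y + k
      rw [e2, map_add]
      linarith
    · exact hy α (𝔸.mem_rootsJ_of_apply_eq_zero hJ hη hα h0.symm)
  · have := h (η + v) (𝔸.dir_add hη hv)
    convert this using 1
    abel

/-- Only the finitely many half-spaces for `Φ_J` matter. They contain `x + t (u + n)` for small `t >
0`, and they ignore `n`. -/
theorem eventually_mem_germ_of_mem_chim [FiniteDimensional ℝ V] {ε : ℤˣ}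
    {J : Set I} (hJ : 𝔸.IsSpherical J) {S : Set V} {x u n : V} {F : Set V}
    (hF : 𝔸.IsVectorialFacet F) (hn : n ∈ 𝔸.VJ J) (hu : u + n ∈ F) (hS : S ∈ 𝔸.chim ε J x F) :
    ∀ᶠ t : ℝ in 𝓝[>] 0, S ∈ 𝔸.germ ε J (x + t • u) := by
  obtain ⟨D, hD, hsub, ⟨ξ, hξ, h⟩, hloc⟩ := 𝔸.exists_family_of_mem_chimneyGerm hF hS
  have h1 := (biInter_mem (𝔸.rootsJ_finite hJ)).2 hloc
  filter_upwards [(𝔸.tendsto_localFacet hF x hu).eventually h1] with t ht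
  refine mem_of_superset ((hD.mem_germ_iff hJ h).2 fun α hα => ?_) hsub
  have := Set.mem_iInter₂.1 ht α hα
  rwa [smul_add, ← add_assoc, hD.add_mem_iff hα (Submodule.smul_mem _ _ hn)] at this

end ModelApartment

/-! ### Germs, chimneys and parallelism in the masure. -/

namespace Masure

variable {V : Type*} [NormedAddCommGroup V] [NormedSpace ℝ V] {I : Type*} [Fintype I]
  {𝔸 : ModelApartment V I} {X : Type*} (ℐ : Masure 𝔸 X)

theorem isom_injective {A : Set X} (hA : A ∈ ℐ.apts) {f : V → X} (hf : f ∈ ℐ.isom A) :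
    Function.Injective f := ((ℐ.MA1 A hA).2 f hf).1

theorem isom_range {A : Set X} (hA : A ∈ ℐ.apts) {f : V → X} (hf : f ∈ ℐ.isom A) :
    Set.range f = A := ((ℐ.MA1 A hA).2 f hf).2.1

theorem isom_comp {A : Set X} (hA : A ∈ ℐ.apts) {f : V → X} (hf : f ∈ ℐ.isom A) {w : V ≃ᵃ[ℝ] V}
    (hw : w ∈ 𝔸.W) : f ∘ w ∈ ℐ.isom A := (((ℐ.MA1 A hA).2 f hf).2.2 _).2 ⟨w, hw, rfl⟩

theorem exists_isom_eq_comp {A : Set X} (hA : A ∈ ℐ.apts) {f f' : V → X} (hf : f ∈ ℐ.isom A)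
    (hf' : f' ∈ ℐ.isom A) : ∃ w ∈ 𝔸.W, f' = f ∘ w := (((ℐ.MA1 A hA).2 f hf).2.2 _).1 hf'

theorem apt_mem_map {A : Set X} (hA : A ∈ ℐ.apts) {f : V → X} (hf : f ∈ ℐ.isom A) (F : Filter V) :
    A ∈ map f F := by
  rw [mem_map, ← ℐ.isom_range hA hf, Set.preimage_range]
  exact univ_mem

theorem preimage_of_eqOn {A : Set X} (hA : A ∈ ℐ.apts) {f f' : V → X} (hf' : f' ∈ ℐ.isom A)
    {S : Set V} (h : ∀ y ∈ S, f y = f' y) : S ⊆ f ⁻¹' A := fun y hy => by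
  rw [Set.mem_preimage, h y hy, ← ℐ.isom_range hA hf']
  exact ⟨y, rfl⟩

theorem map_eq_of_eqOn {E X : Type*} {f f' : E → X} {S : Set E} (h : ∀ y ∈ S, f y = f' y)
    {F : Filter E}
    (hS : S ∈ F) : map f F = map f' F :=
  map_congr (mem_of_superset hS h)

variable {ε : ℤˣ} {J : Set I}

theorem isSplayed_chim (hJ : 𝔸.IsSpherical J) (x : V) {F : Set V} (hF : 𝔸.IsVectorialFacet F) :
    𝔸.IsSplayedChimneyGerm (𝔸.chim ε J x F) :=
  ⟨x, F, _, hF, 𝔸.isSphericalFacet_dir hJ ε, rfl⟩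

/-- Parallelism of germs of sector faces of sign `ε` and type `J`. -/
def Par (ε : ℤˣ) (J : Set I) (F G : Filter X) : Prop :=
  ∃ A ∈ ℐ.apts, ∃ f ∈ ℐ.isom A, ∃ x y, F = map f (𝔸.germ ε J x) ∧ G = map f (𝔸.germ ε J y)

theorem Par.symm {ℐ : Masure 𝔸 X} {F G : Filter X} (h : ℐ.Par ε J F G) : ℐ.Par ε J G F := by
  obtain ⟨A, hA, f, hf, x, y, h1, h2⟩ := h
  exact ⟨A, hA, f, hf, y, x, h2, h1⟩

theorem isVectorialFacet_of_isSphericalFacet {Fv : Set V} (h : 𝔸.IsSphericalFacet Fv) :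
    𝔸.IsVectorialFacet Fv := by
  obtain ⟨ε', v, hv, J', -, rfl⟩ := h
  exact ⟨ε', v, hv, J', rfl⟩

variable [FiniteDimensional ℝ V]

/-- If an apartment contains the germ of a sector face, it contains an enclosed sector face of this
germ. -/
theorem exists_enclosed_of_germ (hJ : 𝔸.IsSpherical J) {A A' : Set X} (hA : A ∈ ℐ.apts)
    (hA' : A' ∈ ℐ.apts)
    {f : V → X} (hf : f ∈ ℐ.isom A) {z : V} (h : A' ∈ map f (𝔸.germ ε J z)) :
    ∃ n ∈ 𝔸.VJ J, ∃ S, 𝔸.IsEnclosed S ∧ (∀ v ∈ 𝔸.facetOf ε 1 J, z + n + v ∈ S) ∧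
      ∃ f' ∈ ℐ.isom A', ∀ y ∈ S, f y = f' y := by
  rw [mem_map, 𝔸.mem_germ] at h
  obtain ⟨ξ, hξ, h⟩ := h
  -- (MA2) speaks of half-lines with nonzero direction. When the facet is reduced to `{0}` there is
  -- none, and the case of a point in (MA2) replaces it.
  obtain ⟨u, hu, hu'⟩ : ∃ u ∈ 𝔸.facetOf ε 1 J, u ≠ 0 ∨ 𝔸.facetOf ε 1 J = {0} := by
    obtain ⟨u, hu⟩ := 𝔸.facetOf_nonempty ε 1 J
    by_cases hex : ∃ u ∈ 𝔸.facetOf ε 1 J, u ≠ 0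
    · obtain ⟨u, hu, h0⟩ := hex
      exact ⟨u, hu, Or.inl h0⟩
    · push Not at hex
      exact ⟨u, hu, Or.inr (Set.eq_singleton_iff_unique_mem.2 ⟨hex u hu ▸ hu, hex⟩)⟩
  have hline : ∀ t : ℝ, 0 ≤ t → z + (ξ + u) + t • u ∈ f ⁻¹' A' := by
    intro t ht
    have e : z + (ξ + u) + t • u = z + ξ + (1 + t) • u := by
      rw [add_smul, one_smul]
      abel
    rw [e]
    exact h _ (𝔸.facetOf_smul hu (by linarith))
  have key : ∃ S, 𝔸.IsEnclosed S ∧ (∀ t : ℝ, 0 ≤ t → z + (ξ + u) + t • u ∈ S) ∧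
      ∃ f' ∈ ℐ.isom A', ∀ y ∈ S, f y = f' y := by
    rcases hu' with hu0 | hC
    · obtain ⟨f', hf', heq⟩ := ℐ.MA2 A hA A' hA' f hf
        (𝓟 ((fun t : ℝ => z + (ξ + u) + t • u) '' Set.Ici 0))
        (Or.inr (Or.inr (Or.inl ⟨_, u, hu0, ⟨_, 𝔸.isSphericalFacet_dir hJ ε, hu⟩, rfl⟩)))
        (by
          rw [mem_map, mem_principal, Set.image_subset_iff]
          exact fun t ht => hline t ht)
      obtain ⟨S, hS, h1, h2⟩ := 𝔸.mem_cl.1 heq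
      exact ⟨S, hS, fun t ht => h1 ⟨t, ht, rfl⟩, f', hf', fun y hy => h2 hy⟩
    · obtain ⟨f', hf', heq⟩ := ℐ.MA2 A hA A' hA' f hf (pure (z + (ξ + u)))
        (Or.inl ⟨_, rfl⟩) (by
          rw [mem_map, mem_pure]
          simpa using hline 0 le_rfl)
      obtain ⟨S, hS, h1, h2⟩ := 𝔸.mem_cl.1 heq
      refine ⟨S, hS, fun t ht => ?_, f', hf', fun y hy => h2 hy⟩
      rw [hC, Set.mem_singleton_iff] at hu
      rw [hu, smul_zero, add_zero]
      rw [hu] at h1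
      exact h1
  obtain ⟨S, hS, h1, h2⟩ := key
  refine ⟨ξ + u, add_mem (𝔸.closure_dir_subset_VJ hξ) (𝔸.dir_subset_VJ hu), S, hS,
    fun v hv => ?_, h2⟩
  obtain ⟨D, hD, rfl⟩ := hS
  simp only [Set.mem_iInter] at h1 ⊢
  intro α hα
  have h3 := fun t ht => h1 t ht α hα
  rcases hD α hα with e | ⟨k, -, e⟩
  · rw [e]
    trivial
  · rw [e] at h3 ⊢
    have h4 : ∀ t : ℝ, 0 ≤ t → 0 ≤ α (z + (ξ + u)) + t * α u + k := fun t ht => by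
      have : 0 ≤ α (z + (ξ + u) + t • u) + k := h3 t ht
      rwa [map_add _ (z + (ξ + u)), map_smul, smul_eq_mul] at this
    have hαu : 0 ≤ α u := by
      by_contra! hneg
      have h5 := h4 ((|α (z + (ξ + u)) + k| + 1) / -(α u))
        (div_nonneg (by positivity) (by linarith))
      have : (|α (z + (ξ + u)) + k| + 1) / -(α u) * α u = -(|α (z + (ξ + u)) + k| + 1) := by
        rw [div_neg, neg_mul, div_mul_cancel₀ _ hneg.ne]
      rw [this] at h5
      linarith [le_abs_self (α (z + (ξ + u)) + k)]
    -- A half-line in the direction `u` suffices to capture the whole sector face, as a root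
    -- nonnegative at `u` is nonnegative on the facet.
    have hαv := 𝔸.roots_nonneg_of_facetOf hα (one_mem _) hu hv hαu
    have h6 := h4 0 le_rfl
    change 0 ≤ α (z + (ξ + u) + v) + k
    rw [map_add _ (z + (ξ + u))]
    linarith

theorem exists_isom_of_germ (hJ : 𝔸.IsSpherical J) {A A' : Set X} (hA : A ∈ ℐ.apts)
    (hA' : A' ∈ ℐ.apts) {f : V → X} (hf : f ∈ ℐ.isom A) {z : V}
    (h : A' ∈ map f (𝔸.germ ε J z)) :
    ∃ f' ∈ ℐ.isom A', map f (𝔸.germ ε J z) = map f' (𝔸.germ ε J z) := by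
  obtain ⟨n, hn, S, hS, h1, f', hf', h2⟩ := ℐ.exists_enclosed_of_germ hJ hA hA' hf h
  refine ⟨f', hf', map_eq_of_eqOn h2 ?_⟩
  rw [ModelApartment.germ, ← 𝔸.germ_add z n hn, 𝔸.mem_germ]
  exact ⟨0, 𝔸.zero_mem_closure_dir, fun v hv => by rw [add_zero]; exact h1 v hv⟩

/-- The chimney based at the facet of direction `ε F^v(J)` itself is the thinnest one. It replaces
the sector face in (MA3) and (MA4), whose statements concern chimneys; the shift by `n ∈ V_J` leaves
the germ of the sector face unchanged. -/
theorem exists_chim_of_germ (hJ : 𝔸.IsSpherical J) {A A' : Set X} (hA : A ∈ ℐ.apts)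
    (hA' : A' ∈ ℐ.apts) {f : V → X} (hf : f ∈ ℐ.isom A) {z : V}
    (h : A' ∈ map f (𝔸.germ ε J z)) :
    ∃ n ∈ 𝔸.VJ J, A' ∈ map f (𝔸.chim ε J (z + n) (𝔸.facetOf ε 1 J)) := by
  obtain ⟨n, hn, S, hS, h1, f', hf', h2⟩ := ℐ.exists_enclosed_of_germ hJ hA hA' hf h
  refine ⟨n, hn, mem_map.2 (mem_of_superset (hS.mem_chimneyGerm (mem_inf_of_right ?_) h1)
    (ℐ.preimage_of_eqOn hA' hf' h2))⟩
  rw [mem_principal, Set.singleton_add, Set.image_subset_iff]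
  exact fun v hv => h1 v hv

theorem isSolid_chim (hJ : 𝔸.IsSpherical J) (x : V) {F : Set V} (hF : 𝔸.IsVectorialFacet F) :
    𝔸.IsFacetOrSolidChimneyGerm (𝔸.chim ε J x F) :=
  Or.inr ⟨x, F, _, hF, 𝔸.isVectorialFacet_dir ε J, 𝔸.isSolid_dir hJ x hF, rfl⟩

/-- Two apartments containing the germs of two chimneys of direction `ε F^v(J)` are isomorphic by
an isomorphism fixing an enclosed set which contains both germs. -/
theorem exists_isom_of_chim (hJ : 𝔸.IsSpherical J) {A A' : Set X} (hA : A ∈ ℐ.apts)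
    (hA' : A' ∈ ℐ.apts) {f : V → X} (hf : f ∈ ℐ.isom A) {x y : V} {F F' : Set V}
    (hF : 𝔸.IsVectorialFacet F) (hF' : 𝔸.IsVectorialFacet F')
    (h : A' ∈ map f (𝔸.chim ε J x F)) (h' : A' ∈ map f (𝔸.chim ε J y F')) :
    ∃ f' ∈ ℐ.isom A', ∃ S, 𝔸.IsEnclosed S ∧ S ∈ 𝔸.chim ε J x F ∧ S ∈ 𝔸.chim ε J y F' ∧
      ∀ z ∈ S, f z = f' z := by
  obtain ⟨f', hf', heq⟩ := ℐ.MA4 A hA A' hA' f hf _ _ (isSplayed_chim hJ x hF)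
    (isSolid_chim hJ y hF') h h'
  obtain ⟨S, hS, h1, h2⟩ := 𝔸.mem_cl.1 heq
  rw [mem_sup] at h1
  exact ⟨f', hf', S, hS, h1.1, h1.2, fun z hz => h2 hz⟩

/-- By (MA4) for the thin chimneys at the two ends, `A'` contains the image of an enclosed set
containing both germs, and convexity adds the chimney between them. -/
theorem exists_chim_of_segment (hJ : 𝔸.IsSpherical J) {A A' : Set X} (hA : A ∈ ℐ.apts)
    (hA' : A' ∈ ℐ.apts) {f : V → X} (hf : f ∈ ℐ.isom A) {x u : V} {F : Set V}
    (hF : 𝔸.IsVectorialFacet F) (hu : u ∈ F)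
    (h : A' ∈ map f (𝔸.germ ε J x)) (h' : A' ∈ map f (𝔸.germ ε J (x + u))) :
    ∃ n ∈ 𝔸.VJ J, A' ∈ map f (𝔸.chim ε J (x + n) F) := by
  have hdir := 𝔸.isVectorialFacet_dir ε J
  obtain ⟨n₁, hn₁, h₁⟩ := ℐ.exists_chim_of_germ hJ hA hA' hf h
  obtain ⟨n₂, hn₂, h₂⟩ := ℐ.exists_chim_of_germ hJ hA hA' hf h'
  obtain ⟨f', hf', S, hS, hS₁, hS₂, heq⟩ := ℐ.exists_isom_of_chim hJ hA hA' hf hdir hdir h₁ h₂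
  have hg₁ := 𝔸.chimneyGerm_mem_germ hJ hdir hS₁
  have hg₂ := 𝔸.chimneyGerm_mem_germ hJ hdir hS₂
  rw [𝔸.germ_add _ _ hn₁] at hg₁
  rw [𝔸.germ_add _ _ hn₂] at hg₂
  obtain ⟨n, hn, hm⟩ := hS.mem_chim_of_segment hJ hg₁ hg₂ hF hu
  exact ⟨n, hn, mem_map.2 (mem_of_superset hm (ℐ.preimage_of_eqOn hA' hf' heq))⟩

/-- The parallelism is witnessed in some other apartment; (MA4) gives an isomorphism of that
apartment onto `A` fixing both germs, so their common direction there becomes a common direction in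
`A`. -/
theorem facetOf_eq_of_par (hJ : 𝔸.IsSpherical J) {A : Set X} (hA : A ∈ ℐ.apts)
    {f : V → X} (hf : f ∈ ℐ.isom A) {x y : V} {v : V ≃ₗ[ℝ] V}
    (h : ℐ.Par ε J (map f (𝔸.germ ε J x))
      (map f (ModelApartment.sectorFaceGerm y (𝔸.facetOf ε v J)))) :
    𝔸.facetOf ε v J = 𝔸.facetOf ε 1 J := by
  have hdir := 𝔸.isVectorialFacet_dir ε J
  obtain ⟨A₃, hA₃, f₃, hf₃, a, b, h1, h2⟩ := h
  obtain ⟨n₁, hn₁, h₁⟩ := ℐ.exists_chim_of_germ hJ hA₃ hA hf₃ (h1 ▸ ℐ.apt_mem_map hA hf _)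
  obtain ⟨n₂, hn₂, h₂⟩ := ℐ.exists_chim_of_germ hJ hA₃ hA hf₃ (h2 ▸ ℐ.apt_mem_map hA hf _)
  obtain ⟨f', hf', S, hS, hS₁, hS₂, heq⟩ := ℐ.exists_isom_of_chim hJ hA₃ hA hf₃ hdir hdir h₁ h₂
  have hg₁ := 𝔸.chimneyGerm_mem_germ hJ hdir hS₁
  have hg₂ := 𝔸.chimneyGerm_mem_germ hJ hdir hS₂
  rw [𝔸.germ_add _ _ hn₁] at hg₁
  rw [𝔸.germ_add _ _ hn₂] at hg₂
  obtain ⟨w, hw, rfl⟩ := ℐ.exists_isom_eq_comp hA hf hf'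
  rw [map_eq_of_eqOn heq hg₁, 𝔸.map_germ] at h1
  rw [map_eq_of_eqOn heq hg₂, 𝔸.map_germ] at h2
  have e1 := 𝔸.eq_of_sectorFaceGerm_eq (map_injective (ℐ.isom_injective hA hf) h1)
  have e2 := 𝔸.eq_of_sectorFaceGerm_eq (map_injective (ℐ.isom_injective hA hf) h2)
  rw [e2, e1]

/-- (MA3) puts into one apartment the germ at `y` and a chimney at `x` opening towards `u`, which
contains the germs at `x + t u` for all small `t > 0`. These all have the same direction in this
apartment, where parallelism is equality of directions. -/
theorem eventually_par_iff (hJ : 𝔸.IsSpherical J) {A₁ A₂ : Set X} (hA₁ : A₁ ∈ ℐ.apts)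
    {f₁ : V → X} (hf₁ : f₁ ∈ ℐ.isom A₁) (hA₂ : A₂ ∈ ℐ.apts) {f₂ : V → X} (hf₂ : f₂ ∈ ℐ.isom A₂)
    (x u y : V) : ∀ᶠ t : ℝ in 𝓝[>] 0,
      (ℐ.Par ε J (map f₁ (𝔸.germ ε J (x + t • u))) (map f₂ (𝔸.germ ε J y)) ↔
        ℐ.Par ε J (map f₁ (𝔸.germ ε J x)) (map f₂ (𝔸.germ ε J y))) := by
  have hdir := 𝔸.isVectorialFacet_dir ε J
  obtain ⟨n, hn, F, hF, hu⟩ := 𝔸.exists_vectorialFacet_add hJ u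
  obtain ⟨A, hA, h1, h2⟩ := ℐ.MA3 A₁ hA₁ A₂ hA₂ f₁ hf₁ f₂ hf₂ (𝔸.chim ε J x F)
    (𝔸.chim ε J y (𝔸.facetOf ε 1 J)) (isSplayed_chim hJ x hF) (isSolid_chim hJ y hdir)
  obtain ⟨f, hf, S, hS, hS₁, -, heq⟩ := ℐ.exists_isom_of_chim hJ hA₁ hA hf₁ hF hF h1 h1
  obtain ⟨f', hf', S', hS', hS₁', -, heq'⟩ := ℐ.exists_isom_of_chim hJ hA₂ hA hf₂ hdir hdir h2 h2
  obtain ⟨w, hw, rfl⟩ := ℐ.exists_isom_eq_comp hA hf hf'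
  rw [map_eq_of_eqOn heq' (𝔸.chimneyGerm_mem_germ hJ hdir hS₁'), 𝔸.map_germ]
  have key : ∀ z, S ∈ 𝔸.germ ε J z → (ℐ.Par ε J (map f₁ (𝔸.germ ε J z))
      (map f (ModelApartment.sectorFaceGerm (w y) (𝔸.facetOf ε w.linear J))) ↔
      𝔸.facetOf ε w.linear J = 𝔸.facetOf ε 1 J) := by
    intro z hz
    rw [map_eq_of_eqOn heq hz]
    refine ⟨fun h => ℐ.facetOf_eq_of_par hJ hA hf h, fun h => ?_⟩
    rw [h]
    exact ⟨A, hA, f, hf, z, w y, rfl, rfl⟩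
  filter_upwards [𝔸.eventually_mem_germ_of_mem_chim hJ hF hn hu hS₁] with t ht
  rw [key _ ht, key _ (𝔸.chimneyGerm_mem_germ hJ hF hS₁)]

/-- Parallelism is transitive. -/
theorem par_iff_par (hJ : 𝔸.IsSpherical J) {A₁ A₂ : Set X} (hA₁ : A₁ ∈ ℐ.apts)
    {f₁ : V → X} (hf₁ : f₁ ∈ ℐ.isom A₁) (hA₂ : A₂ ∈ ℐ.apts) {f₂ : V → X} (hf₂ : f₂ ∈ ℐ.isom A₂)
    (x x' y : V) : ℐ.Par ε J (map f₁ (𝔸.germ ε J x')) (map f₂ (𝔸.germ ε J y)) ↔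
        ℐ.Par ε J (map f₁ (𝔸.germ ε J x)) (map f₂ (𝔸.germ ε J y)) := by
  set P : ℝ → Prop := fun t =>
    ℐ.Par ε J (map f₁ (𝔸.germ ε J (x + t • (x' - x)))) (map f₂ (𝔸.germ ε J y)) with hP
  have hloc : IsLocallyConstant P := by
    rw [IsLocallyConstant.iff_eventually_eq]
    intro t₀
    -- The one-sided statement is used with the direction and with its opposite, to cover both sides
    -- of `t₀`.
    have h1 := ℐ.eventually_par_iff (ε := ε) hJ hA₁ hf₁ hA₂ hf₂ (x + t₀ • (x' - x)) (x' - x) y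
    have h2 := ℐ.eventually_par_iff (ε := ε) hJ hA₁ hf₁ hA₂ hf₂ (x + t₀ • (x' - x)) (-(x' - x)) y
    obtain ⟨δ, hδ, h⟩ := mem_nhdsGT_iff_exists_Ioo_subset.1 (h1.and h2)
    rw [Set.mem_Ioi] at hδ
    filter_upwards [Ioo_mem_nhds (sub_lt_self t₀ hδ) (lt_add_of_pos_right t₀ hδ)] with t ht
    rcases lt_trichotomy t t₀ with hlt | rfl | hlt
    · have := (h ⟨sub_pos.2 hlt, by linarith [ht.1]⟩).2
      have e : x + t₀ • (x' - x) + (t₀ - t) • -(x' - x) = x + t • (x' - x) := by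
        rw [smul_neg, sub_smul]
        abel
      rw [e] at this
      exact propext this
    · rfl
    · have := (h ⟨sub_pos.2 hlt, by linarith [ht.2]⟩).1
      have e : x + t₀ • (x' - x) + (t - t₀) • (x' - x) = x + t • (x' - x) := by
        rw [sub_smul]
        abel
      rw [e] at this
      exact propext this
  have h01 : P 1 = P 0 := hloc.apply_eq_of_preconnectedSpace 1 0
  simp only [hP, one_smul, zero_smul, add_zero, add_sub_cancel] at h01
  exact iff_of_eq h01

theorem Par.trans {ℐ : Masure 𝔸 X} (hJ : 𝔸.IsSpherical J) {F G H : Filter X}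
    (h : ℐ.Par ε J F G) (h' : ℐ.Par ε J G H) : ℐ.Par ε J F H := by
  obtain ⟨A₁, hA₁, f₁, hf₁, x, y, rfl, rfl⟩ := h
  have h'' := h'
  obtain ⟨A₂, hA₂, f₂, hf₂, a, b, -, rfl⟩ := h''
  exact (ℐ.par_iff_par hJ hA₁ hf₁ hA₂ hf₂ y x b).2 h'

/-- The direction of a germ of sector face is determined up to the action of `W`. -/
theorem exists_facet_eq_image (hJ : 𝔸.IsSpherical J) {A A' : Set X} (hA : A ∈ ℐ.apts)
    (hA' : A' ∈ ℐ.apts) {f f' : V → X} (hf : f ∈ ℐ.isom A) (hf' : f' ∈ ℐ.isom A') {x y : V}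
    {Fv : Set V} (hFv : 𝔸.IsVectorialFacet Fv)
    (h : map f (𝔸.germ ε J x) = map f' (ModelApartment.sectorFaceGerm y Fv)) :
    ∃ w ∈ 𝔸.W, Fv = w.linear '' 𝔸.facetOf ε 1 J := by
  obtain ⟨f'', hf'', heq⟩ := ℐ.exists_isom_of_germ hJ hA hA' hf (h ▸ ℐ.apt_mem_map hA' hf' _)
  obtain ⟨w, hw, rfl⟩ := ℐ.exists_isom_eq_comp hA' hf' hf''
  obtain ⟨ε', v, hv, J', rfl⟩ := hFv
  rw [heq, 𝔸.map_germ] at h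
  refine ⟨w, hw, ?_⟩
  rw [← 𝔸.facetOf_linear_eq]
  exact (𝔸.eq_of_sectorFaceGerm_eq (map_injective (ℐ.isom_injective hA' hf') h)).symm

theorem map_comp_germ_inv {X : Type*} (f : V → X) (w : V ≃ᵃ[ℝ] V) (y : V) :
    map (f ∘ w) (𝔸.germ ε J (w⁻¹ y)) =
      map f (ModelApartment.sectorFaceGerm y (w.linear '' 𝔸.facetOf ε 1 J)) := by
  rw [𝔸.map_germ, 𝔸.facetOf_linear_eq, ModelApartment.affineEquiv_apply_inv]

theorem exists_isom_of_isSectorFaceGerm {F₀ : Filter X} (h : ℐ.IsSectorFaceGerm ε J F₀) :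
    ∃ A ∈ ℐ.apts, ∃ f ∈ ℐ.isom A, ∃ x, F₀ = map f (𝔸.germ ε J x) := by
  obtain ⟨A, hA, f, hf, x, v, hv, rfl⟩ := h
  obtain ⟨w, hw, rfl⟩ := 𝔸.exists_lift hv
  exact ⟨A, hA, f ∘ w, ℐ.isom_comp hA hf hw, w⁻¹ x, by
    rw [map_comp_germ_inv, 𝔸.facetOf_linear_eq]⟩

/-- `Parallel` allows any spherical facet as common direction. Composing with an element of `W`
brings this facet to the standard one. -/
theorem parallel_iff_par (hJ : 𝔸.IsSpherical J) {F₀ : Filter X} (h₀ : ℐ.IsSectorFaceGerm ε J F₀)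
    (F : Filter X) : ℐ.Parallel F₀ F ↔ ℐ.Par ε J F₀ F := by
  constructor
  · rintro ⟨A₁, hA₁, f₁, hf₁, x, y, Fv, hFv, h1, h2⟩
    obtain ⟨A, hA, f, hf, z, h0⟩ := ℐ.exists_isom_of_isSectorFaceGerm h₀
    obtain ⟨w, hw, rfl⟩ := ℐ.exists_facet_eq_image hJ hA hA₁ hf hf₁
      (isVectorialFacet_of_isSphericalFacet hFv) (h0.symm.trans h1)
    exact ⟨A₁, hA₁, f₁ ∘ w, ℐ.isom_comp hA₁ hf₁ hw, w⁻¹ x, w⁻¹ y, by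
      rw [map_comp_germ_inv, h1], by rw [map_comp_germ_inv, h2]⟩
  · rintro ⟨A, hA, f, hf, x, y, h1, h2⟩
    exact ⟨A, hA, f, hf, x, y, _, 𝔸.isSphericalFacet_dir hJ ε, h1, h2⟩

end Masure

/-! ## The façade -/

namespace ModelApartment

variable {V : Type*} [NormedAddCommGroup V] [NormedSpace ℝ V] {I : Type*} [Fintype I]
  (𝔸 : ModelApartment V I) {J : Set I}

theorem mkQ_eq_iff {x y : V} : (𝔸.VJ J).mkQ x = (𝔸.VJ J).mkQ y ↔ y - x ∈ 𝔸.VJ J := by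
  rw [eq_comm, ← sub_eq_zero, ← map_sub]
  exact Submodule.Quotient.mk_eq_zero _

theorem mkQ_add {x n : V} (hn : n ∈ 𝔸.VJ J) : (𝔸.VJ J).mkQ (x + n) = (𝔸.VJ J).mkQ x := by
  rw [eq_comm, mkQ_eq_iff, add_sub_cancel_left]
  exact hn

theorem map_VJ_of_mem_parabolic {u : V ≃ₗ[ℝ] V} (hu : u ∈ 𝔸.parabolic J) :
    (𝔸.VJ J).map (u : V →ₗ[ℝ] V) = 𝔸.VJ J := by
  ext v
  constructor
  · rintro ⟨n, hn, rfl⟩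
    change u n ∈ _
    rw [𝔸.parabolic_apply_of_mem_VJ hu hn]
    exact hn
  · intro hv
    exact ⟨v, hv, 𝔸.parabolic_apply_of_mem_VJ hu hv⟩

theorem exists_WJ_of_mem_W {w : V ≃ᵃ[ℝ] V} (hw : w ∈ 𝔸.W) (hl : w.linear ∈ 𝔸.parabolic J) :
    ∃ g ∈ 𝔸.WJ J, ∀ x, g ((𝔸.VJ J).mkQ x) = (𝔸.VJ J).mkQ (w x) := by
  let L := Submodule.Quotient.equiv (𝔸.VJ J) (𝔸.VJ J) w.linear (𝔸.map_VJ_of_mem_parabolic hl)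
  let g : (V ⧸ 𝔸.VJ J) ≃ᵃ[ℝ] (V ⧸ 𝔸.VJ J) :=
    L.toAffineEquiv.trans (AffineEquiv.constVAdd ℝ _ ((𝔸.VJ J).mkQ (w 0)))
  have hg : ∀ x, g ((𝔸.VJ J).mkQ x) = (𝔸.VJ J).mkQ (w x) := fun x => by
    rw [affineEquiv_apply w x, map_add]
    rfl
  exact ⟨g, ⟨w, hw, hl, hg⟩, hg⟩

/-- An element of `W^v(J)` which fixes modulo `V_J` a vector of the open fundamental chamber is
trivial. -/
theorem eq_one_of_sub_mem_VJ (hJ : 𝔸.IsSpherical J) {w : V ≃ₗ[ℝ] V} (hw : w ∈ 𝔸.parabolic J)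
    {u : V} (hu : ∀ i, 0 < 𝔸.root i u) (h : w u - u ∈ 𝔸.VJ J) : w = 1 := by
  -- Right translation by `w` permutes `W^v(J)`, while `w u - u`, being in `V_J`, is fixed by the
  -- whole group. Hence the order of the group times `w u - u` is zero.
  have hsum : ∑ s ∈ hJ.toFinset, s (w u) = ∑ s ∈ hJ.toFinset, s u := by
    refine Finset.sum_nbij' (fun s => s * w) (fun s => s * w⁻¹) ?_ ?_ ?_ ?_ ?_
    · intro s hs
      rw [𝔸.mem_sphericalFinset hJ] at hs ⊢
      exact mul_mem hs hw
    · intro s hs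
      rw [𝔸.mem_sphericalFinset hJ] at hs ⊢
      exact mul_mem hs (inv_mem hw)
    · intro s _
      simp
    · intro s _
      simp
    · intro s _
      rfl
  have hsub : ∑ s ∈ hJ.toFinset, s (w u - u) = 0 := by
    simp only [map_sub, Finset.sum_sub_distrib, hsum, sub_self]
  have hconst : ∑ s ∈ hJ.toFinset, s (w u - u) = hJ.toFinset.card • (w u - u) := by
    rw [← Finset.sum_const]
    refine Finset.sum_congr rfl fun s hs => ?_
    rw [𝔸.mem_sphericalFinset hJ] at hs
    exact 𝔸.parabolic_apply_of_mem_VJ hs h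
  rw [hconst, ← Nat.cast_smul_eq_nsmul ℝ, smul_eq_zero] at hsub
  have hfix : w u = u := by
    rcases hsub with h0 | h0
    · exfalso
      have hmem : (1 : V ≃ₗ[ℝ] V) ∈ hJ.toFinset :=
        (𝔸.mem_sphericalFinset hJ).2 (one_mem (𝔸.parabolic J))
      exact Finset.card_ne_zero_of_mem hmem (by exact_mod_cast h0)
    · exact sub_eq_zero.1 h0
  have := (𝔸.eq_and_mem_parabolic_of_dominant (𝔸.parabolic_le_weyl J hw) (fun i => (hu i).le)
    (fun i => by rw [hfix]; exact (hu i).le)).2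
  have hempty : {i | 𝔸.root i u = 0} = (∅ : Set I) := by
    ext i
    simp [(hu i).ne']
  rw [hempty, RootBasis.parabolic, Set.image_empty, Subgroup.closure_empty] at this
  exact Subgroup.mem_bot.1 this

end ModelApartment

/-! ### Apartments and facets of the façade. -/

namespace Masure

variable {V : Type*} [NormedAddCommGroup V] [NormedSpace ℝ V] {I : Type*} [Fintype I]
  {𝔸 : ModelApartment V I} {X : Type*} (ℐ : Masure 𝔸 X) {ε : ℤˣ} {J : Set I} {F₀ : Filter X}

/-- `f` is an isomorphism of `𝔸` onto the apartment `A`, sends the direction `ε F^v(J)` to that of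
`F₀`, and induces `g`. -/
structure Induces (ε : ℤˣ) (J : Set I) (F₀ : Filter X) (A : Set X) (f : V → X)
    (g : V ⧸ 𝔸.VJ J → ℐ.Facade F₀) : Prop where
  apt : A ∈ ℐ.apts
  isom : f ∈ ℐ.isom A
  eq : ∀ x : V, (g ((𝔸.VJ J).mkQ x)).1 = map f (𝔸.germ ε J x)

theorem mem_facadeIsom_iff {B : Set (ℐ.Facade F₀)} {g : V ⧸ 𝔸.VJ J → ℐ.Facade F₀} :
    g ∈ ℐ.facadeIsom ε J F₀ B ↔
      ∃ A f, ℐ.Induces ε J F₀ A f g ∧ B = ℐ.facadeApt F₀ A := by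
  constructor
  · rintro ⟨A, hA, hB, f, hf, h⟩
    exact ⟨A, f, ⟨hA, hf, h⟩, hB⟩
  · rintro ⟨A, f, h, hB⟩
    exact ⟨A, h.apt, hB, f, h.isom, h.eq⟩

variable {ℐ} {A A' : Set X} {f f' : V → X} {g g' : V ⧸ 𝔸.VJ J → ℐ.Facade F₀}

theorem Induces.mem (h : ℐ.Induces ε J F₀ A f g) (v : V ⧸ 𝔸.VJ J) : A ∈ (g v).1 := by
  obtain ⟨x, rfl⟩ := (𝔸.VJ J).mkQ_surjective v
  rw [h.eq]
  exact ℐ.apt_mem_map h.apt h.isom _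

theorem Induces.apply_eq_of_mem (h : ℐ.Induces ε J F₀ A f g) (h' : ℐ.Induces ε J F₀ A' f' g')
    {S : Set V} (hS : ∀ y ∈ S, f y = f' y) {x : V} (hx : S ∈ 𝔸.germ ε J x) :
    g ((𝔸.VJ J).mkQ x) = g' ((𝔸.VJ J).mkQ x) :=
  Subtype.ext (by rw [h.eq, h'.eq, map_eq_of_eqOn hS hx])

theorem facadeApt_mem_facadeFilter {R : Filter X} (h : A ∈ R) :
    ℐ.facadeApt F₀ A ∈ ℐ.facadeFilter F₀ R :=
  mem_lift' h

variable [FiniteDimensional ℝ V]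

/-- Transitivity of parallelism is used here: one germ in the right direction makes all its
translates elements of the façade. The choice of representatives modulo `V_J` is immaterial by
`germ_add`. -/
theorem exists_induces (hJ : 𝔸.IsSpherical J) (h₀ : ℐ.IsSectorFaceGerm ε J F₀) (hA : A ∈ ℐ.apts)
    (hf : f ∈ ℐ.isom A) {z : V} (hz : ℐ.Par ε J F₀ (map f (𝔸.germ ε J z))) :
    ∃ g, ℐ.Induces ε J F₀ A f g := by
  have hpar : ∀ x, ℐ.Parallel F₀ (map f (𝔸.germ ε J x)) := fun x =>
    (ℐ.parallel_iff_par hJ h₀ _).2 (hz.trans hJ ⟨A, hA, f, hf, z, x, rfl, rfl⟩)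
  refine ⟨fun v => ⟨_, hpar (Function.surjInv (𝔸.VJ J).mkQ_surjective v)⟩, hA, hf, fun x => ?_⟩
  have h := Function.surjInv_eq (𝔸.VJ J).mkQ_surjective ((𝔸.VJ J).mkQ x)
  rw [𝔸.mkQ_eq_iff] at h
  have := 𝔸.germ_add (ε := ε) (Function.surjInv (𝔸.VJ J).mkQ_surjective ((𝔸.VJ J).mkQ x)) _ h
  rw [add_sub_cancel] at this
  simp only [this]

theorem exists_induces_of_mem (hJ : 𝔸.IsSpherical J) (h₀ : ℐ.IsSectorFaceGerm ε J F₀)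
    (hA : A ∈ ℐ.apts) (F : ℐ.Facade F₀) (hF : A ∈ F.1) :
    ∃ f g, ℐ.Induces ε J F₀ A f g := by
  have hpar := (ℐ.parallel_iff_par hJ h₀ _).1 F.2
  have hpar' := hpar
  obtain ⟨A₁, hA₁, f₁, hf₁, x, y, h1, h2⟩ := hpar'
  rw [h2] at hF
  obtain ⟨f, hf, e⟩ := ℐ.exists_isom_of_germ hJ hA₁ hA hf₁ hF
  rw [h2, e] at hpar
  exact ⟨f, exists_induces hJ h₀ hA hf hpar⟩

namespace Induces

theorem par (hJ : 𝔸.IsSpherical J) (h₀ : ℐ.IsSectorFaceGerm ε J F₀)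
    (h : ℐ.Induces ε J F₀ A f g) (x : V) : ℐ.Par ε J F₀ (map f (𝔸.germ ε J x)) := by
  rw [← h.eq]
  exact (ℐ.parallel_iff_par hJ h₀ _).1 (g _).2

theorem injective (h : ℐ.Induces ε J F₀ A f g) : Function.Injective g := by
  intro v v' hv
  obtain ⟨x, rfl⟩ := (𝔸.VJ J).mkQ_surjective v
  obtain ⟨y, rfl⟩ := (𝔸.VJ J).mkQ_surjective v'
  have e := congrArg Subtype.val hv
  rw [h.eq, h.eq] at e
  rw [𝔸.mkQ_eq_iff]
  exact 𝔸.sub_mem_VJ_of_germ_eq (map_injective (ℐ.isom_injective h.apt h.isom) e)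

/-- An isomorphism fixing the germ carries it into `A`, where it has some direction; being parallel
to germs of the standard direction of `f` in the same apartment, it has this very direction. -/
theorem exists_eq (hJ : 𝔸.IsSpherical J) (h₀ : ℐ.IsSectorFaceGerm ε J F₀)
    (h : ℐ.Induces ε J F₀ A f g) (F : ℐ.Facade F₀) (hF : A ∈ F.1) : ∃ v, g v = F := by
  have hpar := (ℐ.parallel_iff_par hJ h₀ _).1 F.2
  have hpar' := hpar
  obtain ⟨A₁, hA₁, f₁, hf₁, x, y, h1, h2⟩ := hpar'
  have hF' := hF
  rw [h2] at hF'
  obtain ⟨f', hf', e⟩ := ℐ.exists_isom_of_germ hJ hA₁ h.apt hf₁ hF'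
  obtain ⟨w, hw, rfl⟩ := ℐ.exists_isom_eq_comp h.apt h.isom hf'
  rw [e, 𝔸.map_germ] at h2
  have hFH := (h.par hJ h₀ 0).symm.trans hJ hpar
  rw [h2] at hFH
  have hdir := ℐ.facetOf_eq_of_par hJ h.apt h.isom hFH
  refine ⟨(𝔸.VJ J).mkQ (w y), Subtype.ext ?_⟩
  rw [h.eq, h2, hdir]

theorem range_eq (hJ : 𝔸.IsSpherical J) (h₀ : ℐ.IsSectorFaceGerm ε J F₀)
    (h : ℐ.Induces ε J F₀ A f g) : Set.range g = ℐ.facadeApt F₀ A := by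
  ext F
  constructor
  · rintro ⟨v, rfl⟩
    exact h.mem v
  · exact fun hF => h.exists_eq hJ h₀ F hF

/-- If `f' = f ∘ w` also induces a map into the façade, then the linear part of `w` is in
`W^v(J)`. -/
theorem linear_mem_parabolic (hJ : 𝔸.IsSpherical J) (h₀ : ℐ.IsSectorFaceGerm ε J F₀)
    (h : ℐ.Induces ε J F₀ A f g) {w : V ≃ᵃ[ℝ] V} (hw : w ∈ 𝔸.W)
    (h' : ℐ.Induces ε J F₀ A (f ∘ w) g') : w.linear ∈ 𝔸.parabolic J := by
  have hpar := (h.par hJ h₀ 0).symm.trans hJ (h'.par hJ h₀ 0)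
  rw [𝔸.map_germ] at hpar
  have := ℐ.facetOf_eq_of_par hJ h.apt h.isom hpar
  rw [𝔸.facetOf_linear_eq] at this
  exact 𝔸.mem_parabolic_of_image_dir (𝔸.linear_mem_weyl hw) this

theorem map_comp (h : ℐ.Induces ε J F₀ A f g) {w : V ≃ᵃ[ℝ] V}
    (hl : w.linear ∈ 𝔸.parabolic J) (x : V) :
    map (f ∘ w) (𝔸.germ ε J x) = (g ((𝔸.VJ J).mkQ (w x))).1 := by
  rw [𝔸.map_germ, h.eq, 𝔸.facetOf_linear_eq, 𝔸.image_dir_of_mem_parabolic hl]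

theorem comp (h : ℐ.Induces ε J F₀ A f g) {k : (V ⧸ 𝔸.VJ J) ≃ᵃ[ℝ] (V ⧸ 𝔸.VJ J)}
    (hk : k ∈ 𝔸.WJ J) : ∃ f', ℐ.Induces ε J F₀ A f' (g ∘ k) := by
  obtain ⟨w, hw, hl, e⟩ := hk
  exact ⟨f ∘ w, h.apt, ℐ.isom_comp h.apt h.isom hw, fun x => by
    rw [h.map_comp hl, Function.comp_apply, e]⟩

/-- The filter of the façade attached to the germ of a chimney is a closed facet. -/
theorem facadeFilter_eq (hJ : 𝔸.IsSpherical J) (h₀ : ℐ.IsSectorFaceGerm ε J F₀)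
    (h : ℐ.Induces ε J F₀ A f g) (x : V) {u : V} {F : Set V} (hF : 𝔸.IsVectorialFacet F)
    (hu : u ∈ F) : ℐ.facadeFilter F₀ (map f (𝔸.chim ε J x F)) =
      map g (EuclideanBuilding.closedFacet (𝔸.wallsJ J) ((𝔸.VJ J).mkQ x) ((𝔸.VJ J).mkQ u)) := by
  have hmono : Monotone fun S : Set X => {G : ℐ.Facade F₀ | S ∈ G.1} :=
    fun S T hST G hG => mem_of_superset hG hST
  ext T
  unfold facadeFilter
  rw [mem_lift'_sets hmono, mem_map]
  constructor
  · rintro ⟨S, hS, hsub⟩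
    obtain ⟨D, hD, hDS, ⟨ξ, hξ, hsec⟩, hloc⟩ := 𝔸.exists_family_of_mem_chimneyGerm hF hS
    refine 𝔸.mem_closedFacet_of_family hJ hD hF hu hloc fun z hz => hsub ?_
    change S ∈ (g _).1
    rw [h.eq, mem_map]
    exact mem_of_superset ((hD.mem_germ_iff hJ hsec).2 hz) hDS
  · intro hT
    obtain ⟨S, hS, hsub, hsat, -, -⟩ := 𝔸.exists_enclosed_of_mem_closedFacet ε hF hu hT
    -- Any germ of the façade inside `f '' S` is in `A`, hence comes from some `z`; invariance of
    -- `S` under `V_J` then gives `z ∈ S`.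
    refine ⟨f '' S, image_mem_map hS, fun G hG => ?_⟩
    have hG' : f '' S ∈ G.1 := hG
    obtain ⟨v, rfl⟩ := h.exists_eq hJ h₀ G (mem_of_superset hG' (by
      rw [← ℐ.isom_range h.apt h.isom]
      exact Set.image_subset_range _ _))
    obtain ⟨z, rfl⟩ := (𝔸.VJ J).mkQ_surjective v
    rw [h.eq, mem_map, Set.preimage_image_eq _ (ℐ.isom_injective h.apt h.isom),
      𝔸.mem_germ] at hG'
    obtain ⟨ξ, hξ, hG'⟩ := hG'
    obtain ⟨η, hη⟩ := 𝔸.facetOf_nonempty ε 1 J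
    have := hG' η hη
    rw [add_assoc] at this
    exact hsub (hsat z _ (add_mem (𝔸.closure_dir_subset_VJ hξ) (𝔸.dir_subset_VJ hη)) this)

/-- If a façade apartment contains a closed facet, then the apartment contains the germ of a chimney
which defines this facet. -/
theorem exists_chim (hJ : 𝔸.IsSpherical J) (h : ℐ.Induces ε J F₀ A f g) (hA' : A' ∈ ℐ.apts)
    {x u : V} (hm : ℐ.facadeApt F₀ A' ∈ map g (EuclideanBuilding.closedFacet (𝔸.wallsJ J)
      ((𝔸.VJ J).mkQ x) ((𝔸.VJ J).mkQ u))) :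
    ∃ x' u' F, (𝔸.VJ J).mkQ x' = (𝔸.VJ J).mkQ x ∧ (𝔸.VJ J).mkQ u' = (𝔸.VJ J).mkQ u ∧
      𝔸.IsVectorialFacet F ∧ u' ∈ F ∧ A' ∈ map f (𝔸.chim ε J x' F) := by
  obtain ⟨n, hn, F, hF, hu⟩ := 𝔸.exists_vectorialFacet_add hJ u
  rw [mem_map, ← 𝔸.mkQ_add (x := u) hn] at hm
  obtain ⟨S, -, hsub, -, hloc, hxS⟩ := 𝔸.exists_enclosed_of_mem_closedFacet ε hF hu hm
  have key : ∀ z ∈ S, A' ∈ map f (𝔸.germ ε J z) := fun z hz => by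
    rw [← h.eq]
    exact hsub hz
  -- A second point in the direction `u + n`, so that `exists_chim_of_segment` can be applied to a
  -- segment with both end germs in `A'`.
  obtain ⟨t, ht, ht0⟩ := (((𝔸.tendsto_localFacet hF x hu).eventually hloc).and
    self_mem_nhdsWithin).exists
  have htu : t • (u + n) ∈ F := by
    obtain ⟨ε', w, hw, J', rfl⟩ := hF
    exact 𝔸.facetOf_smul hu ht0
  obtain ⟨m, hm', hc⟩ := ℐ.exists_chim_of_segment hJ h.apt hA' h.isom hF htu (key x hxS)
    (key _ ht)
  exact ⟨x + m, u + n, F, 𝔸.mkQ_add hm', 𝔸.mkQ_add hn, hF, hu, hc⟩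

theorem exists_of_eqOn (hJ : 𝔸.IsSpherical J) (h₀ : ℐ.IsSectorFaceGerm ε J F₀)
    (h : ℐ.Induces ε J F₀ A f g) (hA' : A' ∈ ℐ.apts) (hf' : f' ∈ ℐ.isom A') {S : Set V}
    (hS : ∀ y ∈ S, f y = f' y) {x : V} (hx : S ∈ 𝔸.germ ε J x) :
    ∃ g', ℐ.Induces ε J F₀ A' f' g' := by
  have := h.par hJ h₀ x
  rw [map_eq_of_eqOn hS hx] at this
  exact exists_induces hJ h₀ hA' hf' this

/-- The maps inducing a given apartment of the façade differ by elements of the group induced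
by `W^J`. -/
theorem exists_WJ (hJ : 𝔸.IsSpherical J) (h₀ : ℐ.IsSectorFaceGerm ε J F₀)
    (h : ℐ.Induces ε J F₀ A f g) (h' : ℐ.Induces ε J F₀ A' f' g')
    (hAA' : ℐ.facadeApt F₀ A = ℐ.facadeApt F₀ A') : ∃ k ∈ 𝔸.WJ J, g' = g ∘ k := by
  have hdir := 𝔸.isVectorialFacet_dir ε J
  have hall : ∀ z, A' ∈ map f (𝔸.germ ε J z) := fun z => by
    have : g ((𝔸.VJ J).mkQ z) ∈ ℐ.facadeApt F₀ A' := hAA' ▸ h.mem _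
    rw [← h.eq]
    exact this
  -- A regular direction: a chimney based at the chamber of `u` is thick enough to determine an
  -- isomorphism on the façade.
  obtain ⟨u, hu1⟩ := 𝔸.exists_root_eq fun _ => 1
  have hu : ∀ i, 0 < 𝔸.root i u := fun i => by rw [hu1]; exact one_pos
  have huF : u + 0 ∈ 𝔸.facetOf 1 1 ∅ := by
    rw [add_zero, 𝔸.mem_dir, one_smul]
    exact ⟨fun i hi => hi.elim, fun i _ => hu i⟩
  have hF := 𝔸.isVectorialFacet_dir 1 (∅ : Set I)
  obtain ⟨n, hn, hc⟩ := ℐ.exists_chim_of_segment hJ h.apt h'.apt h.isom hF huF (hall 0) (hall _)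
  rw [zero_add] at hc
  -- For each `z`, (MA4) provides an isomorphism onto `A'` which fixes both the thick chimney and
  -- the germ at `z`. It depends on `z`, but its restriction to the thick chimney does not.
  have key : ∀ z, ∃ f₁ g₁, ℐ.Induces ε J F₀ A' f₁ g₁ ∧
      g₁ ((𝔸.VJ J).mkQ z) = g ((𝔸.VJ J).mkQ z) ∧ g₁ ((𝔸.VJ J).mkQ n) = g ((𝔸.VJ J).mkQ n) ∧
      ∀ᶠ t : ℝ in 𝓝[>] 0,
        g₁ ((𝔸.VJ J).mkQ (n + t • u)) = g ((𝔸.VJ J).mkQ (n + t • u)) := by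
    intro z
    obtain ⟨m, hm, hcz⟩ := ℐ.exists_chim_of_germ hJ h.apt h'.apt h.isom (hall z)
    obtain ⟨f₁, hf₁, S, hS, hS1, hS2, heq⟩ :=
      ℐ.exists_isom_of_chim hJ h.apt h'.apt h.isom hF hdir hc hcz
    have hgn := 𝔸.chimneyGerm_mem_germ hJ hF hS1
    have hgz := 𝔸.chimneyGerm_mem_germ hJ hdir hS2
    rw [𝔸.germ_add _ _ hm] at hgz
    obtain ⟨g₁, hg₁⟩ := h.exists_of_eqOn hJ h₀ h'.apt hf₁ heq hgz
    refine ⟨f₁, g₁, hg₁, (h.apply_eq_of_mem hg₁ heq hgz).symm,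
      (h.apply_eq_of_mem hg₁ heq hgn).symm, ?_⟩
    filter_upwards [𝔸.eventually_mem_germ_of_mem_chim hJ hF (zero_mem _) huF hS1] with t ht
    exact (h.apply_eq_of_mem hg₁ heq ht).symm
  obtain ⟨f₁, g₁, hg₁, -, hn₁, ht₁⟩ := key 0
  have hgg₁ : g₁ = g := by
    funext v
    obtain ⟨z, rfl⟩ := (𝔸.VJ J).mkQ_surjective v
    obtain ⟨f₂, g₂, hg₂, hz, hn₂, ht₂⟩ := key z
    rw [← hz]
    obtain ⟨w, hw, rfl⟩ := ℐ.exists_isom_eq_comp hg₁.apt hg₁.isom hg₂.isom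
    have hl := hg₁.linear_mem_parabolic hJ h₀ hw hg₂
    have hw' : ∀ x, g₂ ((𝔸.VJ J).mkQ x) = g₁ ((𝔸.VJ J).mkQ (w x)) := fun x =>
      Subtype.ext (by rw [hg₂.eq, hg₁.map_comp hl])
    have e1 := (hw' n).symm.trans (hn₂.trans hn₁.symm)
    obtain ⟨t, ⟨ht1, ht2⟩, ht0⟩ := ((ht₁.and ht₂).and self_mem_nhdsWithin).exists
    have ht0' : (0 : ℝ) < t := ht0
    have e2 := (hw' _).symm.trans (ht2.trans ht1.symm)
    have e1' := 𝔸.mkQ_eq_iff.1 (hg₁.injective e1)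
    have e2' := 𝔸.mkQ_eq_iff.1 (hg₁.injective e2)
    -- Modulo `V_J`, `w` fixes both `n` and `n + t u`, so its linear part fixes the regular vector
    -- `u`. Hence `w` is a translation by a vector of `V_J`, and `g₂ = g₁`.
    have hlin : w.linear u - u ∈ 𝔸.VJ J := by
      have e : w.linear u - u = t⁻¹ • ((n - w n) - (n + t • u - w (n + t • u))) := by
        rw [ModelApartment.affineEquiv_add, map_smul]
        have : (n - w n) - (n + t • u - (w n + t • w.linear u)) = t • (w.linear u - u) := by
          rw [smul_sub]
          abel
        rw [this, smul_smul, inv_mul_cancel₀ ht0'.ne', one_smul]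
      rw [e]
      exact Submodule.smul_mem _ _ (sub_mem e1' e2')
    have hw1 := 𝔸.eq_one_of_sub_mem_VJ hJ hl hu hlin
    rw [hw' z]
    congr 1
    rw [eq_comm, 𝔸.mkQ_eq_iff]
    have e3 : z - w z = n - w n := by
      rw [ModelApartment.affineEquiv_apply w z, ModelApartment.affineEquiv_apply w n, hw1]
      simp only [LinearEquiv.coe_one, id_eq]
      abel
    rw [e3]
    exact e1'
  subst hgg₁
  obtain ⟨w, hw, rfl⟩ := ℐ.exists_isom_eq_comp hg₁.apt hg₁.isom h'.isom
  have hl := hg₁.linear_mem_parabolic hJ h₀ hw h'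
  obtain ⟨k, hk, hkw⟩ := 𝔸.exists_WJ_of_mem_W hw hl
  refine ⟨k, hk, ?_⟩
  funext v
  obtain ⟨x, rfl⟩ := (𝔸.VJ J).mkQ_surjective v
  exact Subtype.ext (by rw [h'.eq, hg₁.map_comp hl, Function.comp_apply, hkw])

end Induces

/-- An element of `W` normalizes the direction of the chimney to `ε F^v(J)`, at the price of moving
its base point and base facet. -/
theorem mem_facadeFacets_iff (hJ : 𝔸.IsSpherical J) (h₀ : ℐ.IsSectorFaceGerm ε J F₀)
    {𝓕 : Filter (ℐ.Facade F₀)} : 𝓕 ∈ ℐ.facadeFacets F₀ ↔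
      ∃ A f g x F, ℐ.Induces ε J F₀ A f g ∧ 𝔸.IsVectorialFacet F ∧
        𝓕 = ℐ.facadeFilter F₀ (map f (𝔸.chim ε J x F)) := by
  constructor
  · rintro ⟨R, ⟨A, hA, f, hf, x, F, Fv, hF, hFv, rfl, hpar⟩, rfl⟩
    have hpar := (ℐ.parallel_iff_par hJ h₀ _).1 hpar
    have hpar' := hpar
    obtain ⟨A₁, hA₁, f₁, hf₁, a, b, -, h2⟩ := hpar'
    obtain ⟨w, hw, rfl⟩ := ℐ.exists_facet_eq_image hJ hA₁ hA hf₁ hf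
      (isVectorialFacet_of_isSphericalFacet hFv) h2.symm
    rw [← map_comp_germ_inv] at hpar
    obtain ⟨g, hg⟩ := exists_induces hJ h₀ hA (ℐ.isom_comp hA hf hw) hpar
    refine ⟨A, f ∘ w, g, w⁻¹ x, w⁻¹.linear '' F, hg, ?_, ?_⟩
    · obtain ⟨ε', v, hv, J', rfl⟩ := hF
      refine ⟨ε', w⁻¹.linear * v, mul_mem (𝔸.linear_mem_weyl (inv_mem hw)) hv, J', ?_⟩
      rw [RootBasis.image_facetOf]
    · have e := ModelApartment.inv_linear_image w⁻¹ F
      rw [inv_inv] at e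
      rw [← map_map, 𝔸.map_chimneyGerm hw, ModelApartment.affineEquiv_apply_inv, e]
  · rintro ⟨A, f, g, x, F, hg, hF, rfl⟩
    exact ⟨_, ⟨A, hg.apt, f, hg.isom, x, F, _, hF, 𝔸.isSphericalFacet_dir hJ ε, rfl,
      (ℐ.parallel_iff_par hJ h₀ _).2 (hg.par hJ h₀ x)⟩, rfl⟩

/-- A facet contained in the apartment may have been defined in another one. `Induces.exists_chim`
finds a defining chimney germ lying in `A`, and (MA4) rewrites it as a chimney germ seen from `f`.
-/
theorem facet_iff (hJ : 𝔸.IsSpherical J) (h₀ : ℐ.IsSectorFaceGerm ε J F₀)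
    (h : ℐ.Induces ε J F₀ A f g) (𝓕 : Filter (ℐ.Facade F₀)) :
    (𝓕 ∈ ℐ.facadeFacets F₀ ∧ ℐ.facadeApt F₀ A ∈ 𝓕) ↔
      ∃ x u, 𝓕 = map g (EuclideanBuilding.closedFacet (𝔸.wallsJ J) x u) := by
  constructor
  · rintro ⟨hfac, hm⟩
    obtain ⟨A₁, f₁, g₁, x, F, h₁, hF, rfl⟩ := (mem_facadeFacets_iff hJ h₀).1 hfac
    obtain ⟨u, hu⟩ := 𝔸.vectorialFacet_nonempty hF
    rw [h₁.facadeFilter_eq hJ h₀ x hF hu] at hm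
    obtain ⟨x', u', F', hx', hu', hF', huF', hc⟩ := h₁.exists_chim hJ h.apt hm
    rw [h₁.facadeFilter_eq hJ h₀ x hF hu, ← hx', ← hu', ← h₁.facadeFilter_eq hJ h₀ x' hF' huF']
    obtain ⟨f₂, hf₂, S, hS, hS1, -, heq⟩ :=
      ℐ.exists_isom_of_chim hJ h₁.apt h.apt h₁.isom hF' hF' hc hc
    obtain ⟨g₂, hg₂⟩ := h₁.exists_of_eqOn hJ h₀ h.apt hf₂ heq
      (𝔸.chimneyGerm_mem_germ hJ hF' hS1)
    obtain ⟨w, hw, rfl⟩ := ℐ.exists_isom_eq_comp h.apt h.isom hf₂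
    have hl := h.linear_mem_parabolic hJ h₀ hw hg₂
    have hFw : 𝔸.IsVectorialFacet (w.linear '' F') := by
      obtain ⟨ε', v, hv, J', rfl⟩ := hF'
      refine ⟨ε', w.linear * v, mul_mem (𝔸.linear_mem_weyl hw) hv, J', ?_⟩
      rw [RootBasis.image_facetOf]
    refine ⟨(𝔸.VJ J).mkQ (w x'), (𝔸.VJ J).mkQ (w.linear u'), ?_⟩
    rw [map_eq_of_eqOn heq hS1, ← map_map, 𝔸.map_chimneyGerm hw,
      𝔸.image_dir_of_mem_parabolic hl]
    exact h.facadeFilter_eq hJ h₀ (w x') hFw (Set.mem_image_of_mem _ huF')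
  · rintro ⟨v, v', rfl⟩
    obtain ⟨x, rfl⟩ := (𝔸.VJ J).mkQ_surjective v
    obtain ⟨u, rfl⟩ := (𝔸.VJ J).mkQ_surjective v'
    constructor
    · obtain ⟨n, hn, F, hF, hu⟩ := 𝔸.exists_vectorialFacet_add hJ u
      rw [mem_facadeFacets_iff hJ h₀]
      refine ⟨A, f, g, x, F, h, hF, ?_⟩
      rw [h.facadeFilter_eq hJ h₀ x hF hu, 𝔸.mkQ_add hn]
    · rw [mem_map]
      exact univ_mem' h.mem

/-- A facet of the façade contained in two apartments comes from the germ of a chimney contained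
in both. -/
theorem Induces.exists_facadeFilter_eq (hJ : 𝔸.IsSpherical J) (h₀ : ℐ.IsSectorFaceGerm ε J F₀)
    (h : ℐ.Induces ε J F₀ A f g) (hA' : A' ∈ ℐ.apts) {𝓕 : Filter (ℐ.Facade F₀)}
    (h𝓕 : 𝓕 ∈ ℐ.facadeFacets F₀) (hm : ℐ.facadeApt F₀ A ∩ ℐ.facadeApt F₀ A' ∈ 𝓕) :
    ∃ x F, 𝔸.IsVectorialFacet F ∧ 𝓕 = ℐ.facadeFilter F₀ (map f (𝔸.chim ε J x F)) ∧
      A' ∈ map f (𝔸.chim ε J x F) := by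
  obtain ⟨v, v', rfl⟩ := (facet_iff hJ h₀ h 𝓕).1 ⟨h𝓕, mem_of_superset hm Set.inter_subset_left⟩
  obtain ⟨x, rfl⟩ := (𝔸.VJ J).mkQ_surjective v
  obtain ⟨u, rfl⟩ := (𝔸.VJ J).mkQ_surjective v'
  obtain ⟨x', u', F, hx, hu, hF, hu', hc⟩ :=
    h.exists_chim hJ hA' (mem_of_superset hm Set.inter_subset_right)
  exact ⟨x', F, hF, by rw [h.facadeFilter_eq hJ h₀ x' hF hu', hx, hu], hc⟩

end Masure

/-! ### The axioms of a Euclidean building for the façade. -/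

theorem proposition4p3 {V : Type*} [NormedAddCommGroup V] [NormedSpace ℝ V]
    [FiniteDimensional ℝ V] {I : Type*} [Fintype I] (𝔸 : ModelApartment V I)
    {X : Type*} (ℐ : Masure 𝔸 X) (ε : ℤˣ) (J : Set I) (hJ : 𝔸.IsSpherical J)
    (F₀ : Filter X) (hF₀ : ℐ.IsSectorFaceGerm ε J F₀) :
    ∃ B : LinearMap.BilinForm ℝ (V ⧸ 𝔸.VJ J),
      EuclideanBuilding.IsEuclideanBuilding B (𝔸.wallsJ J) (𝔸.WJ J)
        (ℐ.facadeApts F₀) (ℐ.facadeIsom ε J F₀) (ℐ.facadeFacets F₀) := by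
  refine ⟨𝔸.formBar hJ, ?_⟩
  have hex : ∀ B ∈ ℐ.facadeApts F₀, ∃ A f g, ℐ.Induces ε J F₀ A f g ∧ B = ℐ.facadeApt F₀ A := by
    rintro _ ⟨A, hA, ⟨F, hF⟩, rfl⟩
    obtain ⟨f, g, h⟩ := Masure.exists_induces_of_mem hJ hF₀ hA F hF
    exact ⟨A, f, g, h, rfl⟩
  exact {
    apartment := 𝔸.isEuclideanApartment hJ
    weyl_le := 𝔸.weylGroup_le_WJ hJ
    linear_mem := fun g hg => 𝔸.WJ_linear_mem hJ hg
    isometry := fun g hg => 𝔸.WJ_isometry hJ hg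
    walls_stable := fun g hg M hM => 𝔸.WJ_walls_stable hg hM
    cover := by
      refine Set.eq_univ_of_forall fun F => ?_
      obtain ⟨A, hA, f, hf, x, y, Fv, -, -, h2⟩ := F.2
      have hm : A ∈ F.1 := h2 ▸ ℐ.apt_mem_map hA hf _
      exact ⟨_, ⟨A, hA, ⟨F, hm⟩, rfl⟩, hm⟩
    I0 := by
      intro B hB
      obtain ⟨A₀, f₀, g₀, h₀, e₀⟩ := hex B hB
      refine ⟨⟨g₀, ℐ.mem_facadeIsom_iff.2 ⟨A₀, f₀, h₀, e₀⟩⟩, fun g hg => ?_⟩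
      obtain ⟨A, f, h, rfl⟩ := ℐ.mem_facadeIsom_iff.1 hg
      refine ⟨h.injective, h.range_eq hJ hF₀, fun g' => ⟨fun hg' => ?_, ?_⟩⟩
      · obtain ⟨A', f', h', e'⟩ := ℐ.mem_facadeIsom_iff.1 hg'
        exact h.exists_WJ hJ hF₀ h' e'
      · rintro ⟨k, hk, rfl⟩
        obtain ⟨f', h'⟩ := h.comp hk
        exact ℐ.mem_facadeIsom_iff.2 ⟨A, f', h', rfl⟩
    I0_facets := by
      intro B hB g hg 𝓕
      obtain ⟨A, f, h, rfl⟩ := ℐ.mem_facadeIsom_iff.1 hg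
      exact Masure.facet_iff hJ hF₀ h 𝓕
    I1 := by
      intro 𝓕 h𝓕 𝓕' h𝓕'
      obtain ⟨A₁, f₁, g₁, x, F, h₁, hF, rfl⟩ := (Masure.mem_facadeFacets_iff hJ hF₀).1 h𝓕
      obtain ⟨A₂, f₂, g₂, y, F', h₂, hF', rfl⟩ := (Masure.mem_facadeFacets_iff hJ hF₀).1 h𝓕'
      -- The same kind of chimney germ enters (MA3) once as splayed and once as solid.
      obtain ⟨A, hA, hm, hm'⟩ := ℐ.MA3 A₁ h₁.apt A₂ h₂.apt f₁ h₁.isom f₂ h₂.isom _ _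
        (Masure.isSplayed_chim hJ x hF) (Masure.isSolid_chim hJ y hF')
      refine ⟨_, ⟨A, hA, ⟨g₁ ((𝔸.VJ J).mkQ x), ?_⟩, rfl⟩,
        Masure.facadeApt_mem_facadeFilter hm, Masure.facadeApt_mem_facadeFilter hm'⟩
      change A ∈ (g₁ _).1
      rw [h₁.eq]
      exact 𝔸.chimneyGerm_mem_germ hJ hF hm
    I2_union := by
      intro B hB B' hB' y hy
      obtain ⟨A, f, g, h, rfl⟩ := hex B hB
      obtain ⟨A', hA', -, rfl⟩ := hB'
      obtain ⟨v, rfl⟩ := h.exists_eq hJ hF₀ y hy.1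
      obtain ⟨z, rfl⟩ := (𝔸.VJ J).mkQ_surjective v
      have hz : A' ∈ map f (𝔸.germ ε J z) := by
        rw [← h.eq]
        exact hy.2
      have hdir := 𝔸.isVectorialFacet_dir ε J
      obtain ⟨η, hη⟩ := 𝔸.facetOf_nonempty ε 1 J
      -- The facet through the given point is the one defined by the thin chimney.
      obtain ⟨n, hn, hc⟩ := ℐ.exists_chim_of_germ hJ h.apt hA' h.isom hz
      refine ⟨ℐ.facadeFilter F₀ (map f (𝔸.chim ε J (z + n) (𝔸.facetOf ε 1 J))),
        (Masure.mem_facadeFacets_iff hJ hF₀).2 ⟨A, f, g, z + n, _, h, hdir, rfl⟩, ?_,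
        inter_mem (Masure.facadeApt_mem_facadeFilter (ℐ.apt_mem_map h.apt h.isom _))
          (Masure.facadeApt_mem_facadeFilter hc)⟩
      intro T hT
      rw [h.facadeFilter_eq hJ hF₀ _ hdir hη, 𝔸.mkQ_add hn, mem_map] at hT
      obtain ⟨S, -, hsub, -, -, hxS⟩ := 𝔸.exists_enclosed_of_mem_closedFacet ε hdir hη hT
      exact hsub hxS
    I2_isom := by
      intro B hB B' hB' 𝓕 h𝓕 𝓕' h𝓕' hm hm'
      obtain ⟨A, f, g, h, rfl⟩ := hex B hB
      obtain ⟨A', hA', -, rfl⟩ := hB'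
      obtain ⟨x, F, hF, rfl, hc⟩ := h.exists_facadeFilter_eq hJ hF₀ hA' h𝓕 hm
      obtain ⟨y, F', hF', rfl, hc'⟩ := h.exists_facadeFilter_eq hJ hF₀ hA' h𝓕' hm'
      -- One enclosed set `S` contains both chimney germs, so the same member `f '' S` witnesses
      -- that both facets are fixed.
      obtain ⟨f', hf', S, -, hS, hS', heq⟩ :=
        ℐ.exists_isom_of_chim hJ h.apt hA' h.isom hF hF' hc hc'
      obtain ⟨g', h'⟩ := h.exists_of_eqOn hJ hF₀ hA' hf' heq (𝔸.chimneyGerm_mem_germ hJ hF hS)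
      have hfix : ∀ p, g p ∈ {G : ℐ.Facade F₀ | f '' S ∈ G.1} → g' p = g p := by
        intro p hp
        obtain ⟨z, rfl⟩ := (𝔸.VJ J).mkQ_surjective p
        rw [Set.mem_ofPred_eq, h.eq, mem_map,
          Set.preimage_image_eq _ (ℐ.isom_injective h.apt h.isom)] at hp
        exact (h.apply_eq_of_mem h' heq hp).symm
      exact ⟨g, ℐ.mem_facadeIsom_iff.2 ⟨A, f, h, rfl⟩, g', ℐ.mem_facadeIsom_iff.2 ⟨A', f', h', rfl⟩,
        ⟨_, mem_lift' (image_mem_map hS), hfix⟩, ⟨_, mem_lift' (image_mem_map hS'), hfix⟩⟩ }
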